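/- Let $N$ be a square-free positive integer, $k\ge 4$ an integer, $\chi$ a Dirichlet character modulo $N$, and $\rho=(N_0,N_1,N_2)$ positive integers with $N_0N_1N_2=N$. For $M\mid N$ let $\chi_M$ denote the component of $\chi$ modulo $M$, so that $\chi=\chi_M\chi_{N/M}$ with $\chi_M$ a character modulo $M$; assume $\chi_{N_1}^2=1$. Write elements of $Sp_2(\mathbb Z)$ ($4\times4$ integral symplectic matrices) in $2\times2$ blocks as $\gamma=\begin{pmatrix}A_\gamma&B_\gamma\\C_\gamma&D_\gamma\end{pmatrix}$; let $\Gamma_0(N)=\{\gamma\in Sp_2(\mathbb Z):C_\gamma\equiv0\ (N)\}$ and $\Gamma_\infty^+=\{\gamma\in Sp_2(\mathbb Z): C_\gamma=0,\ \det D_\gamma=1\}$. Let $\mathfrak h_{(2)}$ be the space of symmetric complex $2\times2$ matrices with positive definite imaginary part. For a real matrix $g=\begin{pmatrix}A&B\\C&D\end{pmatrix}$ with $g\circ\tau=(A\tau+B)(C\tau+D)^{-1}$, put $f(\tau)|g=(\det g)^{k/2}\det(C\tau+D)^{-k}f(g\circ\tau)$. For a triple $\rho=(N_0,N_1,N_2)$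 with product $N$, let $M_\rho$ be any integral diagonal matrix which, modulo each prime $p\mid N$, is congruent to $0$ if $p\mid N_0$, to $\begin{pmatrix}1&0\\0&0\end{pmatrix}$ if $p\mid N_1$, and to $I$ if $p\mid N_2$; let $\gamma_\rho=\begin{pmatrix}I&0\\M_\rho&I\end{pmatrix}$, and define the Eisenstein series $$\mathbb E_\rho(\tau)=\tfrac12\sum_{\gamma}\overline\chi(\det D_\gamma)\,\det\!\left(C_{\gamma_\rho\gamma}\tau+D_{\gamma_\rho\gamma}\right)^{-k}\qquad(\tau\in\mathfrak h_{(2)}),$$ where $\gamma$ varies over elements of $\Gamma_0(N)$ such that $\Gamma_\infty^+\gamma_\rho\gamma$ runs exactly once through the $\Gamma_0(N)$-orbit of $\Gamma_\infty^+\gamma_\rho$. For a prime $p$ define $$f|T_1(p^2)=p^{k-3}\sum_\gamma\overline\chi(\det D_\gamma)\,f|\delta_1^{-1}\gamma,\qquad \delta_1=\begin{pmatrix}X&\\&X^{-1}\end{pmatrix},\quad X=\begin{pmatrix}p&\\&1\end{pmatrix},$$ where $\gamma$ varies over a set of coset representatives for $(\delta_1\Gamma_0(N)\delta_1^{-1}\cap\Gamma_0(N))\backslash\Gamma_0(N)$.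 Proposition 3.9. Let $q$ be a prime dividing $N_1$ and set $\rho'=(N_0,N_1/q,qN_2)$. If $\chi_q=1$ (the trivial character modulo $q$), then $$\mathbb E_\rho|T_1(q^2)=\left(\chi_{N_0}(q^2)q^{2k-2}+\chi_{N_2}(q^2)q\right)\mathbb E_\rho+q^{-1}\left(\chi_{N/q}(q)q^{k-2}+\chi_{N_2}(q^2)\right)(q^2-1)\,\mathbb E_{\rho'},$$ and if $\chi_q\ne1$, then $$\mathbb E_\rho|T_1(q^2)=\left(\chi_{N_0}(q^2)q^{2k-2}+\chi_{N_2}(q^2)q\right)\mathbb E_\rho .$$ -/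

import Mathlib

open scoped Matrix

namespace SiegelDegTwo

/-- `Sp_2(ℤ)`: the integral symplectic `4 × 4` matrices, in `2 × 2` blocks `(A B; C D)`. -/
abbrev Sp : Type := Matrix.symplecticGroup (Fin 2) ℤ

/-- The block `C` of `γ = (A B; C D)`. -/
def blockC (γ : Sp) : Matrix (Fin 2) (Fin 2) ℤ :=
  (γ : Matrix (Fin 2 ⊕ Fin 2) (Fin 2 ⊕ Fin 2) ℤ).toBlocks₂₁

/-- The block `D` of `γ = (A B; C D)`. -/
def blockD (γ : Sp) : Matrix (Fin 2) (Fin 2) ℤ :=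
  (γ : Matrix (Fin 2 ⊕ Fin 2) (Fin 2 ⊕ Fin 2) ℤ).toBlocks₂₂

theorem blockC_mul (γ δ : Sp) :
    blockC (γ * δ) = blockC γ * (δ : Matrix (Fin 2 ⊕ Fin 2) (Fin 2 ⊕ Fin 2) ℤ).toBlocks₁₁
      + blockD γ * blockC δ := by
  ext i j
  simp [blockC, blockD, Matrix.toBlocks₂₁, Matrix.toBlocks₂₂, Matrix.toBlocks₁₁, Matrix.mul_apply]

theorem blockD_mul (γ δ : Sp) :
    blockD (γ * δ) = blockC γ * (δ : Matrix (Fin 2 ⊕ Fin 2) (Fin 2 ⊕ Fin 2) ℤ).toBlocks₁₂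
      + blockD γ * blockD δ := by
  ext i j
  simp [blockC, blockD, Matrix.toBlocks₂₁, Matrix.toBlocks₂₂, Matrix.toBlocks₁₂, Matrix.mul_apply]

theorem blockC_one : blockC 1 = 0 := by
  ext i j
  simp [blockC, Matrix.toBlocks₂₁]

theorem blockD_one : blockD 1 = 1 := by
  ext i j
  simp [blockD, Matrix.toBlocks₂₂, Matrix.one_apply]

theorem blockC_inv (γ : Sp) : blockC γ⁻¹ = -(blockC γ)ᵀ := by
  ext i j
  simp [blockC, Matrix.toBlocks₂₁, SymplecticGroup.coe_inv, Matrix.J, Matrix.mul_apply,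
    Matrix.one_apply]

/-- `Γ_0(N)`: the elements of `Sp_2(ℤ)` with `C ≡ 0` modulo `N`. -/
def Gamma0 (N : ℕ) : Subgroup Sp where
  carrier := {γ | ∀ i j, (N : ℤ) ∣ blockC γ i j}
  one_mem' := by
    intro i j
    simp [blockC_one]
  mul_mem' := by
    intro γ δ hγ hδ i j
    rw [blockC_mul, Matrix.add_apply, Matrix.mul_apply, Matrix.mul_apply]
    exact dvd_add (Finset.dvd_sum fun l _ => (hγ i l).mul_right _)
      (Finset.dvd_sum fun l _ => (hδ l j).mul_left _)
  inv_mem' := by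
    intro γ hγ i j
    rw [blockC_inv]
    simpa using hγ j i

/-- `Γ_∞⁺`: the elements `(A B; 0 D)` of `Sp_2(ℤ)` with `det D = 1`. Two elements of `Sp_2(ℤ)` lie
in the same coset of `Γ_∞⁺` exactly when their bottom rows `(M N)` are `SL_2(ℤ)`-equivalent. -/
def GammaInf : Subgroup Sp where
  carrier := {γ | blockC γ = 0 ∧ (blockD γ).det = 1}
  one_mem' := by simp [blockC_one, blockD_one]
  mul_mem' := by
    rintro γ δ ⟨h1, h2⟩ ⟨h3, h4⟩
    exact ⟨by simp [blockC_mul, h1, h3], by simp [blockD_mul, h1, h2, h4]⟩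
  inv_mem' := by
    rintro γ ⟨h1, h2⟩
    refine ⟨by simp [blockC_inv, h1], ?_⟩
    have h := blockD_mul γ γ⁻¹
    rw [mul_inv_cancel, blockD_one, h1, Matrix.zero_mul, zero_add] at h
    have h' := congrArg Matrix.det h
    rw [Matrix.det_mul, h2, one_mul, Matrix.det_one] at h'
    exact h'.symm

/-- The Siegel upper half-space of degree 2: symmetric complex `2 × 2` matrices with positive
definite imaginary part. -/
def upperHalfSpace : Set (Matrix (Fin 2) (Fin 2) ℂ) :=
  {τ | τ.IsSymm ∧ (τ.map Complex.im).PosDef}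

/-- The matrix `Cτ + D`, for a real matrix `g = (A B; C D)`. -/
noncomputable def denom (g : Matrix (Fin 2 ⊕ Fin 2) (Fin 2 ⊕ Fin 2) ℝ)
    (τ : Matrix (Fin 2) (Fin 2) ℂ) : Matrix (Fin 2) (Fin 2) ℂ :=
  g.toBlocks₂₁.map Complex.ofReal * τ + g.toBlocks₂₂.map Complex.ofReal

/-- The matrix `g ∘ τ = (Aτ + B)(Cτ + D)⁻¹`, for a real matrix `g = (A B; C D)`. -/
noncomputable def act (g : Matrix (Fin 2 ⊕ Fin 2) (Fin 2 ⊕ Fin 2) ℝ)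
    (τ : Matrix (Fin 2) (Fin 2) ℂ) : Matrix (Fin 2) (Fin 2) ℂ :=
  (g.toBlocks₁₁.map Complex.ofReal * τ + g.toBlocks₁₂.map Complex.ofReal) * (denom g τ)⁻¹

/-- The weight `k` slash operator: `(f|g)(τ) = (det g)^{k/2} det(Cτ + D)^{-k} f(g ∘ τ)`. -/
noncomputable def slash (k : ℕ) (f : Matrix (Fin 2) (Fin 2) ℂ → ℂ)
    (g : Matrix (Fin 2 ⊕ Fin 2) (Fin 2 ⊕ Fin 2) ℝ) (τ : Matrix (Fin 2) (Fin 2) ℂ) : ℂ :=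
  ((g.det ^ ((k : ℝ) / 2) : ℝ) : ℂ) * (denom g τ).det ^ (-(k : ℤ)) * f (act g τ)

/-- An integral symplectic matrix, as a real matrix. -/
def toReal (γ : Sp) : Matrix (Fin 2 ⊕ Fin 2) (Fin 2 ⊕ Fin 2) ℝ :=
  (γ : Matrix (Fin 2 ⊕ Fin 2) (Fin 2 ⊕ Fin 2) ℤ).map Int.cast

theorem toReal_one : toReal 1 = 1 := by
  simp [toReal]

theorem toReal_mul (γ δ : Sp) : toReal (γ * δ) = toReal γ * toReal δ := by
  have h := Matrix.map_mul (L := (γ : Matrix (Fin 2 ⊕ Fin 2) (Fin 2 ⊕ Fin 2) ℤ))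
    (M := (δ : Matrix (Fin 2 ⊕ Fin 2) (Fin 2 ⊕ Fin 2) ℤ)) (f := Int.castRingHom ℝ)
  simpa [toReal] using h

/-- For `γ_0 ∈ Sp_2(ℤ)`: the subgroup `γ_0⁻¹ Γ_∞⁺ γ_0 ∩ Γ_0(N)` of `Γ_0(N)`, which is the stabiliser
of the coset `Γ_∞⁺ γ_0` under right multiplication by `Γ_0(N)`. -/
def cuspStabilizer (N : ℕ) (γ₀ : Sp) : Subgroup (Gamma0 N) :=
  (GammaInf.comap (MulAut.conj γ₀).toMonoidHom).subgroupOf (Gamma0 N)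

/-- The Siegel Eisenstein series of degree 2, weight `k`, level `N` and character `χ` attached to
`γ_0 ∈ Sp_2(ℤ)`:
`2 E_{γ_0}(τ) = ∑ conj (χ (det D_γ)) (1|γ_0 γ)(τ)`,
the cosets `Γ_∞⁺ γ_0 γ` running once over the `Γ_0(N)`-orbit of `Γ_∞⁺ γ_0`.
Here `(1|g)(τ) = det (C τ + D)^{-k}` for `g = (A B; C D)`. The factor 2 is there because every coset
of `Γ_∞ = {(* *; 0 *)}` consists of two cosets of `Γ_∞⁺`; their terms agree if `χ(-1) = (-1)^k`,
and otherwise they cancel. -/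
noncomputable def eisenstein (k N : ℕ) (χ : DirichletCharacter ℂ N) (γ₀ : Sp)
    (τ : Matrix (Fin 2) (Fin 2) ℂ) : ℂ :=
  (1 / 2 : ℂ) * ∑' c : Quotient (QuotientGroup.rightRel (cuspStabilizer N γ₀)),
    (starRingEnd ℂ) (χ (((blockD (c.out : Sp)).det : ℤ) : ZMod N)) *
      (denom (toReal (γ₀ * (c.out : Sp))) τ).det ^ (-(k : ℤ))

/-- `γ_M = (I 0; M I)` for the diagonal matrix `M` with diagonal `d`. -/
def cuspRep (d : Fin 2 → ℤ) : Sp :=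
  ⟨Matrix.fromBlocks 1 0 (Matrix.diagonal d) 1, by
    rw [SymplecticGroup.fromBlocks_mem_iff]
    simp⟩

/-- The diagonal matrix `M` with diagonal `d` is an admissible choice of `M_ρ` for
`ρ = (N_0, N_1, N_2)`: modulo every prime `p`, it is `0` if `p ∣ N_0`, `(1 0; 0 0)` if `p ∣ N_1`, and
`I` if `p ∣ N_2`. -/
def IsCuspDiagonal (N₀ N₁ N₂ : ℕ) (d : Fin 2 → ℤ) : Prop :=
  ∀ p : ℕ, p.Prime →
    (p ∣ N₀ → (Matrix.diagonal d).map (Int.cast : ℤ → ZMod p) = 0) ∧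
    (p ∣ N₁ → (Matrix.diagonal d).map (Int.cast : ℤ → ZMod p) = !![1, 0; 0, 0]) ∧
    (p ∣ N₂ → (Matrix.diagonal d).map (Int.cast : ℤ → ZMod p) = 1)

/-- `δ_1 = (X 0; 0 X⁻¹)` with `X = (p 0; 0 1)`. -/
noncomputable def delta1 (p : ℕ) : Matrix (Fin 2 ⊕ Fin 2) (Fin 2 ⊕ Fin 2) ℝ :=
  Matrix.fromBlocks !![(p : ℝ), 0; 0, 1] 0 0 !![(p : ℝ)⁻¹, 0; 0, 1]

/-- The subgroup `δ_1 Γ_0(N) δ_1⁻¹ ∩ Γ_0(N)` of `Γ_0(N)`. The condition `γ δ_1 = δ_1 γ'` says that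
`γ = δ_1 γ' δ_1⁻¹`. -/
def heckeSubgroup (N p : ℕ) : Subgroup (Gamma0 N) where
  carrier := {γ | ∃ γ' : Gamma0 N, toReal γ * delta1 p = delta1 p * toReal γ'}
  one_mem' := ⟨1, by simp [toReal_one]⟩
  mul_mem' := by
    rintro a b ⟨a', ha⟩ ⟨b', hb⟩
    refine ⟨a' * b', ?_⟩
    rw [Subgroup.coe_mul, Subgroup.coe_mul, toReal_mul, toReal_mul, Matrix.mul_assoc, hb,
      ← Matrix.mul_assoc, ha, Matrix.mul_assoc]
  inv_mem' := by
    rintro a ⟨a', ha⟩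
    refine ⟨a'⁻¹, ?_⟩
    have h1 : toReal ((a : Sp)⁻¹) * toReal a = 1 := by
      rw [← toReal_mul, inv_mul_cancel, toReal_one]
    have h2 : toReal a' * toReal ((a' : Sp)⁻¹) = 1 := by
      rw [← toReal_mul, mul_inv_cancel, toReal_one]
    rw [Subgroup.coe_inv, Subgroup.coe_inv]
    calc toReal ((a : Sp)⁻¹) * delta1 p
        = toReal ((a : Sp)⁻¹) * delta1 p * (toReal a' * toReal ((a' : Sp)⁻¹)) := by
          rw [h2, Matrix.mul_one]
      _ = toReal ((a : Sp)⁻¹) * (delta1 p * toReal a') * toReal ((a' : Sp)⁻¹) := by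
          simp only [Matrix.mul_assoc]
      _ = toReal ((a : Sp)⁻¹) * toReal a * (delta1 p * toReal ((a' : Sp)⁻¹)) := by
          rw [← ha]
          simp only [Matrix.mul_assoc]
      _ = delta1 p * toReal ((a' : Sp)⁻¹) := by rw [h1, Matrix.one_mul]

/-- The Hecke operator `T_1(p²)` in weight `k`, level `N`, character `χ`:
`f|T_1(p²) = p^{k-3} ∑_γ conj (χ (det D_γ)) f|δ_1⁻¹ γ`, where `γ` runs over representatives of
`(δ_1 Γ_0(N) δ_1⁻¹ ∩ Γ_0(N)) \ Γ_0(N)`, a finite set. -/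
noncomputable def heckeT1 (k N : ℕ) (χ : DirichletCharacter ℂ N) (p : ℕ)
    (f : Matrix (Fin 2) (Fin 2) ℂ → ℂ) (τ : Matrix (Fin 2) (Fin 2) ℂ) : ℂ :=
  (p : ℂ) ^ ((k : ℤ) - 3) * ∑ᶠ c : Quotient (QuotientGroup.rightRel (heckeSubgroup N p)),
    (starRingEnd ℂ) (χ (((blockD (c.out : Sp)).det : ℤ) : ZMod N)) *
      slash k f ((delta1 p)⁻¹ * toReal (c.out : Sp)) τ

open scoped Classical in
/-- The component `χ_M`, a character modulo `M`, of a character `χ` modulo `N`, where `M ∣ N` with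
`M` and `N / M` coprime: `χ_M(a) = χ(b)`, where `b ≡ a` modulo `M` and `b ≡ 1` modulo `N / M`. So
`χ = χ_M χ_{N/M}`. (For other `M` the value is irrelevant, and is set to `1`.) -/
noncomputable def component {N : ℕ} (χ : DirichletCharacter ℂ N) (M : ℕ) :
    DirichletCharacter ℂ M :=
  if h : M ∣ N ∧ M.Coprime (N / M) then
    { toFun := fun a => χ (ZMod.ringEquivCongr (Nat.mul_div_cancel' h.1)
        ((ZMod.chineseRemainder h.2).symm (a, 1)))
      map_one' := by
        rw [← Prod.one_eq_mk, map_one, map_one, map_one]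
      map_mul' := by
        intro a b
        rw [← map_mul, ← map_mul, ← map_mul, Prod.mk_mul_mk, one_mul]
      map_nonunit' := by
        intro a ha
        refine χ.map_nonunit fun hu => ha ?_
        rw [isUnit_map_iff, isUnit_map_iff, Prod.isUnit_iff] at hu
        exact hu.1 }
  else 1

end SiegelDegTwo

namespace SiegelDegTwo

/-! A coset of `GammaInf` in `Sp` is determined by the 2×2 minors of its bottom rows `(C D)`,
exactly and not only up to sign because `det D = 1` on `GammaInf`. Since `C Dᵀ = D Cᵀ`, the matrix
`adj(C) D` is symmetric, which leaves five coordinates `(c, a, b, e, d)` with `c d = a e - b²`.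
Every primitive integral solution of this equation occurs (`exists_plucker_eq`). `Sp` acts linearly
on these vectors, and `det (C τ + D)` is a linear form in them (`det_denom`).

The Eisenstein series thereby becomes half the sum of `weight v * linForm τ v ^ (-k)` over all
primitive isotropic `v`, where the weight is a product of factors at the primes `p ∣ N`. For `p ∣
N₀` the factor is `χ_p⁻¹(d)` on `c = a = b = e = 0`; for `p ∣ N₁` it is `χ_p` of any nonzero value
of the form `(a b; b e)` on `c = 0`, well defined because this form has rank at most one and `χ_p`
is quadratic; for `p ∣ N₂` it is `χ_p(c)`. This is `eisenstein_eq_tsum`. It rests on the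
transformation law `weight_act` under `Γ_0(N)` and on the support being a single orbit
(`exists_plucker_cuspRep_mul_eq`).

Up to a factor `q`, `δ_1` acts by `v ↦ (q² c, a, q b, q² e, d)`, whose content is `q^m` with `m ≤
2`. Dividing by the content permutes the cusps, and slashing by `δ_1⁻¹ γ` replaces the coefficient
`f v` by `f (dilateCusp (v γ⁻¹)) q^((m-1)k)` (`slash_tsum`). The inverses of the Hecke
representatives are products of a point of `P¹(F_q)` and a translation by `(x y; y 0)` with `y`
modulo `q` and `x` modulo `q²`, so each coefficient of the image is a finite sum of `(q+1) q³`
terms.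

In that sum the primes `p ≠ q` contribute only a constant depending on `m`: `χ_{N₂}(q²)`,
`χ_{N/q}(q)`, `χ_{N₀}(q²)` for `m = 0, 1, 2`. At `q` residues are counted. If `q ∣ c`, the three
values of `m` contribute `q⁴`, `0`, `q` times the old local factor. If `q ∤ c`, where only the local
factor of `ρ'` lives, they contribute `q²(q²-1)`, `q²-1`, `0` when `χ_q = 1`, and nothing otherwise,
by orthogonality. Weighting by `q^(-3)`, `q^(k-3)`, `q^(2k-3)` gives the formula. Absolute
convergence (`summable_linForm`) justifies exchanging the sums. -/

/-- The block `A` of `γ = (A B; C D)`. -/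
def blockA (γ : Sp) : Matrix (Fin 2) (Fin 2) ℤ :=
  (γ : Matrix (Fin 2 ⊕ Fin 2) (Fin 2 ⊕ Fin 2) ℤ).toBlocks₁₁

/-- The block `B` of `γ = (A B; C D)`. -/
def blockB (γ : Sp) : Matrix (Fin 2) (Fin 2) ℤ :=
  (γ : Matrix (Fin 2 ⊕ Fin 2) (Fin 2 ⊕ Fin 2) ℤ).toBlocks₁₂

theorem coe_eq_fromBlocks (γ : Sp) :
    (γ : Matrix (Fin 2 ⊕ Fin 2) (Fin 2 ⊕ Fin 2) ℤ) =
      Matrix.fromBlocks (blockA γ) (blockB γ) (blockC γ) (blockD γ) :=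
  (Matrix.fromBlocks_toBlocks _).symm

theorem col_relations (γ : Sp) :
    (blockA γ)ᵀ * blockC γ = (blockC γ)ᵀ * blockA γ ∧
    (blockB γ)ᵀ * blockD γ = (blockD γ)ᵀ * blockB γ ∧
    (blockA γ)ᵀ * blockD γ - (blockC γ)ᵀ * blockB γ = 1 := by
  rw [← SymplecticGroup.fromBlocks_mem_iff, ← coe_eq_fromBlocks]
  exact γ.2

theorem row_relations (γ : Sp) :
    blockA γ * (blockB γ)ᵀ = blockB γ * (blockA γ)ᵀ ∧
    blockC γ * (blockD γ)ᵀ = blockD γ * (blockC γ)ᵀ ∧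
    blockA γ * (blockD γ)ᵀ - blockB γ * (blockC γ)ᵀ = 1 := by
  have h := SymplecticGroup.transpose_mem γ.2
  rw [coe_eq_fromBlocks, Matrix.fromBlocks_transpose, SymplecticGroup.fromBlocks_mem_iff] at h
  simp only [Matrix.transpose_transpose] at h
  refine ⟨h.1, h.2.1, ?_⟩
  have h3 := congrArg Matrix.transpose h.2.2
  simp only [Matrix.transpose_sub, Matrix.transpose_mul, Matrix.transpose_transpose,
    Matrix.transpose_one] at h3
  rw [← h.2.2]

/-! ### Plücker coordinates and the linear action -/

/-- Plücker coordinates of the bottom rows `(C D)` of a symplectic matrix: `c = det C`, `d = det D`,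
and `(a b; b e)` is the symmetric matrix `adj(C) D`. -/
@[ext]
structure Plucker (R : Type*) where
  c : R
  a : R
  b : R
  e : R
  d : R

namespace Plucker

variable {R S : Type*} [CommRing R] [CommRing S]

/-- The symmetric matrix `(a b; b e)`. -/
def mat (v : Plucker R) : Matrix (Fin 2) (Fin 2) R := !![v.a, v.b; v.b, v.e]

/-- Apply a map to all coordinates. -/
def map {R S : Type*} (f : R → S) (v : Plucker R) : Plucker S :=
  ⟨f v.c, f v.a, f v.b, f v.e, f v.d⟩

/-- The Plücker coordinates of the two bottom rows of a matrix. -/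
def of (x : Matrix (Fin 2 ⊕ Fin 2) (Fin 2 ⊕ Fin 2) R) : Plucker R where
  c := x.toBlocks₂₁.det
  a := (x.toBlocks₂₁.adjugate * x.toBlocks₂₂) 0 0
  b := (x.toBlocks₂₁.adjugate * x.toBlocks₂₂) 0 1
  e := (x.toBlocks₂₁.adjugate * x.toBlocks₂₂) 1 1
  d := x.toBlocks₂₂.det

/-- Right multiplication by a symplectic matrix, in Plücker coordinates: the middle part. -/
def actMat (v : Plucker R) (y : Matrix (Fin 2 ⊕ Fin 2) (Fin 2 ⊕ Fin 2) R) :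
    Matrix (Fin 2) (Fin 2) R :=
  v.c • (y.toBlocks₁₁.adjugate * y.toBlocks₁₂) + y.toBlocks₁₁.adjugate * v.mat * y.toBlocks₂₂ +
    y.toBlocks₂₁.adjugate * v.mat.adjugate * y.toBlocks₁₂ +
    v.d • (y.toBlocks₂₁.adjugate * y.toBlocks₂₂)

/-- Right multiplication by a symplectic matrix, in Plücker coordinates. -/
def act (v : Plucker R) (y : Matrix (Fin 2 ⊕ Fin 2) (Fin 2 ⊕ Fin 2) R) : Plucker R where
  c := v.c * y.toBlocks₁₁.det + (y.toBlocks₁₁.adjugate * v.mat * y.toBlocks₂₁).trace +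
    v.d * y.toBlocks₂₁.det
  a := v.actMat y 0 0
  b := v.actMat y 0 1
  e := v.actMat y 1 1
  d := v.c * y.toBlocks₁₂.det + (y.toBlocks₁₂.adjugate * v.mat * y.toBlocks₂₂).trace +
    v.d * y.toBlocks₂₂.det

/-- By Cauchy–Binet the six minors of the bottom rows transform linearly. The symmetry hypothesis
identifies the two off-diagonal mixed minors, so five coordinates suffice. -/
theorem of_mul (x y : Matrix (Fin 2 ⊕ Fin 2) (Fin 2 ⊕ Fin 2) R)
    (hx : (x.toBlocks₂₁.adjugate * x.toBlocks₂₂).IsSymm) :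
    of (x * y) = (of x).act y := by
  have h := congrFun (congrFun hx 1) 0
  obtain ⟨A, B, C, D, rfl⟩ : ∃ A B C D, x = Matrix.fromBlocks A B C D :=
    ⟨_, _, _, _, (Matrix.fromBlocks_toBlocks x).symm⟩
  obtain ⟨A', B', C', D', rfl⟩ : ∃ A B C D, y = Matrix.fromBlocks A B C D :=
    ⟨_, _, _, _, (Matrix.fromBlocks_toBlocks y).symm⟩
  simp only [Matrix.toBlocks_fromBlocks₂₁, Matrix.toBlocks_fromBlocks₂₂, Matrix.transpose_apply,
    Matrix.adjugate_fin_two, Matrix.mul_apply, Fin.sum_univ_two, Matrix.of_apply,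
    Matrix.cons_val', Matrix.cons_val_zero, Matrix.cons_val_one, Matrix.cons_val_fin_one] at h
  ext <;>
  simp only [of, act, actMat, mat, Matrix.fromBlocks_multiply, Matrix.toBlocks_fromBlocks₂₁,
    Matrix.toBlocks_fromBlocks₂₂, Matrix.toBlocks_fromBlocks₁₁, Matrix.toBlocks_fromBlocks₁₂,
    Matrix.det_fin_two, Matrix.adjugate_fin_two, Matrix.mul_apply, Fin.sum_univ_two,
    Matrix.add_apply, Matrix.of_apply, Matrix.cons_val', Matrix.cons_val_zero,
    Matrix.cons_val_one, Matrix.cons_val_fin_one, Matrix.trace_fin_two, Matrix.smul_apply,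
    smul_eq_mul]
  · linear_combination (A' 0 1 * C' 0 0 - A' 0 0 * C' 0 1) * h
  · linear_combination (A' 0 1 * D' 0 0 - C' 0 1 * B' 0 0) * h
  · linear_combination (A' 0 1 * D' 0 1 - C' 0 1 * B' 0 1) * h
  · linear_combination (C' 0 0 * B' 0 1 - A' 0 0 * D' 0 1) * h
  · linear_combination (B' 0 1 * D' 0 0 - B' 0 0 * D' 0 1) * h

theorem of_map (f : R →+* S) (x : Matrix (Fin 2 ⊕ Fin 2) (Fin 2 ⊕ Fin 2) R) :
    of (x.map f) = (of x).map f := by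
  ext <;> simp [of, map, Matrix.det_fin_two, Matrix.adjugate_fin_two, Matrix.mul_apply,
    Matrix.toBlocks₂₁, Matrix.toBlocks₂₂]

theorem act_c (v : Plucker R) (y : Matrix (Fin 2 ⊕ Fin 2) (Fin 2 ⊕ Fin 2) R) :
    (v.act y).c = v.c * (y.toBlocks₁₁ 0 0 * y.toBlocks₁₁ 1 1 - y.toBlocks₁₁ 0 1 * y.toBlocks₁₁ 1 0)
      + v.a * (y.toBlocks₁₁ 1 1 * y.toBlocks₂₁ 0 0 - y.toBlocks₁₁ 1 0 * y.toBlocks₂₁ 0 1)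
      + v.b * (y.toBlocks₁₁ 1 1 * y.toBlocks₂₁ 1 0 - y.toBlocks₁₁ 0 1 * y.toBlocks₂₁ 0 0
        + y.toBlocks₁₁ 0 0 * y.toBlocks₂₁ 0 1 - y.toBlocks₁₁ 1 0 * y.toBlocks₂₁ 1 1)
      + v.e * (y.toBlocks₁₁ 0 0 * y.toBlocks₂₁ 1 1 - y.toBlocks₁₁ 0 1 * y.toBlocks₂₁ 1 0)
      + v.d * (y.toBlocks₂₁ 0 0 * y.toBlocks₂₁ 1 1 - y.toBlocks₂₁ 0 1 * y.toBlocks₂₁ 1 0) := by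
  simp only [act, mat, Matrix.det_fin_two, Matrix.adjugate_fin_two, Matrix.mul_apply,
    Fin.sum_univ_two, Matrix.of_apply, Matrix.cons_val', Matrix.cons_val_zero,
    Matrix.cons_val_one, Matrix.cons_val_fin_one, Matrix.trace_fin_two]
  ring

theorem act_d (v : Plucker R) (y : Matrix (Fin 2 ⊕ Fin 2) (Fin 2 ⊕ Fin 2) R) :
    (v.act y).d = v.c * (y.toBlocks₁₂ 0 0 * y.toBlocks₁₂ 1 1 - y.toBlocks₁₂ 0 1 * y.toBlocks₁₂ 1 0)
      + v.a * (y.toBlocks₁₂ 1 1 * y.toBlocks₂₂ 0 0 - y.toBlocks₁₂ 1 0 * y.toBlocks₂₂ 0 1)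
      + v.b * (y.toBlocks₁₂ 1 1 * y.toBlocks₂₂ 1 0 - y.toBlocks₁₂ 0 1 * y.toBlocks₂₂ 0 0
        + y.toBlocks₁₂ 0 0 * y.toBlocks₂₂ 0 1 - y.toBlocks₁₂ 1 0 * y.toBlocks₂₂ 1 1)
      + v.e * (y.toBlocks₁₂ 0 0 * y.toBlocks₂₂ 1 1 - y.toBlocks₁₂ 0 1 * y.toBlocks₂₂ 1 0)
      + v.d * (y.toBlocks₂₂ 0 0 * y.toBlocks₂₂ 1 1 - y.toBlocks₂₂ 0 1 * y.toBlocks₂₂ 1 0) := by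
  simp only [act, mat, Matrix.det_fin_two, Matrix.adjugate_fin_two, Matrix.mul_apply,
    Fin.sum_univ_two, Matrix.of_apply, Matrix.cons_val', Matrix.cons_val_zero,
    Matrix.cons_val_one, Matrix.cons_val_fin_one, Matrix.trace_fin_two]
  ring

theorem act_a (v : Plucker R) (y : Matrix (Fin 2 ⊕ Fin 2) (Fin 2 ⊕ Fin 2) R) :
    (v.act y).a = v.c * (y.toBlocks₁₁ 1 1 * y.toBlocks₁₂ 0 0 + -y.toBlocks₁₁ 0 1 * y.toBlocks₁₂ 1 0)
      + ((y.toBlocks₁₁ 1 1 * v.a + -y.toBlocks₁₁ 0 1 * v.b) * y.toBlocks₂₂ 0 0 +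
        (y.toBlocks₁₁ 1 1 * v.b + -y.toBlocks₁₁ 0 1 * v.e) * y.toBlocks₂₂ 1 0)
      + ((y.toBlocks₂₁ 1 1 * v.e - -y.toBlocks₂₁ 0 1 * v.b) * y.toBlocks₁₂ 0 0 +
        (-y.toBlocks₂₁ 0 1 * v.a - y.toBlocks₂₁ 1 1 * v.b) * y.toBlocks₁₂ 1 0)
      + v.d * (y.toBlocks₂₁ 1 1 * y.toBlocks₂₂ 0 0 + -y.toBlocks₂₁ 0 1 * y.toBlocks₂₂ 1 0) := by
  simp only [act, actMat, mat, Matrix.det_fin_two, Matrix.adjugate_fin_two, Matrix.mul_apply, Fin.sum_univ_two,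
    Matrix.add_apply, Matrix.of_apply, Matrix.cons_val', Matrix.cons_val_zero,
    Matrix.cons_val_one, Matrix.cons_val_fin_one, Matrix.trace_fin_two, Matrix.smul_apply,
    smul_eq_mul]
  ring

theorem act_b (v : Plucker R) (y : Matrix (Fin 2 ⊕ Fin 2) (Fin 2 ⊕ Fin 2) R) :
    (v.act y).b = v.c * (y.toBlocks₁₁ 1 1 * y.toBlocks₁₂ 0 1 + -y.toBlocks₁₁ 0 1 * y.toBlocks₁₂ 1 1)
      + ((y.toBlocks₁₁ 1 1 * v.a + -y.toBlocks₁₁ 0 1 * v.b) * y.toBlocks₂₂ 0 1 +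
        (y.toBlocks₁₁ 1 1 * v.b + -y.toBlocks₁₁ 0 1 * v.e) * y.toBlocks₂₂ 1 1)
      + ((y.toBlocks₂₁ 1 1 * v.e - -y.toBlocks₂₁ 0 1 * v.b) * y.toBlocks₁₂ 0 1 +
        (-y.toBlocks₂₁ 0 1 * v.a - y.toBlocks₂₁ 1 1 * v.b) * y.toBlocks₁₂ 1 1)
      + v.d * (y.toBlocks₂₁ 1 1 * y.toBlocks₂₂ 0 1 + -y.toBlocks₂₁ 0 1 * y.toBlocks₂₂ 1 1) := by
  simp only [act, actMat, mat, Matrix.det_fin_two, Matrix.adjugate_fin_two, Matrix.mul_apply, Fin.sum_univ_two,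
    Matrix.add_apply, Matrix.of_apply, Matrix.cons_val', Matrix.cons_val_zero,
    Matrix.cons_val_one, Matrix.cons_val_fin_one, Matrix.trace_fin_two, Matrix.smul_apply,
    smul_eq_mul]
  ring

theorem act_e (v : Plucker R) (y : Matrix (Fin 2 ⊕ Fin 2) (Fin 2 ⊕ Fin 2) R) :
    (v.act y).e = v.c * (-y.toBlocks₁₁ 1 0 * y.toBlocks₁₂ 0 1 + y.toBlocks₁₁ 0 0 * y.toBlocks₁₂ 1 1)
      + ((-y.toBlocks₁₁ 1 0 * v.a + y.toBlocks₁₁ 0 0 * v.b) * y.toBlocks₂₂ 0 1 +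
        (-y.toBlocks₁₁ 1 0 * v.b + y.toBlocks₁₁ 0 0 * v.e) * y.toBlocks₂₂ 1 1)
      + ((-y.toBlocks₂₁ 1 0 * v.e - y.toBlocks₂₁ 0 0 * v.b) * y.toBlocks₁₂ 0 1 +
        (y.toBlocks₂₁ 0 0 * v.a - -y.toBlocks₂₁ 1 0 * v.b) * y.toBlocks₁₂ 1 1)
      + v.d * (-y.toBlocks₂₁ 1 0 * y.toBlocks₂₂ 0 1 + y.toBlocks₂₁ 0 0 * y.toBlocks₂₂ 1 1) := by
  simp only [act, actMat, mat, Matrix.det_fin_two, Matrix.adjugate_fin_two, Matrix.mul_apply, Fin.sum_univ_two,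
    Matrix.add_apply, Matrix.of_apply, Matrix.cons_val', Matrix.cons_val_zero,
    Matrix.cons_val_one, Matrix.cons_val_fin_one, Matrix.trace_fin_two, Matrix.smul_apply,
    smul_eq_mul]
  ring

theorem act_map (f : R →+* S) (v : Plucker R) (y : Matrix (Fin 2 ⊕ Fin 2) (Fin 2 ⊕ Fin 2) R) :
    (v.act y).map f = (v.map f).act (y.map f) := by
  have h₁ (i j) : (y.map f).toBlocks₁₁ i j = f (y.toBlocks₁₁ i j) := rfl
  have h₂ (i j) : (y.map f).toBlocks₁₂ i j = f (y.toBlocks₁₂ i j) := rfl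
  have h₃ (i j) : (y.map f).toBlocks₂₁ i j = f (y.toBlocks₂₁ i j) := rfl
  have h₄ (i j) : (y.map f).toBlocks₂₂ i j = f (y.toBlocks₂₂ i j) := rfl
  ext <;> simp only [map, act_a, act_b, act_c, act_d, act_e, h₁, h₂, h₃, h₄, map_add, map_mul,
    map_sub, map_neg]

theorem act_map_mul (t : R) (v : Plucker R) (y : Matrix (Fin 2 ⊕ Fin 2) (Fin 2 ⊕ Fin 2) R) :
    (v.map (t * ·)).act y = (v.act y).map (t * ·) := by
  ext <;> simp only [map, act_a, act_b, act_c, act_d, act_e] <;> ring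

/-- The Plücker coordinates of a row space are isotropic. -/
def Isotropic (v : Plucker R) : Prop := v.c * v.d = v.a * v.e - v.b ^ 2

/-- No prime divides all coordinates. -/
def Primitive (v : Plucker ℤ) : Prop :=
  ∀ p : ℕ, p.Prime → ¬ ((p : ℤ) ∣ v.c ∧ (p : ℤ) ∣ v.a ∧ (p : ℤ) ∣ v.b ∧ (p : ℤ) ∣ v.e ∧
    (p : ℤ) ∣ v.d)

end Plucker

open Plucker

/-- The Plücker coordinates of an integral symplectic matrix. -/
def plucker (γ : Sp) : Plucker ℤ :=
  Plucker.of (γ : Matrix (Fin 2 ⊕ Fin 2) (Fin 2 ⊕ Fin 2) ℤ)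

theorem isSymm_of_mem_symplecticGroup {R : Type*} [CommRing R]
    {x : Matrix (Fin 2 ⊕ Fin 2) (Fin 2 ⊕ Fin 2) R} (hx : x ∈ Matrix.symplecticGroup (Fin 2) R) :
    (x.toBlocks₂₁.adjugate * x.toBlocks₂₂).IsSymm := by
  have h := SymplecticGroup.transpose_mem hx
  rw [← Matrix.fromBlocks_toBlocks x, Matrix.fromBlocks_transpose,
    SymplecticGroup.fromBlocks_mem_iff] at h
  have h1 := congrFun (congrFun h.2.1 0) 1
  simp only [Matrix.mul_apply, Fin.sum_univ_two, Matrix.transpose_apply] at h1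
  apply Matrix.IsSymm.ext
  intro i j
  fin_cases i <;> fin_cases j <;> simp [Matrix.adjugate_fin_two, Matrix.mul_apply]
  · linear_combination h1
  · linear_combination -h1

theorem adjugate_blockC_mul_blockD_isSymm (γ : Sp) :
    ((blockC γ).adjugate * blockD γ).IsSymm :=
  isSymm_of_mem_symplecticGroup γ.2

theorem plucker_mul (γ δ : Sp) :
    plucker (γ * δ) = (plucker γ).act (δ : Matrix (Fin 2 ⊕ Fin 2) (Fin 2 ⊕ Fin 2) ℤ) :=
  of_mul _ _ (adjugate_blockC_mul_blockD_isSymm γ)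

theorem plucker_one : plucker 1 = ⟨0, 0, 0, 0, 1⟩ := by
  have hC := blockC_one
  have hD := blockD_one
  simp only [blockC, blockD] at hC hD
  ext <;> simp only [plucker, of, hC, hD] <;> simp

theorem plucker_isotropic (γ : Sp) : (plucker γ).Isotropic := by
  have h := congrFun (congrFun (adjugate_blockC_mul_blockD_isSymm γ) 1) 0
  simp only [Matrix.transpose_apply, blockC, blockD, Matrix.adjugate_fin_two, Matrix.mul_apply,
    Fin.sum_univ_two, Matrix.of_apply, Matrix.cons_val', Matrix.cons_val_zero, Matrix.cons_val_one,
    Matrix.cons_val_fin_one] at h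
  simp only [Isotropic, plucker, of, Matrix.adjugate_fin_two, Matrix.mul_apply, Matrix.det_fin_two,
    Fin.sum_univ_two, Matrix.of_apply, Matrix.cons_val', Matrix.cons_val_zero, Matrix.cons_val_one,
    Matrix.cons_val_fin_one]
  generalize (γ : Matrix (Fin 2 ⊕ Fin 2) (Fin 2 ⊕ Fin 2) ℤ).toBlocks₂₁ = C at *
  generalize (γ : Matrix (Fin 2 ⊕ Fin 2) (Fin 2 ⊕ Fin 2) ℤ).toBlocks₂₂ = D at *
  linear_combination (C 1 1 * D 0 1 + -C 0 1 * D 1 1) * h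

/-- Acting by `γ⁻¹` writes `1` as an integral linear combination of the coordinates of `γ`. -/
theorem plucker_primitive (γ : Sp) : (plucker γ).Primitive := by
  rintro p hp ⟨h1, h2, h3, h4, h5⟩
  have h := plucker_mul γ γ⁻¹
  rw [mul_inv_cancel, plucker_one] at h
  obtain ⟨w, hw⟩ : ∃ w : Plucker ℤ, plucker γ = w.map ((p : ℤ) * ·) := by
    obtain ⟨c, hc⟩ := h1
    obtain ⟨a, ha⟩ := h2
    obtain ⟨b, hb⟩ := h3
    obtain ⟨e, he⟩ := h4
    obtain ⟨d, hd⟩ := h5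
    exact ⟨⟨c, a, b, e, d⟩, Plucker.ext hc ha hb he hd⟩
  rw [hw, act_map_mul] at h
  have hd : (1 : ℤ) = p * _ := congrArg Plucker.d h
  exact hp.one_lt.ne' (by exact_mod_cast Int.eq_one_of_mul_eq_one_right (by positivity) hd.symm)

theorem mem_GammaInf_iff (γ : Sp) : γ ∈ GammaInf ↔ plucker γ = ⟨0, 0, 0, 0, 1⟩ := by
  constructor
  · rintro ⟨h1, h2⟩
    simp only [blockC, blockD] at h1 h2
    ext <;> simp only [plucker, of, h1, h2] <;> simp
  · intro h
    have hd : (blockD γ).det = 1 := congrArg Plucker.d h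
    have hs := adjugate_blockC_mul_blockD_isSymm γ
    have h0 : (blockC γ).adjugate * blockD γ = 0 := by
      ext i j
      have h1 : ((blockC γ).adjugate * blockD γ) 0 1 = 0 := congrArg Plucker.b h
      fin_cases i <;> fin_cases j
      · exact congrArg Plucker.a h
      · exact h1
      · exact (congrFun (congrFun hs 0) 1).trans h1
      · exact congrArg Plucker.e h
    -- Since `det D = 1`, the factor `D` can be cancelled from `adj(C) D = 0`.
    have h1 : (blockC γ).adjugate = 0 := by
      have h2 := congrArg (· * (blockD γ).adjugate) h0
      simpa [Matrix.mul_assoc, Matrix.mul_adjugate, hd] using h2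
    refine ⟨?_, hd⟩
    have h2 := Matrix.adjugate_adjugate (blockC γ) (by simp)
    simpa [h1] using h2.symm

theorem plucker_eq_iff (γ δ : Sp) : plucker γ = plucker δ ↔ γ * δ⁻¹ ∈ GammaInf := by
  constructor
  · intro h
    rw [mem_GammaInf_iff, plucker_mul, h, ← plucker_mul, mul_inv_cancel, plucker_one]
  · intro h
    rw [mem_GammaInf_iff] at h
    rw [← mul_one δ, ← inv_mul_cancel_right γ δ, plucker_mul (γ * δ⁻¹), h, ← plucker_one,
      ← plucker_mul, one_mul, mul_one]

/-! ### Elementary symplectic matrices and surjectivity onto primitive isotropic vectors -/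

/-- The translation `(I Y; 0 I)` with `Y = (x y; y z)`. -/
def translation (x y z : ℤ) : Sp :=
  ⟨Matrix.fromBlocks 1 !![x, y; y, z] 0 1, by
    rw [SymplecticGroup.fromBlocks_mem_iff]
    refine ⟨by simp, ?_, by simp⟩
    ext i j
    fin_cases i <;> fin_cases j <;> simp⟩

/-- The element `(G 0; 0 G⁻ᵀ)` for `G` of determinant one. -/
def levi (G : Matrix.SpecialLinearGroup (Fin 2) ℤ) : Sp :=
  ⟨Matrix.fromBlocks G.1 0 0 (G.1.adjugate)ᵀ, by
    rw [SymplecticGroup.fromBlocks_mem_iff]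
    refine ⟨by simp, by simp, ?_⟩
    rw [← Matrix.transpose_mul, Matrix.adjugate_mul, G.2]
    simp⟩

/-- The lower unipotent element of the `SL_2` in the second coordinate. -/
def lowerUnipotent (t : ℤ) : Sp :=
  ⟨Matrix.fromBlocks 1 0 !![0, 0; 0, t] 1, by
    rw [SymplecticGroup.fromBlocks_mem_iff]
    refine ⟨?_, by simp, by simp⟩
    ext i j
    fin_cases i <;> fin_cases j <;> simp⟩

/-- The partial inversion in the first coordinate. -/
def partialInversionFst : Sp :=
  ⟨Matrix.fromBlocks !![0, 0; 0, 1] !![-1, 0; 0, 0] !![1, 0; 0, 0] !![0, 0; 0, 1], by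
    rw [SymplecticGroup.fromBlocks_mem_iff]
    refine ⟨?_, ?_, ?_⟩ <;> ext i j <;> fin_cases i <;> fin_cases j <;>
      simp [Matrix.mul_apply]⟩

/-- The partial inversion in the second coordinate. -/
def partialInversionSnd : Sp :=
  ⟨Matrix.fromBlocks !![1, 0; 0, 0] !![0, 0; 0, -1] !![0, 0; 0, 1] !![1, 0; 0, 0], by
    rw [SymplecticGroup.fromBlocks_mem_iff]
    refine ⟨?_, ?_, ?_⟩ <;> ext i j <;> fin_cases i <;> fin_cases j <;>
      simp [Matrix.mul_apply]⟩

theorem act_translation (v : Plucker ℤ) (x y z : ℤ) :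
    v.act (translation x y z : Sp).1 = ⟨v.c, v.a + v.c * x, v.b + v.c * y, v.e + v.c * z,
      v.d + v.e * x + v.a * z - 2 * v.b * y + v.c * (x * z - y ^ 2)⟩ := by
  ext <;> simp [translation, act_a, act_b, act_c, act_d, act_e] <;> ring

theorem act_levi (v : Plucker ℤ) (G : Matrix.SpecialLinearGroup (Fin 2) ℤ) :
    v.act (levi G).1 = ⟨v.c,
      G.1 1 1 ^ 2 * v.a - 2 * G.1 1 1 * G.1 0 1 * v.b + G.1 0 1 ^ 2 * v.e,
      -(G.1 1 1 * G.1 1 0 * v.a) + (G.1 1 1 * G.1 0 0 + G.1 0 1 * G.1 1 0) * v.b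
        - G.1 0 1 * G.1 0 0 * v.e,
      G.1 1 0 ^ 2 * v.a - 2 * G.1 1 0 * G.1 0 0 * v.b + G.1 0 0 ^ 2 * v.e, v.d⟩ := by
  have h := G.2
  rw [Matrix.det_fin_two] at h
  ext <;> simp [levi, act_a, act_b, act_c, act_d, act_e, Matrix.adjugate_fin_two]
  · rw [h, mul_one]
  · ring
  · ring
  · ring
  · linear_combination v.d * h

theorem act_lowerUnipotent (v : Plucker ℤ) (t : ℤ) :
    v.act (lowerUnipotent t).1 = ⟨v.c + t * v.e, v.a + t * v.d, v.b, v.e, v.d⟩ := by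
  ext <;> simp [lowerUnipotent, act_a, act_b, act_c, act_d, act_e] <;> ring

theorem act_partialInversionFst (v : Plucker ℤ) :
    v.act partialInversionFst.1 = ⟨v.a, -v.c, v.b, v.d, -v.e⟩ := by
  ext <;> simp [partialInversionFst, act_a, act_b, act_c, act_d, act_e]

theorem act_partialInversionSnd (v : Plucker ℤ) :
    v.act partialInversionSnd.1 = ⟨v.e, v.d, v.b, -v.c, -v.a⟩ := by
  ext <;> simp [partialInversionSnd, act_a, act_b, act_c, act_d, act_e]

theorem Plucker.Primitive.of_act {w : Plucker ℤ}
    {y : Matrix (Fin 2 ⊕ Fin 2) (Fin 2 ⊕ Fin 2) ℤ} (h : (w.act y).Primitive) : w.Primitive := by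
  rintro p hp ⟨⟨c, hc⟩, ⟨a, ha⟩, ⟨b, hb⟩, ⟨e, he⟩, ⟨d, hd⟩⟩
  have hw : w = Plucker.map ((p : ℤ) * ·) ⟨c, a, b, e, d⟩ := Plucker.ext hc ha hb he hd
  rw [hw, act_map_mul] at h
  exact h p hp ⟨dvd_mul_right _ _, dvd_mul_right _ _, dvd_mul_right _ _, dvd_mul_right _ _,
    dvd_mul_right _ _⟩

theorem exists_plucker_eq_act {w : Plucker ℤ} (γ : Sp) (h : ∃ δ, plucker δ = w) :
    ∃ δ, plucker δ = w.act γ.1 := by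
  obtain ⟨δ, rfl⟩ := h
  exact ⟨δ * γ, plucker_mul δ γ⟩

theorem exists_plucker_eq_of_isUnit {v : Plucker ℤ} (hi : v.Isotropic) (hc : v.c * v.c = 1) :
    ∃ δ, plucker δ = v := by
  refine ⟨⟨Matrix.fromBlocks 0 !![-v.c, 0; 0, -1] !![v.c, 0; 0, 1]
    !![v.a, v.b; v.c * v.b, v.c * v.e], ?_⟩, ?_⟩
  · rw [SymplecticGroup.fromBlocks_mem_iff]
    refine ⟨by simp, ?_, ?_⟩ <;> ext i j <;> fin_cases i <;> fin_cases j <;>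
      simp [Matrix.mul_apply, hc, mul_comm]
  · unfold Isotropic at hi
    ext <;> simp [plucker, of, Matrix.det_fin_two, Matrix.adjugate_fin_two, Matrix.mul_apply]
    · linear_combination v.e * hc
    · linear_combination v.d * hc - v.c * hi

/-- Euclidean descent on `|c|`. If `c` does not divide `a` or `e`, a translation reduces that
coordinate modulo `c` and a partial inversion makes the smaller remainder the new `c`. -/
theorem exists_plucker_eq_aux (n : ℕ) : ∀ v : Plucker ℤ, v.Isotropic → v.Primitive → v.c ≠ 0 →
    v.c.natAbs = n → ∃ δ, plucker δ = v := by
  induction n using Nat.strong_induction_on with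
  | _ n ih =>
  have step_a : ∀ w : Plucker ℤ, w.Isotropic → w.Primitive → w.a ≠ 0 → w.a.natAbs < n →
      ∃ δ, plucker δ = w := by
    intro w hi hw h0 hn
    have h : (⟨-w.a, w.c, w.b, -w.d, w.e⟩ : Plucker ℤ).act partialInversionFst.1 = w := by
      rw [act_partialInversionFst]
      simp
    rw [← h]
    refine exists_plucker_eq_act _ (ih _ hn _ ?_ (Primitive.of_act (h ▸ hw)) (by simpa) (by simp))
    unfold Isotropic at hi ⊢
    linear_combination hi
  have step_e : ∀ w : Plucker ℤ, w.Isotropic → w.Primitive → w.e ≠ 0 → w.e.natAbs < n →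
      ∃ δ, plucker δ = w := by
    intro w hi hw h0 hn
    have h : (⟨-w.e, -w.d, w.b, w.c, w.a⟩ : Plucker ℤ).act partialInversionSnd.1 = w := by
      rw [act_partialInversionSnd]
      simp
    rw [← h]
    refine exists_plucker_eq_act _ (ih _ hn _ ?_ (Primitive.of_act (h ▸ hw)) (by simpa) (by simp))
    unfold Isotropic at hi ⊢
    linear_combination hi
  have reduce : ∀ v : Plucker ℤ, v.Isotropic → v.Primitive → v.c ≠ 0 → v.c.natAbs = n →
      (¬ v.c ∣ v.a ∨ ¬ v.c ∣ v.e) → ∃ δ, plucker δ = v := by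
    intro v hi hv h0 hn hd
    set w : Plucker ℤ := ⟨v.c, v.a % v.c, v.b, v.e % v.c,
      v.d - v.e * (v.a / v.c) - v.a * (v.e / v.c) + v.c * ((v.a / v.c) * (v.e / v.c))⟩ with hw
    have hwv : w.act (translation (v.a / v.c) 0 (v.e / v.c)).1 = v := by
      rw [act_translation]
      ext <;> simp only [hw, Int.emod_def] <;> ring
    have hwp : w.Primitive := Primitive.of_act (hwv ▸ hv)
    have hwi : w.Isotropic := by
      unfold Isotropic at hi ⊢
      simp only [hw, Int.emod_def]
      linear_combination hi
    rw [← hwv]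
    refine exists_plucker_eq_act _ ?_
    have ha := Int.emod_nonneg v.a h0
    have ha' := Int.emod_lt v.a h0
    have he := Int.emod_nonneg v.e h0
    have he' := Int.emod_lt v.e h0
    rcases hd with hd | hd
    · exact step_a w hwi hwp (fun h => hd (Int.dvd_of_emod_eq_zero h)) (by simp only [hw]; omega)
    · exact step_e w hwi hwp (fun h => hd (Int.dvd_of_emod_eq_zero h)) (by simp only [hw]; omega)
  intro v hi hv h0 hn
  by_cases hd : ¬ v.c ∣ v.a ∨ ¬ v.c ∣ v.e
  · exact reduce v hi hv h0 hn hd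
  push Not at hd
  obtain ⟨⟨x, hx⟩, ⟨z, hz⟩⟩ := hd
  -- Now `c` divides both `a` and `e`, so a translation kills them and leaves `c d = -b²`.
  set w : Plucker ℤ := ⟨v.c, 0, v.b, 0, v.d - v.c * x * z⟩ with hw
  have hwv : w.act (translation x 0 z).1 = v := by
    rw [act_translation]
    ext <;> simp only [hw, hx, hz] <;> ring
  have hwp : w.Primitive := Primitive.of_act (hwv ▸ hv)
  have hwi : w.Isotropic := by
    unfold Isotropic at hi ⊢
    simp only [hw]
    rw [hx, hz] at hi
    linear_combination hi
  rw [← hwv]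
  refine exists_plucker_eq_act _ ?_
  clear_value w
  have hwa : w.a = 0 := by rw [hw]
  have hwe : w.e = 0 := by rw [hw]
  have hwc : w.c = v.c := by rw [hw]
  clear hw
  by_cases hd : w.c ∣ w.d
  -- Here `b² = -c² y`, so `c` divides every coordinate and is a unit by primitivity.
  · obtain ⟨y, hy⟩ := hd
    have hb : w.c ∣ w.b := by
      rw [← Int.pow_dvd_pow_iff two_ne_zero]
      refine ⟨-y, ?_⟩
      unfold Isotropic at hwi
      rw [hy, hwa] at hwi
      linear_combination hwi
    have hu : IsUnit w.c := by
      rw [Int.isUnit_iff_natAbs_eq]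
      by_contra hne
      obtain ⟨p, hp, hpc⟩ := Nat.exists_prime_and_dvd hne
      have hpc : (p : ℤ) ∣ w.c := Int.natCast_dvd.2 hpc
      exact hwp p hp ⟨hpc, by simp [hwa], hpc.trans hb, by simp [hwe], hpc.trans ⟨y, hy⟩⟩
    exact exists_plucker_eq_of_isUnit hwi (Int.isUnit_mul_self hu)
  -- A lower unipotent copies `d` into the vacant coordinate `a`. As `c ∤ d`, the reduction step
  -- applies again.
  · have h : (⟨w.c, w.d, w.b, w.e, w.d⟩ : Plucker ℤ).act (lowerUnipotent (-1)).1 = w := by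
      rw [act_lowerUnipotent]
      ext <;> simp [hwa, hwe]
    rw [← h]
    refine exists_plucker_eq_act _ (reduce _ ?_ (Primitive.of_act (h ▸ hwp)) (by simpa [hwc])
      (by simp [hwc, hn]) (Or.inl hd))
    unfold Isotropic at hwi ⊢
    simp only [hwa, hwe] at hwi ⊢
    linear_combination hwi

/-- When `c = 0`, a partial inversion brings a nonzero `a` or `e` into the place of `c`. If only `d`
is nonzero, it is first copied into `a`. -/
theorem exists_plucker_eq {v : Plucker ℤ} (hi : v.Isotropic) (hv : v.Primitive) :
    ∃ δ, plucker δ = v := by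
  by_cases hc : v.c = 0
  swap
  · exact exists_plucker_eq_aux _ v hi hv hc rfl
  have fst : ∀ w : Plucker ℤ, w.Isotropic → w.Primitive → w.a ≠ 0 → ∃ δ, plucker δ = w := by
    intro w hi hw h0
    have h : (⟨-w.a, w.c, w.b, -w.d, w.e⟩ : Plucker ℤ).act partialInversionFst.1 = w := by
      rw [act_partialInversionFst]
      simp
    rw [← h]
    refine exists_plucker_eq_act _
      (exists_plucker_eq_aux _ _ ?_ (Primitive.of_act (h ▸ hw)) (by simpa) rfl)
    unfold Isotropic at hi ⊢
    linear_combination hi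
  by_cases ha : v.a = 0
  swap
  · exact fst v hi hv ha
  have hb : v.b = 0 := by
    unfold Isotropic at hi
    rw [hc, ha] at hi
    have : v.b ^ 2 = 0 := by linear_combination hi
    simpa using this
  by_cases he : v.e = 0
  · have hd : v.d ≠ 0 := by
      intro hd
      exact hv 2 Nat.prime_two (by simp [ha, hb, hc, hd, he])
    have h : (⟨v.c, v.d, v.b, v.e, v.d⟩ : Plucker ℤ).act (lowerUnipotent (-1)).1 = v := by
      rw [act_lowerUnipotent]
      ext <;> simp [ha, he]
    rw [← h]
    refine exists_plucker_eq_act _ (fst _ ?_ (Primitive.of_act (h ▸ hv)) hd)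
    simp [Isotropic, hc, hb, he]
  · have h : (⟨-v.e, -v.d, v.b, v.c, v.a⟩ : Plucker ℤ).act partialInversionSnd.1 = v := by
      rw [act_partialInversionSnd]
      simp
    rw [← h]
    refine exists_plucker_eq_act _
      (exists_plucker_eq_aux _ _ ?_ (Primitive.of_act (h ▸ hv)) (by simpa) rfl)
    unfold Isotropic at hi ⊢
    linear_combination hi

/-! ### Cusps as primitive isotropic vectors -/

/-- Primitive isotropic vectors: the cosets `Γ_∞⁺ \ Sp_2(ℤ)` in Plücker coordinates. -/
def Cusp : Type := {v : Plucker ℤ // v.Isotropic ∧ v.Primitive}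

/-- The class of a symplectic matrix in `Γ_∞⁺ \ Sp_2(ℤ)`. -/
def Cusp.mk (γ : Sp) : Cusp := ⟨plucker γ, plucker_isotropic γ, plucker_primitive γ⟩

theorem Cusp.exists_rep (v : Cusp) : ∃ γ, v = Cusp.mk γ := by
  obtain ⟨γ, hγ⟩ := exists_plucker_eq v.2.1 v.2.2
  exact ⟨γ, Subtype.ext hγ.symm⟩

/-- The right action of `Sp_2(ℤ)` on cusps. -/
def Cusp.act (v : Cusp) (γ : Sp) : Cusp :=
  ⟨v.1.act γ.1, by
    obtain ⟨δ, rfl⟩ := v.exists_rep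
    change (Plucker.act (plucker δ) γ.1).Isotropic ∧ (Plucker.act (plucker δ) γ.1).Primitive
    rw [← plucker_mul]
    exact ⟨plucker_isotropic _, plucker_primitive _⟩⟩

theorem Cusp.mk_act (γ δ : Sp) : (Cusp.mk γ).act δ = Cusp.mk (γ * δ) :=
  Subtype.ext (plucker_mul γ δ).symm

theorem Cusp.act_mul (v : Cusp) (γ δ : Sp) : v.act (γ * δ) = (v.act γ).act δ := by
  obtain ⟨g, rfl⟩ := v.exists_rep
  rw [mk_act, mk_act, mk_act, mul_assoc]

theorem Cusp.act_one (v : Cusp) : v.act 1 = v := by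
  obtain ⟨g, rfl⟩ := v.exists_rep
  rw [mk_act, mul_one]

/-- The permutation of the cusps given by an element of `Sp_2(ℤ)`. -/
def Cusp.actEquiv (γ : Sp) : Cusp ≃ Cusp where
  toFun v := v.act γ
  invFun v := v.act γ⁻¹
  left_inv v := by change (v.act γ).act γ⁻¹ = v; rw [← act_mul, mul_inv_cancel, act_one]
  right_inv v := by change (v.act γ⁻¹).act γ = v; rw [← act_mul, inv_mul_cancel, act_one]

/-! ### Components of a Dirichlet character of square-free modulus -/

section Component

variable {N : ℕ} (χ : DirichletCharacter ℂ N)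

theorem component_apply {M : ℕ} (h : M ∣ N ∧ M.Coprime (N / M)) {a b : ℤ}
    (h₁ : b ≡ a [ZMOD M]) (h₂ : b ≡ 1 [ZMOD (N / M : ℕ)]) :
    component χ M (a : ZMod M) = χ (b : ZMod N) := by
  have key : (ZMod.chineseRemainder h.2).symm ((a : ZMod M), 1) = (b : ZMod (M * (N / M))) := by
    rw [RingEquiv.symm_apply_eq, map_intCast]
    ext
    · simpa using ((ZMod.intCast_eq_intCast_iff _ _ _).2 h₁).symm
    · have := (ZMod.intCast_eq_intCast_iff _ _ _).2 h₂
      simpa using this.symm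
  rw [component, dif_pos h]
  change χ (ZMod.ringEquivCongr _ ((ZMod.chineseRemainder h.2).symm ((a : ZMod M), 1))) = _
  rw [key, map_intCast]

theorem coprime_div_of_squarefree {M N : ℕ} (hN : Squarefree N) (h : M ∣ N) :
    M ∣ N ∧ M.Coprime (N / M) := by
  refine ⟨h, ?_⟩
  rw [← Nat.mul_div_cancel' h] at hN
  exact (Nat.squarefree_mul_iff.1 hN).1

theorem exists_component_eq (hN : Squarefree N) {M : ℕ} (h : M ∣ N) (a : ℤ) :
    ∃ b : ℤ, b ≡ a [ZMOD M] ∧ b ≡ 1 [ZMOD (N / M : ℕ)] ∧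
      component χ M (a : ZMod M) = χ (b : ZMod N) := by
  have hc := (coprime_div_of_squarefree hN h)
  obtain ⟨b, h1, h2⟩ : ∃ b : ℤ, b ≡ a [ZMOD M] ∧ b ≡ 1 [ZMOD (N / M : ℕ)] := by
    have hu : IsCoprime (M : ℤ) ((N / M : ℕ) : ℤ) := Nat.isCoprime_iff_coprime.2 hc.2
    obtain ⟨u, w, huw⟩ := hu
    refine ⟨a + (1 - a) * (u * M), ?_, ?_⟩
    · exact (Int.modEq_iff_dvd.2 ⟨-((1 - a) * u), by ring⟩)
    · exact (Int.modEq_iff_dvd.2 ⟨(1 - a) * w, by linear_combination (a - 1) * huw⟩)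
  exact ⟨b, h1, h2, component_apply χ hc h1 h2⟩

theorem component_mul (hN : Squarefree N) {M₁ M₂ : ℕ} (h : M₁ * M₂ ∣ N) (a : ℤ) :
    component χ (M₁ * M₂) (a : ZMod (M₁ * M₂)) =
      component χ M₁ (a : ZMod M₁) * component χ M₂ (a : ZMod M₂) := by
  have hN0 : N ≠ 0 := hN.ne_zero
  obtain ⟨K, rfl⟩ := h
  have h1 : M₁ ≠ 0 := by rintro rfl; simp at hN0
  have h2 : M₂ ≠ 0 := by rintro rfl; simp at hN0
  have d1 : M₁ * M₂ * K / M₁ = M₂ * K := by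
    rw [mul_assoc, Nat.mul_div_cancel_left _ (Nat.pos_of_ne_zero h1)]
  have d2 : M₁ * M₂ * K / M₂ = M₁ * K := by
    rw [mul_comm M₁, mul_assoc, Nat.mul_div_cancel_left _ (Nat.pos_of_ne_zero h2)]
  have d3 : M₁ * M₂ * K / (M₁ * M₂) = K :=
    Nat.mul_div_cancel_left _ (Nat.pos_of_ne_zero (mul_ne_zero h1 h2))
  obtain ⟨b₁, h11, h12, e1⟩ := exists_component_eq χ hN
    (show M₁ ∣ M₁ * M₂ * K from ⟨M₂ * K, by ring⟩) a
  obtain ⟨b₂, h21, h22, e2⟩ := exists_component_eq χ hN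
    (show M₂ ∣ M₁ * M₂ * K from ⟨M₁ * K, by ring⟩) a
  rw [d1] at h12
  rw [d2] at h22
  push_cast at h12 h22
  have hcop : M₁.Coprime M₂ := by
    rw [mul_assoc] at hN
    exact (Nat.squarefree_mul_iff.1 hN).1.coprime_mul_right_right
  rw [e1, e2, ← map_mul, ← Int.cast_mul]
  refine component_apply χ (coprime_div_of_squarefree hN ⟨K, rfl⟩) ?_ ?_
  · push_cast
    rw [← Int.modEq_and_modEq_iff_modEq_mul (by simpa using hcop)]
    constructor
    · simpa using h11.mul (h22.of_mul_right _)
    · simpa using (h12.of_mul_right _).mul h21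
  · rw [d3]
    simpa using (h12.of_mul_left _).mul (h22.of_mul_left _)

theorem component_one_apply (hN : Squarefree N) (a : ZMod 1) : component χ 1 a = 1 := by
  obtain ⟨a, rfl⟩ := ZMod.intCast_surjective a
  rw [component_apply χ (coprime_div_of_squarefree hN (one_dvd N)) (b := 1)
    (by simp [Int.modEq_one]) rfl]
  simp

theorem component_self_apply (hN : Squarefree N) (a : ℤ) :
    component χ N (a : ZMod N) = χ (a : ZMod N) :=
  component_apply χ (coprime_div_of_squarefree hN dvd_rfl) rfl
    (by simp [Nat.div_self (Nat.pos_of_ne_zero hN.ne_zero), Int.modEq_one])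

theorem component_eq_prod (hN : Squarefree N) {M : ℕ} (h : M ∣ N) (a : ℤ) :
    component χ M (a : ZMod M) = ∏ p ∈ M.primeFactors, component χ p (a : ZMod p) := by
  induction M using induction_on_primes with
  | zero => exact absurd (zero_dvd_iff.1 h) hN.ne_zero
  | one => simp [component_one_apply χ hN]
  | prime_mul p M hp ih =>
    have hs := hN.squarefree_of_dvd h
    have hc := (Nat.squarefree_mul_iff.1 hs).1
    rw [component_mul χ hN h, ih ((dvd_mul_left _ _).trans h), hc.primeFactors_mul,
      Finset.prod_union hc.disjoint_primeFactors, hp.primeFactors, Finset.prod_singleton]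

/-- An integer that is `a` modulo `p` and `1` modulo `N / p` is a unit modulo `M`, and its values
under `χ_p` and `χ_M` agree. Thus `χ_M² = 1` passes to `χ_p`. -/
theorem component_prime_sq (hN : Squarefree N) {M : ℕ} (hM : M ∣ N)
    (hχ : component χ M ^ 2 = 1) {p : ℕ} (hp : p.Prime) (hpM : p ∣ M) {x : ZMod p} (hx : x ≠ 0) :
    component χ p x ^ 2 = 1 := by
  obtain ⟨a, rfl⟩ := ZMod.intCast_surjective x
  obtain ⟨b, h1, h2, h3⟩ := exists_component_eq χ hN (hpM.trans hM) a
  obtain ⟨K, rfl⟩ := hpM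
  obtain ⟨L, rfl⟩ := hM
  have hd : p * K * L / p = K * L := by
    rw [mul_assoc, Nat.mul_div_cancel_left _ hp.pos]
  rw [hd] at h2
  push_cast at h2
  have hpK : p * K ≠ 0 := fun h => hN.ne_zero (by rw [h, zero_mul])
  have h4 := component_apply χ (coprime_div_of_squarefree hN (dvd_mul_right (p * K) L))
    (b := b) (a := b) rfl
    (by rw [Nat.mul_div_cancel_left _ (Nat.pos_of_ne_zero hpK)]; exact h2.of_mul_left _)
  rw [h3, ← h4, ← MulChar.pow_apply' _ two_ne_zero, hχ]
  refine MulChar.one_apply ?_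
  rw [ZMod.coe_int_isUnit_iff_isCoprime]
  push_cast
  have := Fact.mk hp
  refine IsCoprime.mul_left ?_ ?_
  · rw [← ZMod.coe_int_isUnit_iff_isCoprime, (ZMod.intCast_eq_intCast_iff _ _ _).2 h1]
    exact hx.isUnit
  · rw [← ZMod.coe_int_isUnit_iff_isCoprime,
      (ZMod.intCast_eq_intCast_iff b 1 _).2 (h2.of_mul_right _)]
    simp

end Component

/-! ### Local factors modulo a prime and their transformation law -/

section Local

/-- The local factor at a prime dividing `N₀`: supported on `C = 0`. -/
noncomputable def localZero {R : Type*} [CommRing R] [DecidableEq R] (ψ : MulChar R ℂ)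
    (v : Plucker R) : ℂ :=
  if v.c = 0 ∧ v.a = 0 ∧ v.b = 0 ∧ v.e = 0 then ψ⁻¹ v.d else 0

/-- The local factor at a prime dividing `N₁`: supported on `C` of rank one. -/
noncomputable def localOne {R : Type*} [CommRing R] [DecidableEq R] (ψ : MulChar R ℂ)
    (v : Plucker R) : ℂ :=
  if v.c = 0 then ψ (if v.a = 0 then v.e else v.a) else 0

/-- The local factor at a prime dividing `N₂`: supported on `C` of rank two. -/
noncomputable def localTwo {R : Type*} [CommRing R] (ψ : MulChar R ℂ) (v : Plucker R) : ℂ := ψ v.c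

variable {F : Type*} [Field F]

/-- Modulo a prime dividing `N`, elements of `Γ_0(N)` have this shape. Since `adj(A) = det(A) Dᵀ`,
the middle matrix `M` becomes `det(A) Dᵀ M D` when `c = 0`; the scalar `δ` is `det A`. -/
theorem act_of_upper {y : Matrix (Fin 2 ⊕ Fin 2) (Fin 2 ⊕ Fin 2) F} (hC : y.toBlocks₂₁ = 0)
    (hAD : y.toBlocks₁₁ * y.toBlocks₂₂ᵀ = 1) (v : Plucker F) :
    ∃ δ : F, δ * y.toBlocks₂₂.det = 1 ∧ (v.act y).c = δ * v.c ∧ (v.c = 0 →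
      (v.act y).a = δ * (y.toBlocks₂₂ 0 0 ^ 2 * v.a + 2 * y.toBlocks₂₂ 0 0 * y.toBlocks₂₂ 1 0 * v.b
        + y.toBlocks₂₂ 1 0 ^ 2 * v.e) ∧
      (v.act y).b = δ * (y.toBlocks₂₂ 0 0 * y.toBlocks₂₂ 0 1 * v.a +
        (y.toBlocks₂₂ 0 0 * y.toBlocks₂₂ 1 1 + y.toBlocks₂₂ 0 1 * y.toBlocks₂₂ 1 0) * v.b
        + y.toBlocks₂₂ 1 0 * y.toBlocks₂₂ 1 1 * v.e) ∧
      (v.act y).e = δ * (y.toBlocks₂₂ 0 1 ^ 2 * v.a + 2 * y.toBlocks₂₂ 0 1 * y.toBlocks₂₂ 1 1 * v.b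
        + y.toBlocks₂₂ 1 1 ^ 2 * v.e) ∧
      (v.a = 0 → v.b = 0 → v.e = 0 → (v.act y).d = v.d * y.toBlocks₂₂.det)) := by
  have hdet : y.toBlocks₁₁.det * y.toBlocks₂₂.det = 1 := by
    have h := congrArg Matrix.det hAD
    rwa [Matrix.det_mul, Matrix.det_transpose, Matrix.det_one] at h
  have hadj : y.toBlocks₁₁.adjugate = y.toBlocks₁₁.det • y.toBlocks₂₂ᵀ := by
    have h := congrArg (y.toBlocks₁₁.adjugate * ·) hAD
    simpa [← Matrix.mul_assoc, Matrix.adjugate_mul] using h.symm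
  refine ⟨y.toBlocks₁₁.det, hdet, ?_, fun hc => ?_⟩
  · simp [act_c, hC, Matrix.det_fin_two, mul_comm]
  · have h00 := congrFun (congrFun hadj 0) 0
    have h01 := congrFun (congrFun hadj 0) 1
    have h10 := congrFun (congrFun hadj 1) 0
    have h11 := congrFun (congrFun hadj 1) 1
    simp only [Matrix.adjugate_fin_two, Matrix.of_apply, Matrix.cons_val', Matrix.cons_val_zero,
      Matrix.cons_val_one, Matrix.cons_val_fin_one, Matrix.smul_apply, Matrix.transpose_apply,
      smul_eq_mul] at h00 h01 h10 h11
    refine ⟨?_, ?_, ?_, fun ha hb he => ?_⟩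
    · rw [act_a, h00, h01]
      simp only [hC, hc, Matrix.zero_apply]
      ring
    · rw [act_b, h00, h01]
      simp only [hC, hc, Matrix.zero_apply]
      ring
    · rw [act_e, h10, h11]
      simp only [hC, hc, Matrix.zero_apply]
      ring
    · rw [act_d, ha, hb, he, hc, Matrix.det_fin_two]
      ring

theorem inv_apply_eq_of_mul_eq_one (ψ : MulChar F ℂ) {δ Δ : F} (h : δ * Δ = 1) :
    ψ⁻¹ Δ = ψ δ := by
  rw [MulChar.inv_apply', eq_inv_of_mul_eq_one_left h]

theorem localTwo_act (ψ : MulChar F ℂ) {y : Matrix (Fin 2 ⊕ Fin 2) (Fin 2 ⊕ Fin 2) F}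
    (hC : y.toBlocks₂₁ = 0) (hAD : y.toBlocks₁₁ * y.toBlocks₂₂ᵀ = 1) (v : Plucker F) :
    localTwo ψ (v.act y) = ψ⁻¹ y.toBlocks₂₂.det * localTwo ψ v := by
  obtain ⟨δ, hδ, hc, -⟩ := act_of_upper hC hAD v
  rw [localTwo, localTwo, hc, map_mul, inv_apply_eq_of_mul_eq_one ψ hδ]

theorem localZero_act [DecidableEq F] (ψ : MulChar F ℂ) {y : Matrix (Fin 2 ⊕ Fin 2) (Fin 2 ⊕ Fin 2) F}
    (hC : y.toBlocks₂₁ = 0) (hAD : y.toBlocks₁₁ * y.toBlocks₂₂ᵀ = 1) (v : Plucker F) :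
    localZero ψ (v.act y) = ψ⁻¹ y.toBlocks₂₂.det * localZero ψ v := by
  obtain ⟨δ, hδ, hc, h⟩ := act_of_upper hC hAD v
  have hδ0 : δ ≠ 0 := left_ne_zero_of_mul_eq_one hδ
  rw [localZero, localZero, hc]
  by_cases h0 : v.c = 0
  swap
  · simp [h0, hδ0]
  obtain ⟨ha, hb, he, hd⟩ := h h0
  by_cases hM : v.a = 0 ∧ v.b = 0 ∧ v.e = 0
  · have h1 : δ * v.c = 0 ∧ (v.act y).a = 0 ∧ (v.act y).b = 0 ∧ (v.act y).e = 0 := by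
      rw [ha, hb, he, hM.1, hM.2.1, hM.2.2, h0]
      simp
    rw [if_pos h1, if_pos ⟨h0, hM⟩, hd hM.1 hM.2.1 hM.2.2, map_mul, mul_comm]
  · rw [if_neg (c := v.c = 0 ∧ v.a = 0 ∧ v.b = 0 ∧ v.e = 0) (fun h' => hM h'.2), if_neg, mul_zero]
    rintro ⟨-, ha', hb', he'⟩
    rw [ha, mul_eq_zero, or_iff_right hδ0] at ha'
    rw [hb, mul_eq_zero, or_iff_right hδ0] at hb'
    rw [he, mul_eq_zero, or_iff_right hδ0] at he'
    rw [Matrix.det_fin_two] at hδ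
    set x := y.toBlocks₂₂ 0 0
    set w := y.toBlocks₂₂ 0 1
    set z := y.toBlocks₂₂ 1 0
    set t := y.toBlocks₂₂ 1 1
    apply hM
    -- The congruence `M ↦ Dᵀ M D` is undone by the congruence by `adj(D)`, up to `det(D)² = δ⁻²`.
    have hsq : δ ^ 2 * (x * t - w * z) ^ 2 = 1 := by rw [← mul_pow, hδ, one_pow]
    refine ⟨?_, ?_, ?_⟩
    · linear_combination -v.a * hsq + δ ^ 2 * (t ^ 2 * ha' - 2 * t * z * hb' + z ^ 2 * he')
    · linear_combination -v.b * hsq + δ ^ 2 * (-(t * w) * ha' + (x * t + w * z) * hb'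
        - x * z * he')
    · linear_combination -v.e * hsq + δ ^ 2 * (w ^ 2 * ha' - 2 * w * x * hb' + x ^ 2 * he')

/-- A nonzero value of a rank one quadratic form determines the form up to squares. -/
theorem quadratic_value [DecidableEq F] (ψ : MulChar F ℂ) (hψ : ∀ x : F, x ≠ 0 → ψ x ^ 2 = 1) {a b e : F}
    (h : a * e = b ^ 2) (x z : F) (hne : x ^ 2 * a + 2 * x * z * b + z ^ 2 * e ≠ 0) :
    ψ (x ^ 2 * a + 2 * x * z * b + z ^ 2 * e) = ψ (if a = 0 then e else a) := by
  split_ifs with ha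
  · have hb : b = 0 := by
      rw [ha, zero_mul] at h
      simpa using h.symm
    rw [ha, hb] at hne ⊢
    simp only [mul_zero, zero_add] at hne ⊢
    have hz : z ≠ 0 := by
      rintro rfl
      simp at hne
    rw [map_mul, map_pow, hψ z hz, one_mul]
  -- Completing the square: as `a e = b²`, `a` times any value of the form is a square, so `ψ` of a
  -- nonzero value equals `ψ a`.
  · have h1 : a * (x ^ 2 * a + 2 * x * z * b + z ^ 2 * e) = (x * a + z * b) ^ 2 := by
      linear_combination z ^ 2 * h
    have h2 : x * a + z * b ≠ 0 := by
      intro h3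
      rw [h3] at h1
      simp [ha, hne] at h1
    have h3 := congrArg ψ h1
    rw [map_mul, map_pow, hψ _ h2, ← hψ a ha, sq (ψ a)] at h3
    exact mul_left_cancel₀ (fun h0 : ψ a = 0 => by
      have h4 := hψ a ha
      rw [h0] at h4
      norm_num at h4) h3

/-- The new `a` and `e` are `δ` times the values of the old form at the columns of `D`. Nonzero
values all have the same `ψ` by `quadratic_value`, and both values vanish only for the zero form
because `D` is invertible. -/
theorem localOne_act [DecidableEq F] (ψ : MulChar F ℂ) (hψ : ∀ x : F, x ≠ 0 → ψ x ^ 2 = 1)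
    {y : Matrix (Fin 2 ⊕ Fin 2) (Fin 2 ⊕ Fin 2) F}
    (hC : y.toBlocks₂₁ = 0) (hAD : y.toBlocks₁₁ * y.toBlocks₂₂ᵀ = 1) (v : Plucker F)
    (hv : v.Isotropic) :
    localOne ψ (v.act y) = ψ⁻¹ y.toBlocks₂₂.det * localOne ψ v := by
  obtain ⟨δ, hδ, hc, h⟩ := act_of_upper hC hAD v
  have hδ0 : δ ≠ 0 := left_ne_zero_of_mul_eq_one hδ
  rw [localOne, localOne, hc]
  by_cases h0 : v.c = 0
  swap
  · simp [h0, hδ0]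
  obtain ⟨ha, hb, he, -⟩ := h h0
  have hq : v.a * v.e = v.b ^ 2 := by
    unfold Isotropic at hv
    rw [h0] at hv
    linear_combination -hv
  rw [if_pos (by simp [h0]), if_pos h0, inv_apply_eq_of_mul_eq_one ψ hδ, ha, he]
  rw [Matrix.det_fin_two] at hδ
  have key := quadratic_value ψ hψ hq
  set x := y.toBlocks₂₂ 0 0
  set w := y.toBlocks₂₂ 0 1
  set z := y.toBlocks₂₂ 1 0
  set t := y.toBlocks₂₂ 1 1
  by_cases hA : x ^ 2 * v.a + 2 * x * z * v.b + z ^ 2 * v.e = 0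
  swap
  · rw [if_neg (mul_ne_zero hδ0 hA), map_mul, key x z hA]
  rw [if_pos (by rw [hA, mul_zero])]
  by_cases hE : w ^ 2 * v.a + 2 * w * t * v.b + t ^ 2 * v.e = 0
  swap
  · rw [map_mul, key w t hE]
  have hva : v.a = 0 := by
    have h1 : (x * v.a + z * v.b) ^ 2 = 0 := by linear_combination v.a * hA - z ^ 2 * hq
    have h2 : (w * v.a + t * v.b) ^ 2 = 0 := by linear_combination v.a * hE - t ^ 2 * hq
    rw [sq_eq_zero_iff] at h1 h2
    linear_combination -v.a * hδ + δ * (t * h1 - z * h2)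
  have hvb : v.b = 0 := by
    rw [hva, zero_mul] at hq
    simpa using hq.symm
  have hve : v.e = 0 := by
    rw [hva, hvb] at hA hE
    have h1 : (z * v.e) ^ 2 = 0 := by linear_combination v.e * hA
    have h2 : (t * v.e) ^ 2 = 0 := by linear_combination v.e * hE
    rw [sq_eq_zero_iff] at h1 h2
    linear_combination -v.e * hδ + δ * (x * h2 - w * h1)
  rw [hE, if_pos hva, hve, mul_zero, ψ.map_nonunit not_isUnit_zero, mul_zero]

end Local

/-! ### The weight function on cusps -/

/-- The local factor at a prime `p ∣ N₀ N₁ N₂` of the coefficients of the Eisenstein series. -/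
noncomputable def localFactor (N₀ N₁ : ℕ) {p : ℕ} (ψ : DirichletCharacter ℂ p)
    (v : Plucker (ZMod p)) : ℂ :=
  if p ∣ N₀ then localZero ψ v else if p ∣ N₁ then localOne ψ v else localTwo ψ v

/-- Reduction of Plücker coordinates modulo `p`. -/
def Plucker.red (p : ℕ) (v : Plucker ℤ) : Plucker (ZMod p) := v.map (Int.castRingHom (ZMod p))

/-- The coefficient of the Eisenstein series at a cusp in Plücker coordinates. -/
noncomputable def weight {N : ℕ} (N₀ N₁ : ℕ) (χ : DirichletCharacter ℂ N) (v : Plucker ℤ) : ℂ :=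
  ∏ p ∈ N.primeFactors, localFactor N₀ N₁ (component χ p) (v.red p)

theorem Plucker.Isotropic.map {R S : Type*} [CommRing R] [CommRing S] (f : R →+* S)
    {v : Plucker R} (h : v.Isotropic) : (v.map f).Isotropic := by
  unfold Isotropic at h ⊢
  simp only [Plucker.map]
  rw [← map_mul, h]
  simp

theorem localFactor_act {N₀ N₁ p : ℕ} (hp : p.Prime) (ψ : DirichletCharacter ℂ p)
    (hψ : p ∣ N₁ → ∀ x : ZMod p, x ≠ 0 → ψ x ^ 2 = 1) {γ : Sp} (hγ : γ ∈ Gamma0 p)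
    {v : Plucker ℤ} (hv : v.Isotropic) :
    localFactor N₀ N₁ ψ ((v.act γ.1).red p) =
      ψ⁻¹ ((blockD γ).det : ℤ) * localFactor N₀ N₁ ψ (v.red p) := by
  have := Fact.mk hp
  set y := (γ.1).map (Int.castRingHom (ZMod p)) with hy
  have hC : y.toBlocks₂₁ = 0 := by
    ext i j
    exact (ZMod.intCast_zmod_eq_zero_iff_dvd _ _).2 (hγ i j)
  have hA : y.toBlocks₁₁ = (blockA γ).map (Int.castRingHom (ZMod p)) := rfl
  have hD : y.toBlocks₂₂ = (blockD γ).map (Int.castRingHom (ZMod p)) := rfl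
  have hCC : y.toBlocks₂₁ = (blockC γ).map (Int.castRingHom (ZMod p)) := rfl
  have hAD : y.toBlocks₁₁ * y.toBlocks₂₂ᵀ = 1 := by
    have h := congrArg (Int.castRingHom (ZMod p)).mapMatrix (row_relations γ).2.2
    rw [map_sub, map_mul, map_mul, map_one] at h
    simp only [RingHom.mapMatrix_apply, Matrix.transpose_map, ← hA, ← hD, ← hCC, hC] at h
    simpa using h
  have hdet : y.toBlocks₂₂.det = (((blockD γ).det : ℤ) : ZMod p) := by
    rw [hD, ← RingHom.mapMatrix_apply, ← RingHom.map_det]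
    simp
  rw [localFactor, localFactor, red, act_map, ← hy, ← hdet]
  split_ifs with h0 h1
  · exact localZero_act ψ hC hAD _
  · exact localOne_act ψ (hψ h1) hC hAD _ (hv.map _)
  · exact localTwo_act ψ hC hAD _

theorem Gamma0_le {M N : ℕ} (h : M ∣ N) : Gamma0 N ≤ Gamma0 M :=
  fun _ hγ i j => (Int.natCast_dvd_natCast.2 h).trans (hγ i j)

section Weight

variable {N N₀ N₁ N₂ : ℕ} {χ : DirichletCharacter ℂ N}

theorem weight_act (hN : Squarefree N) (hN₁ : N₁ ∣ N) (hχ : component χ N₁ ^ 2 = 1) {γ : Sp}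
    (hγ : γ ∈ Gamma0 N) {v : Plucker ℤ} (hv : v.Isotropic) :
    weight N₀ N₁ χ (v.act γ.1) =
      (starRingEnd ℂ) (χ (((blockD γ).det : ℤ) : ZMod N)) * weight N₀ N₁ χ v := by
  rw [← component_self_apply χ hN, component_eq_prod χ hN dvd_rfl, map_prod, weight, weight,
    ← Finset.prod_mul_distrib]
  refine Finset.prod_congr rfl fun p hp => ?_
  have hpp := Nat.prime_of_mem_primeFactors hp
  rw [localFactor_act hpp _ (fun h x hx => component_prime_sq χ hN hN₁ hχ hpp h hx)
    (Gamma0_le (Nat.dvd_of_mem_primeFactors hp) hγ) hv, ← MulChar.star_apply']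
  rfl

theorem plucker_cuspRep (d : Fin 2 → ℤ) : plucker (cuspRep d) = ⟨d 0 * d 1, d 1, 0, d 0, 1⟩ := by
  have hC : (cuspRep d).1.toBlocks₂₁ = !![d 0, 0; 0, d 1] := by
    ext i j
    fin_cases i <;> fin_cases j <;> simp [cuspRep]
  have hD : (cuspRep d).1.toBlocks₂₂ = 1 := by
    simp [cuspRep]
  ext <;> simp [plucker, of, hC, hD, Matrix.adjugate_fin_two, Matrix.det_fin_two]

theorem weight_cuspRep (hρ : N₀ * N₁ * N₂ = N) {d : Fin 2 → ℤ} (hd : IsCuspDiagonal N₀ N₁ N₂ d) :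
    weight N₀ N₁ χ (plucker (cuspRep d)) = 1 := by
  refine Finset.prod_eq_one fun p hp => ?_
  have hpp := Nat.prime_of_mem_primeFactors hp
  have hpN := Nat.dvd_of_mem_primeFactors hp
  have := Fact.mk hpp
  obtain ⟨h0, h1, h2⟩ := hd p hpp
  rw [localFactor, plucker_cuspRep]
  split_ifs with h0' h1'
  · have e0 : (d 0 : ZMod p) = 0 := by simpa using congrFun (congrFun (h0 h0') 0) 0
    have e1 : (d 1 : ZMod p) = 0 := by simpa using congrFun (congrFun (h0 h0') 1) 1
    simp [localZero, red, map, e0, e1]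
  · have e0 : (d 0 : ZMod p) = 1 := by simpa using congrFun (congrFun (h1 h1') 0) 0
    have e1 : (d 1 : ZMod p) = 0 := by simpa using congrFun (congrFun (h1 h1') 1) 1
    simp [localOne, red, map, e0, e1]
  · have h2' : p ∣ N₂ := by
      rw [← hρ, hpp.dvd_mul, hpp.dvd_mul] at hpN
      tauto
    have e0 : (d 0 : ZMod p) = 1 := by simpa using congrFun (congrFun (h2 h2') 0) 0
    have e1 : (d 1 : ZMod p) = 1 := by simpa using congrFun (congrFun (h2 h2') 1) 1
    simp [localTwo, red, map, e0, e1]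

end Weight

/-! ### Solving congruences modulo several primes simultaneously -/

section StrongApproximation

theorem exists_int_forall_cast_eq (S : Finset ℕ) (hS : ∀ p ∈ S, p.Prime) (f : ∀ p : ℕ, ZMod p) :
    ∃ x : ℤ, ∀ p ∈ S, (x : ZMod p) = f p := by
  have hc : Set.Pairwise (S : Set ℕ) (Function.onFun Nat.Coprime id) := fun p hp q hq h =>
    (Nat.coprime_primes (hS p hp) (hS q hq)).2 h
  refine ⟨(Nat.chineseRemainderOfFinset (fun p => (f p).val) id S
    (fun p hp => (hS p hp).ne_zero) hc : ℕ), fun p hp => ?_⟩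
  have := Fact.mk (hS p hp)
  have h := (Nat.chineseRemainderOfFinset (fun p => (f p).val) id S
    (fun p hp => (hS p hp).ne_zero) hc).2 p hp
  have h' := (ZMod.natCast_eq_natCast_iff _ _ _).2 h
  rw [ZMod.natCast_zmod_val] at h'
  rw [Int.cast_natCast]
  exact h'

/-- A symmetric solution `T` of `G⁻ᵀ C = G (A + T C)` for invertible `C`. -/
theorem exists_symm_of_rank_two {F : Type*} [Field F] {A C G : Matrix (Fin 2) (Fin 2) F}
    (hs : Aᵀ * C = Cᵀ * A) (hC : C.det ≠ 0) (hG : G.det = 1) :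
    ∃ x y z : F, G.adjugateᵀ * C = G * (A + !![x, y; y, z] * C) := by
  have hU : IsUnit C.det := hC.isUnit
  have hsymm : (A * C⁻¹)ᵀ = A * C⁻¹ := by
    calc (A * C⁻¹)ᵀ = (C⁻¹)ᵀ * (Aᵀ * C) * C⁻¹ := by
          rw [Matrix.transpose_mul, Matrix.mul_assoc, Matrix.mul_assoc, Matrix.mul_nonsing_inv _ hU,
            Matrix.mul_one]
      _ = (C * C⁻¹)ᵀ * (A * C⁻¹) := by
          rw [hs, Matrix.transpose_mul, Matrix.mul_assoc, Matrix.mul_assoc, Matrix.mul_assoc]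
      _ = A * C⁻¹ := by rw [Matrix.mul_nonsing_inv _ hU, Matrix.transpose_one, Matrix.one_mul]
  -- The equation forces `T = G⁻¹ G⁻ᵀ - A C⁻¹`, and both terms are symmetric.
  set T := G.adjugate * G.adjugateᵀ - A * C⁻¹ with hT
  have hTs : Tᵀ = T := by
    rw [hT, Matrix.transpose_sub, hsymm, Matrix.transpose_mul, Matrix.transpose_transpose]
  refine ⟨T 0 0, T 0 1, T 1 1, ?_⟩
  have hTe : !![T 0 0, T 0 1; T 0 1, T 1 1] = T := by
    have h10 : T 0 1 = T 1 0 := congrFun (congrFun hTs 1) 0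
    ext i j
    fin_cases i <;> fin_cases j <;> simp [h10]
  rw [hTe, hT, Matrix.sub_mul, Matrix.mul_assoc A, Matrix.nonsing_inv_mul _ hU, Matrix.mul_one,
    add_sub_cancel, Matrix.mul_assoc, ← Matrix.mul_assoc G, Matrix.mul_adjugate, hG, one_smul,
    Matrix.one_mul]

/-- A symmetric solution `T` of the first row of `G⁻ᵀ C = G (A + T C)` for `C` of rank one. -/
theorem exists_symm_of_rank_one {F : Type*} [Field F] {A C G : Matrix (Fin 2) (Fin 2) F}
    (hs : Aᵀ * C = Cᵀ * A) (hC : C ≠ 0) (hG : G.det = 1)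
    (h0 : ∀ j, (G.adjugateᵀ * C) 1 j = 0) :
    ∃ x y z : F, ∀ j, (G.adjugateᵀ * C) 0 j = (G * (A + !![x, y; y, z] * C)) 0 j := by
  set R := G.adjugateᵀ * C with hR
  have hCR : C = Gᵀ * R := by
    rw [hR, ← Matrix.mul_assoc, ← Matrix.transpose_mul, Matrix.adjugate_mul, hG]
    simp
  have hC0 (j) : C 0 j = G 0 0 * R 0 j := by
    rw [hCR, Matrix.mul_apply, Fin.sum_univ_two, h0]
    simp
  have hC1 (j) : C 1 j = G 0 1 * R 0 j := by
    rw [hCR, Matrix.mul_apply, Fin.sum_univ_two, h0]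
    simp
  have hs' := congrFun (congrFun hs 0) 1
  simp only [Matrix.mul_apply, Fin.sum_univ_two, Matrix.transpose_apply, hC0, hC1] at hs'
  -- Let `g` be the first row of `G`. Symmetry of `Aᵀ C` says that `g A` is parallel to the nonzero
  -- row `R 0`.
  obtain ⟨s, hs0, hs1⟩ : ∃ s, G 0 0 * A 0 0 + G 0 1 * A 1 0 = s * R 0 0 ∧
      G 0 0 * A 0 1 + G 0 1 * A 1 1 = s * R 0 1 := by
    by_cases hr : R 0 0 = 0
    · have hr1 : R 0 1 ≠ 0 := by
        intro hr1
        apply hC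
        ext i j
        fin_cases i <;> fin_cases j <;> simp [hC0, hC1, hr, hr1]
      refine ⟨(G 0 0 * A 0 1 + G 0 1 * A 1 1) / R 0 1, ?_, by field_simp⟩
      rw [hr] at hs' ⊢
      apply mul_right_cancel₀ hr1
      linear_combination hs'
    · refine ⟨(G 0 0 * A 0 0 + G 0 1 * A 1 0) / R 0 0, by field_simp, ?_⟩
      field_simp
      linear_combination -hs'
  -- The first row of `G (A + T C)` is `(s + g T gᵀ) R 0`, so only `g T gᵀ = 1 - s` is needed.
  obtain ⟨x, y, z, ht⟩ : ∃ x y z : F,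
      G 0 0 ^ 2 * x + 2 * G 0 0 * G 0 1 * y + G 0 1 ^ 2 * z = 1 - s := by
    by_cases hg : G 0 0 = 0
    · have hg1 : G 0 1 ≠ 0 := by
        intro hg1
        rw [Matrix.det_fin_two, hg, hg1] at hG
        simp at hG
      exact ⟨0, 0, (1 - s) / G 0 1 ^ 2, by field_simp; ring⟩
    · exact ⟨(1 - s) / G 0 0 ^ 2, 0, 0, by field_simp; ring⟩
  refine ⟨x, y, z, fun j => ?_⟩
  have hj : G 0 0 * A 0 j + G 0 1 * A 1 j = s * R 0 j := by
    fin_cases j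
    · exact hs0
    · exact hs1
  simp only [Matrix.mul_apply, Matrix.add_apply, Fin.sum_univ_two, Matrix.of_apply,
    Matrix.cons_val', Matrix.cons_val_zero, Matrix.cons_val_one, Matrix.cons_val_fin_one, hC0, hC1]
  linear_combination -hj - R 0 j * ht

/-- Any row vector times `adj(C)` annihilates `C` modulo primes dividing `det C`. A row chosen by
the Chinese remainder theorem makes this vector nonzero modulo every `p ∈ S`; dividing it by its
gcd, which is then prime to `S`, makes it coprime. -/
theorem exists_coprime_annihilating (S : Finset ℕ) (hS : ∀ p ∈ S, p.Prime)
    (C : Matrix (Fin 2) (Fin 2) ℤ) (h0 : ∀ p ∈ S, (C.map (Int.cast : ℤ → ZMod p)) ≠ 0)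
    (hdet : ∀ p ∈ S, ((C.det : ℤ) : ZMod p) = 0) :
    ∃ x y : ℤ, IsCoprime x y ∧ ∀ p ∈ S, ∀ j, ((x * C 0 j + y * C 1 j : ℤ) : ZMod p) = 0 := by
  classical
  have hloc : ∀ p ∈ S, ∃ s t : ZMod p, ¬ (s * C 1 1 - t * C 1 0 = 0 ∧
      -(s * C 0 1) + t * C 0 0 = 0) := by
    intro p hp
    by_contra! h
    apply h0 p hp
    have h1 := h 1 0
    have h2 := h 0 1
    ext i j
    fin_cases i <;> fin_cases j <;> simp at h1 h2 ⊢ <;> tauto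
  choose! s t hst using hloc
  obtain ⟨s', hs'⟩ := exists_int_forall_cast_eq S hS s
  obtain ⟨t', ht'⟩ := exists_int_forall_cast_eq S hS t
  set x₀ := s' * C 1 1 - t' * C 1 0 with hx₀
  set y₀ := -(s' * C 0 1) + t' * C 0 0 with hy₀
  have hne : ∀ p ∈ S, ¬ ((x₀ : ZMod p) = 0 ∧ (y₀ : ZMod p) = 0) := by
    intro p hp h
    apply hst p hp
    simpa [hx₀, hy₀, hs' p hp, ht' p hp] using h
  have hann : ∀ p ∈ S, ∀ j, ((x₀ * C 0 j + y₀ * C 1 j : ℤ) : ZMod p) = 0 := by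
    intro p hp j
    have h : x₀ * C 0 j + y₀ * C 1 j = (if j = 0 then s' else t') * C.det := by
      rw [hx₀, hy₀, Matrix.det_fin_two]
      fin_cases j <;> simp <;> ring
    rw [h, Int.cast_mul, hdet p hp, mul_zero]
  by_cases hz : x₀ = 0 ∧ y₀ = 0
  · refine ⟨1, 0, isCoprime_one_left, fun p hp => ?_⟩
    exact absurd (by simp [hz.1, hz.2]) (hne p hp)
  · have hg : 0 < Int.gcd x₀ y₀ := by
      rw [Nat.pos_iff_ne_zero, Ne, Int.gcd_eq_zero_iff]
      exact hz
    obtain ⟨x, y, hxy, hx, hy⟩ := Int.exists_gcd_one hg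
    refine ⟨x, y, Int.isCoprime_iff_gcd_eq_one.2 hxy, fun p hp j => ?_⟩
    have := Fact.mk (hS p hp)
    have h := hann p hp j
    have h1 := hne p hp
    clear_value x₀ y₀
    generalize Int.gcd x₀ y₀ = k at hx hy
    subst hx hy
    rw [show x * k * C 0 j + y * k * C 1 j = (x * C 0 j + y * C 1 j) * k by ring, Int.cast_mul,
      mul_eq_zero] at h
    refine h.resolve_right fun hg0 => h1 ?_
    rw [Int.cast_mul, Int.cast_mul, hg0, mul_zero, mul_zero]
    exact ⟨rfl, rfl⟩

theorem eq_zero_of_adjugate_mul_eq_zero {F : Type*} [Field F] {C D : Matrix (Fin 2) (Fin 2) F}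
    (h : C.adjugate * D = 0) (hD : D.det ≠ 0) : C = 0 := by
  have h1 : C.adjugate = 0 := by
    have h2 := congrArg (· * D⁻¹) h
    simpa [Matrix.mul_assoc, Matrix.mul_nonsing_inv _ hD.isUnit] using h2
  simpa [h1] using (Matrix.adjugate_adjugate C (by simp)).symm

theorem natCast_dvd_of_squarefree {N : ℕ} (hN : Squarefree N) {x : ℤ}
    (h : ∀ p ∈ N.primeFactors, (x : ZMod p) = 0) : (N : ℤ) ∣ x := by
  rw [Int.natCast_dvd, ← Nat.prod_primeFactors_of_squarefree hN]
  refine Finset.prod_primes_dvd _ (fun p hp => (Nat.prime_of_mem_primeFactors hp).prime)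
    fun p hp => ?_
  rw [← Int.natCast_dvd]
  exact (ZMod.intCast_zmod_eq_zero_iff_dvd _ _).1 (h p hp)

end StrongApproximation

/-! ### The support of the weight is a single orbit -/

section Orbit

variable {N N₀ N₁ N₂ : ℕ} {χ : DirichletCharacter ℂ N}

/-- Nonvanishing of the weight fixes the rank of `C` modulo each `p ∣ N`. Some `h = (G 0; 0 G⁻ᵀ)(I
T; 0 I)` in `GammaInf` is then sought with `γ_ρ⁻¹ h g ∈ Γ_0(N)`, that is `G⁻ᵀ C ≡ M_ρ G (A + T C)`
modulo each `p`. The integral matrix `G` is chosen first so that the second row of `G⁻ᵀ C` vanishes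
at the rank one primes; `T` is then solved prime by prime and glued. -/
theorem exists_plucker_cuspRep_mul_eq (hN : Squarefree N) (hρ : N₀ * N₁ * N₂ = N) {d : Fin 2 → ℤ}
    (hd : IsCuspDiagonal N₀ N₁ N₂ d) (g : Sp) (hw : weight N₀ N₁ χ (plucker g) ≠ 0) :
    ∃ γ ∈ Gamma0 N, plucker (cuspRep d * γ) = plucker g := by
  set S := N.primeFactors
  have hS : ∀ p ∈ S, p.Prime := fun p hp => Nat.prime_of_mem_primeFactors hp
  set A := blockA g with hA
  set C := blockC g with hC
  set D := blockD g with hD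
  have hloc : ∀ p ∈ S, localFactor N₀ N₁ (component χ p) ((plucker g).red p) ≠ 0 := fun p hp =>
    Finset.prod_ne_zero_iff.1 hw p hp
  have hs (p : ℕ) : (A.map (Int.cast : ℤ → ZMod p))ᵀ * C.map Int.cast =
      (C.map Int.cast)ᵀ * A.map Int.cast := by
    have h := congrArg (Int.castRingHom (ZMod p)).mapMatrix (col_relations g).1
    rw [map_mul, map_mul] at h
    exact h
  have hdetC (p : ℕ) : (C.map (Int.cast : ℤ → ZMod p)).det = ((plucker g).red p).c := by
    exact (RingHom.map_det (Int.castRingHom (ZMod p)) C).symm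
  have hadj (p : ℕ) : (C.map (Int.cast : ℤ → ZMod p)).adjugate * D.map (Int.cast : ℤ → ZMod p) =
      !![((plucker g).red p).a, ((plucker g).red p).b; ((plucker g).red p).b,
        ((plucker g).red p).e] := by
    have h1 : C.adjugate * D =
        !![(plucker g).a, (plucker g).b; (plucker g).b, (plucker g).e] := by
      have h2 := congrFun (congrFun (adjugate_blockC_mul_blockD_isSymm g) 0) 1
      ext i j
      fin_cases i <;> fin_cases j
      · rfl
      · rfl
      · exact h2
      · rfl
    have h2 := congrArg (Int.castRingHom (ZMod p)).mapMatrix h1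
    rw [map_mul, RingHom.map_adjugate] at h2
    refine h2.trans ?_
    ext i j
    fin_cases i <;> fin_cases j <;> rfl
  have hzero : ∀ p ∈ S, p ∣ N₀ → C.map (Int.cast : ℤ → ZMod p) = 0 := by
    intro p hp hp0
    have := Fact.mk (hS p hp)
    have h := hloc p hp
    rw [localFactor, if_pos hp0, localZero] at h
    split_ifs at h with h0
    · refine eq_zero_of_adjugate_mul_eq_zero (D := D.map (Int.cast : ℤ → ZMod p)) ?_ ?_
      · rw [hadj, h0.2.1, h0.2.2.1, h0.2.2.2]
        ext i j
        fin_cases i <;> fin_cases j <;> rfl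
      · intro h1
        refine h (MulChar.map_nonunit _ ?_)
        have h2 : (D.map (Int.cast : ℤ → ZMod p)).det = ((plucker g).red p).d :=
          (RingHom.map_det (Int.castRingHom (ZMod p)) D).symm
        rw [← h2, h1]
        exact not_isUnit_zero
    · exact absurd rfl h
  have hone : ∀ p ∈ S, ¬ p ∣ N₀ → p ∣ N₁ → C.map (Int.cast : ℤ → ZMod p) ≠ 0 ∧
      ((C.det : ℤ) : ZMod p) = 0 := by
    intro p hp hp0 hp1
    have := Fact.mk (hS p hp)
    have h := hloc p hp
    rw [localFactor, if_neg hp0, if_pos hp1, localOne] at h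
    split_ifs at h with h0 h1
    · refine ⟨fun hC0 => h (MulChar.map_nonunit _ ?_), h0⟩
      have h2 := congrFun (congrFun (hadj p) 1) 1
      rw [hC0] at h2
      have h3 : ((plucker g).red p).e = 0 := by simpa using h2.symm
      rw [h3]
      exact not_isUnit_zero
    · refine ⟨fun hC0 => h1 ?_, h0⟩
      have h2 := congrFun (congrFun (hadj p) 0) 0
      rw [hC0] at h2
      simpa using h2.symm
    · exact absurd rfl h
  have htwo : ∀ p ∈ S, ¬ p ∣ N₀ → ¬ p ∣ N₁ → (C.map (Int.cast : ℤ → ZMod p)).det ≠ 0 := by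
    intro p hp hp0 hp1 h1
    have := Fact.mk (hS p hp)
    have h := hloc p hp
    rw [localFactor, if_neg hp0, if_neg hp1, localTwo, ← hdetC, h1] at h
    exact h (MulChar.map_nonunit _ not_isUnit_zero)
  obtain ⟨x, y, hxy, hann⟩ := exists_coprime_annihilating (S.filter fun p => ¬ p ∣ N₀ ∧ p ∣ N₁)
    (fun p hp => hS p (Finset.mem_filter.1 hp).1) C
    (fun p hp => (hone p (Finset.mem_filter.1 hp).1 (Finset.mem_filter.1 hp).2.1
      (Finset.mem_filter.1 hp).2.2).1)
    (fun p hp => (hone p (Finset.mem_filter.1 hp).1 (Finset.mem_filter.1 hp).2.1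
      (Finset.mem_filter.1 hp).2.2).2)
  -- With first row `(y, -x)` for `G`, the second row of `G⁻ᵀ` is the annihilating vector `(x, y)`.
  obtain ⟨G, hG00, hG01⟩ : ∃ G : Matrix.SpecialLinearGroup (Fin 2) ℤ, G.1 0 0 = y ∧
      G.1 0 1 = -x := by
    obtain ⟨u, w, huw⟩ := hxy
    exact ⟨⟨!![y, -x; u, w], by rw [Matrix.det_fin_two_of]; linear_combination huw⟩, rfl, rfl⟩
  have hT : ∀ p ∈ S, ∃ t₁ t₂ t₃ : ZMod p, (Matrix.diagonal d).map (Int.cast : ℤ → ZMod p) *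
      (G.1.map Int.cast * (A.map Int.cast + !![t₁, t₂; t₂, t₃] * C.map Int.cast)) =
      (G.1.map Int.cast).adjugateᵀ * C.map Int.cast := by
    intro p hp
    have := Fact.mk (hS p hp)
    have hGdet : (G.1.map (Int.cast : ℤ → ZMod p)).det = 1 := by
      have h := (RingHom.map_det (Int.castRingHom (ZMod p)) G.1).symm
      rw [G.2] at h
      simpa using h
    obtain ⟨h0, h1, h2⟩ := hd p (hS p hp)
    by_cases hp0 : p ∣ N₀
    · exact ⟨0, 0, 0, by rw [h0 hp0, hzero p hp hp0]; simp⟩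
    by_cases hp1 : p ∣ N₁
    · have hann' := hann p (Finset.mem_filter.2 ⟨hp, hp0, hp1⟩)
      have hrow : ∀ j, ((G.1.map (Int.cast : ℤ → ZMod p)).adjugateᵀ *
          C.map (Int.cast : ℤ → ZMod p) : Matrix (Fin 2) (Fin 2) (ZMod p)) 1 j = 0 := by
        intro j
        have := hann' j
        push_cast at this
        simp [Matrix.adjugate_fin_two, Matrix.mul_apply, hG00, hG01]
        linear_combination this
      obtain ⟨t₁, t₂, t₃, ht⟩ := exists_symm_of_rank_one (hs p) (hone p hp hp0 hp1).1 hGdet hrow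
      refine ⟨t₁, t₂, t₃, ?_⟩
      rw [h1 hp1]
      ext i j
      fin_cases i
      · rw [Matrix.mul_apply, Fin.sum_univ_two]
        simpa using (ht j).symm
      · rw [Matrix.mul_apply, Fin.sum_univ_two]
        simpa using (hrow j).symm
    · have hp2 : p ∣ N₂ := by
        have h := Nat.dvd_of_mem_primeFactors hp
        rw [← hρ, (hS p hp).dvd_mul, (hS p hp).dvd_mul] at h
        tauto
      obtain ⟨t₁, t₂, t₃, ht⟩ := exists_symm_of_rank_two (hs p) (htwo p hp hp0 hp1) hGdet
      exact ⟨t₁, t₂, t₃, by rw [h2 hp2, Matrix.one_mul, ht]⟩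
  choose! t₁ t₂ t₃ ht using hT
  obtain ⟨s₁, hs₁⟩ := exists_int_forall_cast_eq S hS t₁
  obtain ⟨s₂, hs₂⟩ := exists_int_forall_cast_eq S hS t₂
  obtain ⟨s₃, hs₃⟩ := exists_int_forall_cast_eq S hS t₃
  set h := levi G * translation s₁ s₂ s₃ with hh
  have hcoe : (h : Matrix (Fin 2 ⊕ Fin 2) (Fin 2 ⊕ Fin 2) ℤ) =
      Matrix.fromBlocks G.1 (G.1 * !![s₁, s₂; s₂, s₃]) 0 (G.1.adjugate)ᵀ := by
    simp [hh, levi, translation, Matrix.fromBlocks_multiply]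
  have hmem : h ∈ GammaInf := by
    refine ⟨?_, ?_⟩
    · rw [blockC, hcoe, Matrix.toBlocks_fromBlocks₂₁]
    · rw [blockD, hcoe, Matrix.toBlocks_fromBlocks₂₂, Matrix.det_transpose, Matrix.det_adjugate,
        G.2, one_pow]
  have hinv : cuspRep d * cuspRep (-d) = 1 := by
    refine Subtype.ext ?_
    simp [cuspRep, Matrix.fromBlocks_multiply, Matrix.diagonal_add]
  refine ⟨cuspRep (-d) * (h * g), ?_, ?_⟩
  · intro i j
    refine natCast_dvd_of_squarefree hN fun p hp => ?_
    have hb : blockC (cuspRep (-d) * (h * g)) = (G.1.adjugate)ᵀ * C -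
        Matrix.diagonal d * (G.1 * (A + !![s₁, s₂; s₂, s₃] * C)) := by
      rw [blockC, Submonoid.coe_mul, Submonoid.coe_mul, hcoe, coe_eq_fromBlocks g, cuspRep]
      simp only [Matrix.fromBlocks_multiply, Matrix.toBlocks_fromBlocks₂₁, ← hA, ← hC,
        Matrix.mul_add, Matrix.mul_assoc, Matrix.one_mul, Matrix.zero_mul, zero_add]
      rw [show Matrix.diagonal (-d) = -Matrix.diagonal d from (Matrix.diagonal_neg d).symm]
      simp only [Matrix.neg_mul]
      abel
    have h1 := congrArg (Int.castRingHom (ZMod p)).mapMatrix hb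
    rw [map_sub, map_mul, map_mul, map_mul, map_add, map_mul] at h1
    have hT : (Int.castRingHom (ZMod p)).mapMatrix !![s₁, s₂; s₂, s₃] =
        !![t₁ p, t₂ p; t₂ p, t₃ p] := by
      rw [← hs₁ p hp, ← hs₂ p hp, ← hs₃ p hp]
      ext i j
      fin_cases i <;> fin_cases j <;> rfl
    have hadjG : (Int.castRingHom (ZMod p)).mapMatrix (G.1.adjugate)ᵀ =
        (G.1.map (Int.cast : ℤ → ZMod p)).adjugateᵀ :=
      congrArg Matrix.transpose (RingHom.map_adjugate (Int.castRingHom (ZMod p)) G.1)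
    rw [hT, hadjG] at h1
    have h2 := h1.trans (sub_eq_zero.2 (ht p hp).symm)
    exact congrFun (congrFun h2 i) j
  · rw [← mul_assoc, hinv, one_mul, plucker_eq_iff, mul_inv_cancel_right]
    exact hmem

end Orbit

/-! ### Eisenstein series as sums over primitive isotropic vectors -/

/-- The value `det (C τ + D)` in terms of Plücker coordinates. -/
def linForm (τ : Matrix (Fin 2) (Fin 2) ℂ) (v : Plucker ℂ) : ℂ :=
  v.c * τ.det + v.e * τ 0 0 + v.a * τ 1 1 - v.b * (τ 0 1 + τ 1 0) + v.d

theorem det_denom (x : Matrix (Fin 2 ⊕ Fin 2) (Fin 2 ⊕ Fin 2) ℝ)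
    (hx : x ∈ Matrix.symplecticGroup (Fin 2) ℝ) (τ : Matrix (Fin 2) (Fin 2) ℂ) :
    (denom x τ).det = linForm τ ((of x).map Complex.ofRealHom) := by
  have h := congrArg (Complex.ofReal : ℝ → ℂ) (congrFun (congrFun (isSymm_of_mem_symplecticGroup hx) 1) 0)
  simp only [Matrix.transpose_apply, Matrix.adjugate_fin_two, Matrix.mul_apply, Fin.sum_univ_two,
    Matrix.of_apply, Matrix.cons_val', Matrix.cons_val_zero, Matrix.cons_val_one,
    Matrix.cons_val_fin_one] at h
  push_cast at h
  simp only [denom, linForm, of, Plucker.map, Matrix.det_fin_two, Matrix.add_apply,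
    Matrix.mul_apply, Fin.sum_univ_two, Matrix.map_apply, Matrix.adjugate_fin_two,
    Matrix.of_apply, Matrix.cons_val', Matrix.cons_val_zero, Matrix.cons_val_one,
    Matrix.cons_val_fin_one, Complex.ofRealHom_eq_coe]
  push_cast
  linear_combination τ 0 1 * h

/-- The coordinates of a cusp as complex numbers. -/
def Cusp.toComplex (v : Cusp) : Plucker ℂ := v.1.map (Int.castRingHom ℂ)

theorem of_toReal (γ : Sp) : of (toReal γ) = (plucker γ).map (Int.castRingHom ℝ) :=
  of_map (Int.castRingHom ℝ) _

theorem toReal_mem (γ : Sp) : toReal γ ∈ Matrix.symplecticGroup (Fin 2) ℝ :=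
  SymplecticGroup.map_mem (f := Int.castRingHom ℝ) γ.2

theorem det_denom_toReal (γ : Sp) (τ : Matrix (Fin 2) (Fin 2) ℂ) :
    (denom (toReal γ) τ).det = linForm τ (Cusp.mk γ).toComplex := by
  rw [det_denom _ (toReal_mem γ), of_toReal]
  congr 1

variable {N N₀ N₁ N₂ : ℕ} {χ : DirichletCharacter ℂ N}

theorem mem_cuspStabilizer_iff (N : ℕ) (γ₀ : Sp) (γ δ : Gamma0 N) :
    γ * δ⁻¹ ∈ cuspStabilizer N γ₀ ↔ Cusp.mk (γ₀ * γ) = Cusp.mk (γ₀ * δ) := by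
  have h : Cusp.mk (γ₀ * γ) = Cusp.mk (γ₀ * δ) ↔ plucker (γ₀ * γ) = plucker (γ₀ * δ) :=
    Subtype.ext_iff
  rw [h, plucker_eq_iff, cuspStabilizer, Subgroup.mem_subgroupOf, Subgroup.mem_comap]
  simp [mul_assoc]

/-- The cosets of the cusp stabiliser inject into the cusps. The weight equals the summand's
character value on the image and vanishes off it, so the sum extends to all cusps. -/
theorem eisenstein_eq_tsum (k : ℕ) (hN : Squarefree N) (hρ : N₀ * N₁ * N₂ = N)
    (hχ : component χ N₁ ^ 2 = 1) {d : Fin 2 → ℤ} (hd : IsCuspDiagonal N₀ N₁ N₂ d)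
    (τ : Matrix (Fin 2) (Fin 2) ℂ) :
    eisenstein k N χ (cuspRep d) τ =
      1 / 2 * ∑' v : Cusp, weight N₀ N₁ χ v.1 * linForm τ v.toComplex ^ (-(k : ℤ)) := by
  have hN₁ : N₁ ∣ N := ⟨N₀ * N₂, by rw [← hρ]; ring⟩
  set ι : Quotient (QuotientGroup.rightRel (cuspStabilizer N (cuspRep d))) → Cusp :=
    fun c => Cusp.mk (cuspRep d * (c.out : Sp)) with hι
  have hinj : Function.Injective ι := by
    intro c c' h
    rw [← Quotient.out_equiv_out]
    refine QuotientGroup.rightRel_apply.2 ?_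
    exact (mem_cuspStabilizer_iff _ _ _ _).2 h.symm
  rw [eisenstein, ← hinj.tsum_eq]
  · congr 1
    refine tsum_congr fun c => ?_
    have h : (ι c).1 = (plucker (cuspRep d)).act (c.out : Sp).1 := plucker_mul _ _
    rw [det_denom_toReal, h, weight_act hN hN₁ hχ c.out.2 (plucker_isotropic _),
      weight_cuspRep hρ hd, mul_one]
  · intro v hv
    obtain ⟨g, rfl⟩ := v.exists_rep
    obtain ⟨γ, hγ, h⟩ := exists_plucker_cuspRep_mul_eq hN hρ hd g
      (left_ne_zero_of_mul (Function.mem_support.1 hv))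
    refine ⟨Quotient.mk _ ⟨γ, hγ⟩, ?_⟩
    have h1 := Quotient.mk_out (s := QuotientGroup.rightRel (cuspStabilizer N (cuspRep d)))
      ⟨γ, hγ⟩
    have h2 := QuotientGroup.rightRel_apply.1 h1
    rw [mem_cuspStabilizer_iff] at h2
    exact h2.symm.trans (Subtype.ext h)

/-! ### A lower bound for the automorphy factor -/

section LowerBound

/-- Put `P = (a b; b e) + c X`, where `X` here collects the real parts of `τ` with its diagonal
exchanged to match `linForm`. The imaginary part of the equation makes `P` orthogonal to a positive
definite matrix, forcing `det P ≤ 0`, while the real part and isotropy give `det P = c² det Im τ ≥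
0`. The identity `e3` is the resulting sum of nonnegative terms. -/
theorem eq_zero_of_linForm_eq_zero {τ : Matrix (Fin 2) (Fin 2) ℂ} (hτ : τ ∈ upperHalfSpace)
    {v : Plucker ℝ} (hv : v.Isotropic) (h : linForm τ (v.map Complex.ofRealHom) = 0) :
    v = ⟨0, 0, 0, 0, 0⟩ := by
  obtain ⟨hs, hp⟩ := hτ
  have h10 : τ 1 0 = τ 0 1 := congrFun (congrFun hs 0) 1
  have hy : 0 < (τ 0 0).im := hp.diag_pos (i := 0)
  have hdet : 0 < (τ 0 0).im * (τ 1 1).im - (τ 0 1).im ^ 2 := by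
    have := hp.det_pos
    rw [Matrix.det_fin_two] at this
    simp only [Matrix.map_apply, h10] at this
    linarith
  have hre := congrArg Complex.re h
  have him := congrArg Complex.im h
  simp only [linForm, Plucker.map, Matrix.det_fin_two, h10, Complex.ofRealHom_eq_coe,
    Complex.add_re, Complex.sub_re, Complex.mul_re, Complex.add_im, Complex.sub_im, Complex.mul_im,
    Complex.ofReal_re, Complex.ofReal_im, Complex.zero_re, Complex.zero_im] at hre him
  obtain ⟨c, a, b, e, d⟩ := v
  unfold Isotropic at hv
  simp only at hv hre him
  generalize (τ 0 0).re = x₀ at *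
  generalize (τ 0 0).im = y₀ at *
  generalize (τ 1 1).re = x₁ at *
  generalize (τ 1 1).im = y₁ at *
  generalize (τ 0 1).re = x₂ at *
  generalize (τ 0 1).im = y₂ at *
  set p := c * x₀ + a with hp'
  set r := c * x₂ + b with hr'
  set s := c * x₁ + e with hs'
  have e1 : p * y₁ + s * y₀ - 2 * r * y₂ = 0 := by
    rw [hp', hr', hs']
    linear_combination him
  have e2 : p * s - r ^ 2 = c ^ 2 * (y₀ * y₁ - y₂ ^ 2) := by
    rw [hp', hr', hs']
    linear_combination c * hre - hv
  have e3 : (y₀ ^ 2 * c ^ 2 + p ^ 2) * (y₀ * y₁ - y₂ ^ 2) + (y₀ * r - p * y₂) ^ 2 = 0 := by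
    linear_combination y₀ ^ 2 * (-e2) + p * y₀ * e1
  have h1 : 0 ≤ (y₀ ^ 2 * c ^ 2 + p ^ 2) * (y₀ * y₁ - y₂ ^ 2) := by positivity
  have h2 : (y₀ ^ 2 * c ^ 2 + p ^ 2) * (y₀ * y₁ - y₂ ^ 2) = 0 := by
    nlinarith [sq_nonneg (y₀ * r - p * y₂)]
  have h3 : y₀ ^ 2 * c ^ 2 + p ^ 2 = 0 := (mul_eq_zero.1 h2).resolve_right hdet.ne'
  have hp0 : p = 0 := by
    have : p ^ 2 = 0 := by nlinarith [sq_nonneg p, mul_nonneg (sq_nonneg y₀) (sq_nonneg c)]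
    simpa using this
  have hc0 : c = 0 := by
    rw [hp0] at h3
    have : y₀ ^ 2 * c ^ 2 = 0 := by linarith
    simpa [hy.ne'] using this
  have hr0 : r = 0 := by
    rw [h2, hp0] at e3
    simpa [hy.ne'] using e3
  have ha : a = 0 := by simpa [hc0, hp0] using hp'.symm
  have hb : b = 0 := by simpa [hc0, hr0] using hr'.symm
  have he : e = 0 := by
    rw [hp0, hr0] at e1
    have : s = 0 := by simpa [hy.ne'] using e1
    simpa [hc0, this] using hs'.symm
  have hd : d = 0 := by
    rw [hc0, ha, hb, he] at hre
    simpa using hre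
  rw [hc0, ha, hb, he, hd]

/-- The coordinate vector. -/
def Plucker.vec {R : Type*} (v : Plucker R) : Fin 5 → R := ![v.c, v.a, v.b, v.e, v.d]

/-- The element with given coordinate vector. -/
def Plucker.ofVec {R : Type*} (w : Fin 5 → R) : Plucker R := ⟨w 0, w 1, w 2, w 3, w 4⟩

/-- Both sides are homogeneous of degree one, so it suffices to take the minimum over the compact
set of isotropic vectors of norm one, which is positive by `eq_zero_of_linForm_eq_zero`. -/
theorem exists_linForm_lower_bound {τ : Matrix (Fin 2) (Fin 2) ℂ} (hτ : τ ∈ upperHalfSpace) :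
    ∃ κ > 0, ∀ v : Plucker ℝ, v.Isotropic →
      κ * ‖v.vec‖ ≤ ‖linForm τ (v.map Complex.ofRealHom)‖ := by
  set g : (Fin 5 → ℝ) → ℝ := fun w => ‖linForm τ ((ofVec w).map Complex.ofRealHom)‖ with hg
  have hgc : Continuous g := by
    simp only [hg, linForm, ofVec, Plucker.map, Complex.ofRealHom_eq_coe]
    fun_prop
  have hgs (t : ℝ) (w : Fin 5 → ℝ) : g (t • w) = |t| * g w := by
    simp only [hg]
    rw [← Complex.norm_real t |>.trans (Real.norm_eq_abs t), ← norm_mul]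
    congr 1
    simp [linForm, ofVec, Plucker.map]
    ring
  set S : Set (Fin 5 → ℝ) := {w | ‖w‖ = 1 ∧ (ofVec w).Isotropic} with hS
  have hcomp : IsCompact S := by
    have h1 : S = Metric.sphere 0 1 ∩ {w | w 0 * w 4 = w 1 * w 3 - w 2 ^ 2} := by
      ext w
      simp [hS, Isotropic, ofVec]
    rw [h1]
    exact (isCompact_sphere 0 1).inter_right (isClosed_eq (by fun_prop) (by fun_prop))
  have key : ∃ κ > 0, ∀ w ∈ S, κ ≤ g w := by
    rcases S.eq_empty_or_nonempty with he | hne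
    · exact ⟨1, one_pos, by simp [he]⟩
    · obtain ⟨w, hw, hmin⟩ := hcomp.exists_isMinOn hne hgc.continuousOn
      refine ⟨g w, ?_, fun w' hw' => hmin hw'⟩
      refine norm_pos_iff.2 fun h0 => ?_
      have h1 := eq_zero_of_linForm_eq_zero hτ hw.2 h0
      have h2 : w = 0 := by
        have := Plucker.ext_iff.1 h1
        ext i
        fin_cases i
        exacts [this.1, this.2.1, this.2.2.1, this.2.2.2.1, this.2.2.2.2]
      have h3 := hw.1
      rw [h2] at h3
      simp at h3
  obtain ⟨κ, hκ, hmin⟩ := key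
  refine ⟨κ, hκ, fun v hv => ?_⟩
  change _ ≤ g v.vec
  by_cases h0 : v.vec = 0
  · rw [h0, norm_zero, mul_zero]
    exact norm_nonneg _
  · have hn : 0 < ‖v.vec‖ := norm_pos_iff.2 h0
    have h1 : ‖v.vec‖⁻¹ • v.vec ∈ S := by
      refine ⟨by rw [norm_smul, norm_inv, norm_norm, inv_mul_cancel₀ hn.ne'], ?_⟩
      generalize ‖v.vec‖⁻¹ = t
      unfold Isotropic at hv ⊢
      simp only [ofVec, vec, Pi.smul_apply, smul_eq_mul, Matrix.cons_val]
      linear_combination t ^ 2 * hv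
    have h2 := hmin _ h1
    rw [hgs, abs_of_pos (inv_pos.2 hn)] at h2
    calc κ * ‖v.vec‖ ≤ ‖v.vec‖⁻¹ * g v.vec * ‖v.vec‖ := by gcongr
      _ = g v.vec := by field_simp

end LowerBound

/-! ### A divisor bound -/

section Divisors

/-- The quotient `(k + 1)⁴ / 2ᵏ` is largest at `k = 5`, where it is `40.5`. For `k ≥ 8` the left
side at most doubles at each step. -/
theorem succ_pow_four_le (k : ℕ) : (k + 1) ^ 4 ≤ 41 * 2 ^ k := by
  rcases lt_or_ge k 8 with h | h
  · interval_cases k <;> norm_num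
  · induction k, h using Nat.le_induction with
    | base => norm_num
    | succ k hk ih =>
      have h1 : (k + 1 + 1) ^ 4 ≤ 2 * (k + 1) ^ 4 := by
        obtain ⟨j, rfl⟩ := Nat.exists_eq_add_of_le hk
        ring_nf
        nlinarith [sq_nonneg j]
      rw [pow_succ 2 k]
      omega

theorem succ_pow_four_le_of_large (k : ℕ) {p : ℕ} (hp : 16 ≤ p) : (k + 1) ^ 4 ≤ p ^ k := by
  calc (k + 1) ^ 4 ≤ (2 ^ k) ^ 4 := Nat.pow_le_pow_left Nat.lt_two_pow_self 4
    _ = 16 ^ k := by rw [← pow_mul, mul_comm, pow_mul]; norm_num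
    _ ≤ p ^ k := Nat.pow_le_pow_left hp k

/-- The inequality is multiplicative. A prime power costs the factor `41` only when the prime is
below `16 = 2⁴`. -/
theorem card_divisors_pow_four_le_aux (n : ℕ) (hn : 0 < n) :
    n.divisors.card ^ 4 ≤ 41 ^ (n.primeFactors.filter (· < 16)).card * n := by
  induction n using Nat.recOnPosPrimePosCoprime with
  | zero => omega
  | one => simp
  | prime_pow p k hp hk =>
    rw [Nat.divisors_prime_pow hp, Finset.card_map, Finset.card_range,
      Nat.primeFactors_prime_pow hk.ne' hp]
    by_cases h : p < 16
    · rw [Finset.filter_singleton, if_pos h, Finset.card_singleton, pow_one]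
      exact (succ_pow_four_le k).trans (by gcongr; exact hp.two_le)
    · rw [Finset.filter_singleton, if_neg h, Finset.card_empty, pow_zero, one_mul]
      exact succ_pow_four_le_of_large k (not_lt.1 h)
  | coprime a b ha hb hab iha ihb =>
    rw [hab.card_divisors_mul, hab.primeFactors_mul, Finset.filter_union, Finset.card_union_of_disjoint
      (Finset.disjoint_filter_filter hab.disjoint_primeFactors), mul_pow, pow_add]
    calc _ ≤ _ := Nat.mul_le_mul (iha (by omega)) (ihb (by omega))
      _ = _ := by ring

/-- A divisor bound. -/
theorem card_divisors_pow_four_le (n : ℕ) (hn : 0 < n) : n.divisors.card ^ 4 ≤ 41 ^ 16 * n := by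
  refine (card_divisors_pow_four_le_aux n hn).trans ?_
  gcongr
  · norm_num
  · calc (n.primeFactors.filter (· < 16)).card ≤ (Finset.range 16).card :=
        Finset.card_le_card fun p hp => Finset.mem_range.2 (Finset.mem_filter.1 hp).2
      _ = 16 := Finset.card_range 16

end Divisors

/-! ### Absolute convergence in weight at least four -/

section Summability

theorem summable_norm_rpow_int {n : ℕ} {r : ℝ} (hr : r < -n) :
    Summable fun x : Fin n → ℤ => ‖x‖ ^ r := by
  set L := Submodule.span ℤ (Set.range (Pi.basisFun ℝ (Fin n))) with hL
  have hrank : Module.finrank ℤ L = n := by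
    rw [ZLattice.rank ℝ L]
    simp
  have hs := ZLattice.summable_norm_rpow L r (by rw [hrank]; exact hr)
  have hmem (x : Fin n → ℤ) : (fun i => (x i : ℝ)) ∈ L := by
    rw [hL, Module.Basis.mem_span_iff_repr_mem]
    intro i
    exact ⟨x i, by simp⟩
  have hinj : Function.Injective fun x : Fin n → ℤ => (⟨fun i => (x i : ℝ), hmem x⟩ : L) := by
    intro x y h
    ext i
    have : (x i : ℝ) = y i := congrFun (congrArg Subtype.val h) i
    exact_mod_cast this
  refine (hs.comp_injective hinj).congr fun x => ?_
  simp only [Function.comp]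
  congr 1

/-- The number of divisors of `n ≤ 2 ‖x‖²` is `O(n^(1/4)) = O(‖x‖^(1/2))`, which leaves the exponent
`-7/2`, still below `-3` as required on `ℤ³`. -/
theorem summable_divisor_sum : Summable fun x : (Fin 3 → ℤ) × ℕ =>
    if x.2 ∈ (x.1 0 * x.1 2 - x.1 1 ^ 2).natAbs.divisors then ‖x.1‖ ^ (-4 : ℝ) else 0 := by
  rw [summable_prod_of_nonneg (fun x => by positivity)]
  have hsum (x : Fin 3 → ℤ) : HasSum (fun m : ℕ =>
      if m ∈ (x 0 * x 2 - x 1 ^ 2).natAbs.divisors then ‖x‖ ^ (-4 : ℝ) else 0)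
      ((x 0 * x 2 - x 1 ^ 2).natAbs.divisors.card * ‖x‖ ^ (-4 : ℝ)) := by
    have h : HasSum (fun m : ℕ =>
        if m ∈ (x 0 * x 2 - x 1 ^ 2).natAbs.divisors then ‖x‖ ^ (-4 : ℝ) else 0) _ :=
      hasSum_sum_of_ne_finset_zero (s := (x 0 * x 2 - x 1 ^ 2).natAbs.divisors)
        (fun m hm => if_neg hm)
    rwa [Finset.sum_congr rfl (fun m hm => if_pos hm), Finset.sum_const, nsmul_eq_mul] at h
  refine ⟨fun x => (hsum x).summable, ?_⟩
  simp only [(hsum _).tsum_eq]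
  have hr : Summable fun x : Fin 3 → ℤ => ‖x‖ ^ (-(7 / 2) : ℝ) :=
    summable_norm_rpow_int (by norm_num)
  refine Summable.of_nonneg_of_le (fun x => by positivity) (fun x => ?_)
    (hr.mul_left ((2 * 41 ^ 16 : ℝ) ^ (1 / 4 : ℝ)))
  set n := (x 0 * x 2 - x 1 ^ 2).natAbs with hn
  by_cases h0 : n = 0
  · rw [h0, Nat.divisors_zero, Finset.card_empty, Nat.cast_zero, zero_mul]
    positivity
  have hx : x ≠ 0 := by
    rintro rfl
    simp [hn] at h0
  have hxn : 0 < ‖x‖ := norm_pos_iff.2 hx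
  have hnx : (n : ℝ) ≤ 2 * ‖x‖ ^ 2 := by
    have h1 (i) : |(x i : ℝ)| ≤ ‖x‖ := by
      rw [← Int.norm_eq_abs]
      exact norm_le_pi_norm x i
    have h2 : (n : ℝ) = |(x 0 : ℝ) * x 2 - x 1 ^ 2| := by
      rw [hn, Nat.cast_natAbs]
      push_cast
      rfl
    rw [h2]
    calc |(x 0 : ℝ) * x 2 - x 1 ^ 2| ≤ |(x 0 : ℝ)| * |(x 2 : ℝ)| + |(x 1 : ℝ)| ^ 2 := by
          rw [← abs_mul, ← abs_pow]
          exact abs_sub _ _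
      _ ≤ ‖x‖ * ‖x‖ + ‖x‖ ^ 2 := by
          gcongr <;> exact h1 _
      _ = 2 * ‖x‖ ^ 2 := by ring
  have hd : ((n.divisors.card : ℕ) : ℝ) ≤ (2 * 41 ^ 16 : ℝ) ^ (1 / 4 : ℝ) * ‖x‖ ^ (1 / 2 : ℝ) := by
    have h1 : ((n.divisors.card : ℕ) : ℝ) ^ 4 ≤ 41 ^ 16 * n := by
      exact_mod_cast card_divisors_pow_four_le n (Nat.pos_of_ne_zero h0)
    have h2 : ((n.divisors.card : ℕ) : ℝ) ^ 4 ≤ 2 * 41 ^ 16 * ‖x‖ ^ 2 := by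
      calc _ ≤ (41 : ℝ) ^ 16 * n := h1
        _ ≤ 41 ^ 16 * (2 * ‖x‖ ^ 2) := by gcongr
        _ = _ := by ring
    have h3 := Real.rpow_le_rpow (by positivity) h2 (show (0 : ℝ) ≤ 1 / 4 by norm_num)
    rw [Real.mul_rpow (by positivity) (by positivity), ← Real.rpow_natCast, ← Real.rpow_natCast ‖x‖,
      ← Real.rpow_mul (by positivity), ← Real.rpow_mul (by positivity)] at h3
    norm_num at h3 ⊢
    exact h3
  calc ((n.divisors.card : ℕ) : ℝ) * ‖x‖ ^ (-4 : ℝ)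
      ≤ (2 * 41 ^ 16 : ℝ) ^ (1 / 4 : ℝ) * ‖x‖ ^ (1 / 2 : ℝ) * ‖x‖ ^ (-4 : ℝ) := by gcongr
    _ = (2 * 41 ^ 16 : ℝ) ^ (1 / 4 : ℝ) * ‖x‖ ^ (-(7 / 2) : ℝ) := by
        rw [mul_assoc, ← Real.rpow_add hxn]
        norm_num

theorem summable_bool_factor {α : Type*} {f : α → ℝ} (hf : Summable f) (h0 : 0 ≤ f) {β : Type*}
    [Finite β] : Summable fun x : α × β => f x.1 := by
  simpa using hf.mul_of_nonneg (Summable.of_finite (f := fun _ : β => (1 : ℝ))) h0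
    (fun _ => zero_le_one)

/-- If `c d ≠ 0`, the vector is determined by `(a, b, e)`, the divisor `|c|` of `a e - b²` and a
sign. If `c d = 0`, it is determined by a point of `ℤ³` and two binary choices. The norm of the
vector dominates that of the triple in both cases. -/
theorem summable_cusp_norm : Summable fun v : Cusp => ‖v.1.vec‖ ^ (-4 : ℝ) := by
  have hmono (v : Cusp) {n : ℕ} {x : Fin n → ℤ} (hx : x ≠ 0) (h : ‖x‖ ≤ ‖v.1.vec‖) :
      ‖v.1.vec‖ ^ (-4 : ℝ) ≤ ‖x‖ ^ (-4 : ℝ) :=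
    Real.rpow_le_rpow_of_nonpos (norm_pos_iff.2 hx) h (by norm_num)
  have hcoord (v : Cusp) (i : Fin 5) : ‖v.1.vec i‖ ≤ ‖v.1.vec‖ := norm_le_pi_norm _ i
  set s : Set Cusp := {v | v.1.c * v.1.d ≠ 0} with hs
  have h1 : Summable ((fun v : Cusp => ‖v.1.vec‖ ^ (-4 : ℝ)) ∘ ((↑) : s → Cusp)) := by
    have hb := summable_bool_factor summable_divisor_sum (fun x => by positivity) (β := Bool)
    set ι : s → ((Fin 3 → ℤ) × ℕ) × Bool := fun v =>
      ((![v.1.1.a, v.1.1.b, v.1.1.e], v.1.1.c.natAbs), decide (0 ≤ v.1.1.c)) with hι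
    have hinj : Function.Injective ι := by
      rintro ⟨⟨v, hv⟩, hvs⟩ ⟨⟨w, hw⟩, hws⟩ h
      simp only [hι, Prod.mk.injEq, decide_eq_decide] at h
      obtain ⟨⟨hx, hc⟩, hb⟩ := h
      have ha : v.a = w.a := congrFun hx 0
      have hb' : v.b = w.b := congrFun hx 1
      have he : v.e = w.e := congrFun hx 2
      have hc' : v.c = w.c := by omega
      have hd : v.d = w.d := by
        have h1 := hv.1
        have h2 := hw.1
        unfold Isotropic at h1 h2
        refine mul_left_cancel₀ (left_ne_zero_of_mul hvs : v.c ≠ 0) ?_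
        rw [h1, hc', h2, ha, hb', he]
      exact Subtype.ext (Subtype.ext (Plucker.ext hc' ha hb' he hd))
    refine Summable.of_nonneg_of_le (fun v => by simp only [Function.comp]; positivity) (fun v => ?_)
      (hb.comp_injective hinj)
    obtain ⟨⟨v, hv⟩, hvs⟩ := v
    have hi : v.c * v.d = v.a * v.e - v.b ^ 2 := hv.1
    have hne : v.a * v.e - v.b ^ 2 ≠ 0 := hi ▸ hvs
    have hmem : v.c.natAbs ∈ (v.a * v.e - v.b ^ 2).natAbs.divisors := by
      rw [Nat.mem_divisors, ← hi, Int.natAbs_mul]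
      exact ⟨dvd_mul_right _ _, by rw [← Int.natAbs_mul]; exact Int.natAbs_ne_zero.2 hvs⟩
    have hx : (![v.a, v.b, v.e] : Fin 3 → ℤ) ≠ 0 := by
      intro h
      apply hne
      have ha : v.a = 0 := congrFun h 0
      have hb' : v.b = 0 := congrFun h 1
      rw [ha, hb']
      simp
    simp only [hι, Function.comp, Matrix.cons_val]
    rw [if_pos hmem]
    refine hmono ⟨v, hv⟩ hx ?_
    rw [pi_norm_le_iff_of_nonneg (norm_nonneg _)]
    intro i
    fin_cases i
    exacts [hcoord ⟨v, hv⟩ 1, hcoord ⟨v, hv⟩ 2, hcoord ⟨v, hv⟩ 3]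
  have h2 : Summable ((fun v : Cusp => ‖v.1.vec‖ ^ (-4 : ℝ)) ∘ ((↑) : ↑(sᶜ) → Cusp)) := by
    have hb := summable_bool_factor (summable_norm_rpow_int (n := 3) (r := -4) (by norm_num))
      (fun x => by positivity) (β := Bool × Bool)
    -- As `c d = 0`, the sum `c + d` is the one of the two that may be nonzero, and `b² = a e` gives
    -- `b` up to sign.
    set ι : ↑(sᶜ) → (Fin 3 → ℤ) × (Bool × Bool) := fun v =>
      (![v.1.1.a, v.1.1.e, v.1.1.c + v.1.1.d], (decide (v.1.1.c = 0), decide (0 ≤ v.1.1.b))) with hι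
    have hinj : Function.Injective ι := by
      rintro ⟨⟨v, hv⟩, hvs⟩ ⟨⟨w, hw⟩, hws⟩ h
      simp only [hι, Prod.mk.injEq, decide_eq_decide] at h
      obtain ⟨hx, hc, hb⟩ := h
      have ha : v.a = w.a := congrFun hx 0
      have he : v.e = w.e := congrFun hx 1
      have hcd : v.c + v.d = w.c + w.d := congrFun hx 2
      have hvs' : v.c * v.d = 0 := not_not.1 hvs
      have hws' : w.c * w.d = 0 := not_not.1 hws
      have h1 : v.c * v.d = v.a * v.e - v.b ^ 2 := hv.1
      have h2 : w.c * w.d = w.a * w.e - w.b ^ 2 := hw.1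
      have hbb : v.b = w.b := by
        have h3 : v.b ^ 2 = w.b ^ 2 := by
          rw [ha, he] at h1
          linear_combination h1 - h2 - hvs' + hws'
        rcases sq_eq_sq_iff_eq_or_eq_neg.1 h3 with h4 | h4 <;> omega
      have hcc : v.c = w.c ∧ v.d = w.d := by
        by_cases hc0 : v.c = 0
        · have hc1 := hc.1 hc0
          constructor <;> omega
        · have hd0 := (mul_eq_zero.1 hvs').resolve_left hc0
          have hd1 := (mul_eq_zero.1 hws').resolve_left (fun h => hc0 (hc.2 h))
          constructor <;> omega
      exact Subtype.ext (Subtype.ext (Plucker.ext hcc.1 ha hbb he hcc.2))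
    -- the third coordinate is `c` or `d`
    refine Summable.of_nonneg_of_le (fun v => by simp only [Function.comp]; positivity) (fun v => ?_)
      (hb.comp_injective hinj)
    obtain ⟨⟨v, hv⟩, hvs⟩ := v
    have hvs' : v.c * v.d = 0 := not_not.1 hvs
    have hi : v.c * v.d = v.a * v.e - v.b ^ 2 := hv.1
    have hx : (![v.a, v.e, v.c + v.d] : Fin 3 → ℤ) ≠ 0 := by
      intro h
      have ha : v.a = 0 := congrFun h 0
      have he : v.e = 0 := congrFun h 1
      have hcd : v.c + v.d = 0 := congrFun h 2
      have hb : v.b = 0 := by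
        rw [hvs', ha] at hi
        have : v.b ^ 2 = 0 := by linear_combination hi
        simpa using this
      have hc : v.c = 0 ∧ v.d = 0 := by
        rcases mul_eq_zero.1 hvs' with h | h <;> constructor <;> omega
      exact hv.2 2 Nat.prime_two (by simp [ha, hb, he, hc.1, hc.2])
    simp only [hι, Function.comp]
    refine hmono ⟨v, hv⟩ hx ?_
    rw [pi_norm_le_iff_of_nonneg (norm_nonneg _)]
    intro i
    fin_cases i
    · exact hcoord ⟨v, hv⟩ 1
    · exact hcoord ⟨v, hv⟩ 3
    · rcases mul_eq_zero.1 hvs' with h | h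
      · simpa [h] using! hcoord ⟨v, hv⟩ 4
      · simpa [h] using! hcoord ⟨v, hv⟩ 0
  rw [summable_subtype_iff_indicator] at h1 h2
  refine (h1.add h2).congr fun v => ?_
  exact congrFun (Set.indicator_self_add_compl s _) v

/-- Absolute convergence of the Eisenstein series. -/
theorem summable_linForm {k : ℕ} (hk : 4 ≤ k) {τ : Matrix (Fin 2) (Fin 2) ℂ}
    (hτ : τ ∈ upperHalfSpace) {f : Cusp → ℂ} {K : ℝ} (hf : ∀ v, ‖f v‖ ≤ K) :
    Summable fun v : Cusp => f v * linForm τ v.toComplex ^ (-(k : ℤ)) := by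
  obtain ⟨κ, hκ, hb⟩ := exists_linForm_lower_bound hτ
  have hvec (v : Cusp) : ‖(v.1.map (Int.castRingHom ℝ)).vec‖ = ‖v.1.vec‖ := by
    have h : (v.1.map (Int.castRingHom ℝ)).vec = fun i => (v.1.vec i : ℝ) := by
      ext i
      fin_cases i <;> rfl
    rw [h]
    congr 1
  -- A primitive vector is nonzero and integral. Having norm at least one, it allows the exponent
  -- `k` to be lowered to `4`.
  have hone (v : Cusp) : 1 ≤ ‖v.1.vec‖ := by
    obtain ⟨i, hi⟩ : ∃ i, v.1.vec i ≠ 0 := by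
      by_contra! h
      have h' (j) : (2 : ℤ) ∣ v.1.vec j := by rw [h]; exact dvd_zero 2
      exact v.2.2 2 Nat.prime_two ⟨h' 0, h' 1, h' 2, h' 3, h' 4⟩
    refine le_trans ?_ (norm_le_pi_norm v.1.vec i)
    rw [Int.norm_eq_abs]
    exact_mod_cast Int.one_le_abs hi
  refine Summable.of_norm_bounded (g := fun v : Cusp => K * (κ⁻¹ ^ k * ‖v.1.vec‖ ^ (-4 : ℝ)))
    ((summable_cusp_norm.mul_left _).mul_left _) fun v => ?_
  have h1 := hb (v.1.map (Int.castRingHom ℝ)) (v.2.1.map _)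
  rw [hvec] at h1
  have h2 : (v.1.map (Int.castRingHom ℝ)).map Complex.ofRealHom = v.toComplex := by
    ext <;> simp [Plucker.map, Cusp.toComplex]
  rw [h2] at h1
  have hpos : 0 < κ * ‖v.1.vec‖ := mul_pos hκ (by linarith [hone v])
  rw [norm_mul, norm_zpow, zpow_neg, zpow_natCast]
  have h3 : ‖v.1.vec‖ ^ (-4 : ℝ) = (‖v.1.vec‖ ^ 4)⁻¹ := by
    rw [Real.rpow_neg (norm_nonneg _)]
    norm_cast
  gcongr
  · exact (norm_nonneg _).trans (hf v)
  · exact hf v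
  · rw [h3, inv_pow, ← mul_inv]
    refine inv_anti₀ (mul_pos (pow_pos hκ k) (pow_pos (by linarith [hone v]) 4)) ?_
    calc κ ^ k * ‖v.1.vec‖ ^ 4 ≤ κ ^ k * ‖v.1.vec‖ ^ k := by
          gcongr
          exact hone v
      _ = (κ * ‖v.1.vec‖) ^ k := by rw [mul_pow]
      _ ≤ ‖linForm τ v.toComplex‖ ^ k := by gcongr

end Summability

/-! ### The action of `δ_1` on cusps -/

section Dilation

/-- `q` times the action of `δ_1` in Plücker coordinates. -/
def Plucker.dilate {R : Type*} [CommRing R] (q : R) (v : Plucker R) : Plucker R :=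
  ⟨q ^ 2 * v.c, v.a, q * v.b, q ^ 2 * v.e, v.d⟩

/-- `q` times the action of `δ_1⁻¹` in Plücker coordinates. -/
def Plucker.contract {R : Type*} [CommRing R] (q : R) (v : Plucker R) : Plucker R :=
  ⟨v.c, q ^ 2 * v.a, q * v.b, v.e, q ^ 2 * v.d⟩

variable {q : ℕ}

theorem prime_dvd_of_dvd_mul_pow {p q : ℕ} (hp : p.Prime) (hq : q.Prime) (h : p ≠ q) (n : ℕ)
    {x : ℤ} (hx : (p : ℤ) ∣ q ^ n * x) : (p : ℤ) ∣ x := by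
  have hc : IsCoprime (p : ℤ) ((q : ℤ) ^ n) :=
    (Nat.isCoprime_iff_coprime.2 ((Nat.coprime_primes hp hq).2 h)).pow_right
  exact hc.dvd_of_dvd_mul_left hx

theorem dvd_of_sq_dvd {q : ℕ} (hq : q.Prime) {x y : ℤ} (h : y = x ^ 2) (hy : (q : ℤ) ∣ y) :
    (q : ℤ) ∣ x :=
  (Nat.prime_iff_prime_int.1 hq).dvd_of_dvd_pow (h ▸ hy)

/-- No prime other than `q` can divide the dilated vector, and primitivity of `v` bounds the power
of `q` by `q²`. Which power occurs depends only on `a` and `d`. -/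
theorem exists_dilate (hq : q.Prime) (v : Cusp) :
    ∃ m : ℕ, ∃ w : Cusp, w.1.map ((q : ℤ) ^ m * ·) = v.1.dilate (q : ℤ) ∧
      ((m = 0 ∧ ¬ ((q : ℤ) ∣ v.1.a ∧ (q : ℤ) ∣ v.1.d)) ∨
       (m = 1 ∧ ((q : ℤ) ∣ v.1.a ∧ (q : ℤ) ∣ v.1.d) ∧
          ¬ ((q : ℤ) ^ 2 ∣ v.1.a ∧ (q : ℤ) ^ 2 ∣ v.1.d)) ∨
       (m = 2 ∧ (q : ℤ) ^ 2 ∣ v.1.a ∧ (q : ℤ) ^ 2 ∣ v.1.d)) := by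
  obtain ⟨⟨c, a, b, e, d⟩, hi, hv⟩ := v
  simp only
  have hi' : c * d = a * e - b ^ 2 := hi
  have hq0 : (q : ℤ) ≠ 0 := by exact_mod_cast hq.ne_zero
  by_cases h1 : (q : ℤ) ∣ a ∧ (q : ℤ) ∣ d
  swap
  · refine ⟨0, ⟨⟨q ^ 2 * c, a, q * b, q ^ 2 * e, d⟩, ?_, ?_⟩, ?_, Or.inl ⟨rfl, h1⟩⟩
    · unfold Isotropic
      simp only
      linear_combination (q : ℤ) ^ 2 * hi'
    · rintro p hp ⟨hc, ha, hb, he, hd⟩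
      simp only at hc ha hb he hd
      by_cases hpq : p = q
      · subst hpq
        exact h1 ⟨ha, hd⟩
      · exact hv p hp ⟨prime_dvd_of_dvd_mul_pow hp hq hpq 2 hc, ha,
          prime_dvd_of_dvd_mul_pow hp hq hpq 1 (by rwa [pow_one]),
          prime_dvd_of_dvd_mul_pow hp hq hpq 2 he, hd⟩
    · simp [Plucker.map, dilate]
  by_cases h2 : (q : ℤ) ^ 2 ∣ a ∧ (q : ℤ) ^ 2 ∣ d
  swap
  · obtain ⟨⟨a', rfl⟩, ⟨d', rfl⟩⟩ := id h1
    refine ⟨1, ⟨⟨q * c, a', b, q * e, d'⟩, ?_, ?_⟩, ?_, Or.inr (Or.inl ⟨rfl, h1, h2⟩)⟩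
    · unfold Isotropic
      simp only
      linear_combination hi'
    · rintro p hp ⟨hc, ha, hb, he, hd⟩
      simp only at hc ha hb he hd
      by_cases hpq : p = q
      · subst hpq
        exact h2 ⟨by rw [sq]; exact mul_dvd_mul_left _ ha, by rw [sq]; exact mul_dvd_mul_left _ hd⟩
      · exact hv p hp ⟨prime_dvd_of_dvd_mul_pow hp hq hpq 1 (by rwa [pow_one]), ha.mul_left _, hb,
          prime_dvd_of_dvd_mul_pow hp hq hpq 1 (by rwa [pow_one]), hd.mul_left _⟩
    · ext <;> simp [Plucker.map, dilate] <;> ring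
  -- From `b² = a e - c d` with `q² ∣ a, d`, so that `q b` is divisible by `q²` without further
  -- assumption.
  · have hb : (q : ℤ) ∣ b := by
      obtain ⟨⟨a', rfl⟩, ⟨d', rfl⟩⟩ := h2
      exact dvd_of_sq_dvd hq (y := q * (q * (a' * e - c * d'))) (by linear_combination -hi')
        (dvd_mul_right _ _)
    obtain ⟨b', rfl⟩ := hb
    obtain ⟨⟨a', rfl⟩, ⟨d', rfl⟩⟩ := id h2
    refine ⟨2, ⟨⟨c, a', b', e, d'⟩, ?_, ?_⟩, ?_, Or.inr (Or.inr ⟨rfl, h2⟩)⟩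
    · unfold Isotropic
      simp only
      apply mul_left_cancel₀ (pow_ne_zero 2 hq0)
      linear_combination hi'
    · rintro p hp ⟨hc, ha, hb, he, hd⟩
      exact hv p hp ⟨hc, ha.mul_left _, hb.mul_left _, he, hd.mul_left _⟩
    · ext <;> simp [Plucker.map, dilate] <;> ring

/-- The exponent `m` with `q^m w = dilate q v` for primitive `w`. -/
noncomputable def dilateExp (hq : q.Prime) (v : Cusp) : ℕ := (exists_dilate hq v).choose

/-- The primitive vector proportional to `dilate q v`. -/
noncomputable def dilateCusp (hq : q.Prime) (v : Cusp) : Cusp :=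
  (exists_dilate hq v).choose_spec.choose

theorem dilateCusp_spec (hq : q.Prime) (v : Cusp) :
    (dilateCusp hq v).1.map ((q : ℤ) ^ dilateExp hq v * ·) = v.1.dilate (q : ℤ) :=
  (exists_dilate hq v).choose_spec.choose_spec.1

theorem dilateExp_spec (hq : q.Prime) (v : Cusp) :
    (dilateExp hq v = 0 ∧ ¬ ((q : ℤ) ∣ v.1.a ∧ (q : ℤ) ∣ v.1.d)) ∨
    (dilateExp hq v = 1 ∧ ((q : ℤ) ∣ v.1.a ∧ (q : ℤ) ∣ v.1.d) ∧
      ¬ ((q : ℤ) ^ 2 ∣ v.1.a ∧ (q : ℤ) ^ 2 ∣ v.1.d)) ∨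
    (dilateExp hq v = 2 ∧ (q : ℤ) ^ 2 ∣ v.1.a ∧ (q : ℤ) ^ 2 ∣ v.1.d) :=
  (exists_dilate hq v).choose_spec.choose_spec.2

theorem Cusp.eq_of_map_pow_eq (hq : q.Prime) {v w : Cusp} {m n : ℕ}
    (h : v.1.map ((q : ℤ) ^ m * ·) = w.1.map ((q : ℤ) ^ n * ·)) : v = w ∧ m = n := by
  have hq0 : (q : ℤ) ≠ 0 := by exact_mod_cast hq.ne_zero
  wlog hmn : m ≤ n generalizing v w m n
  · have h1 := this h.symm (le_of_not_ge hmn)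
    exact ⟨h1.1.symm, h1.2.symm⟩
  obtain ⟨j, rfl⟩ := Nat.exists_eq_add_of_le hmn
  have h1 : v.1 = w.1.map ((q : ℤ) ^ j * ·) := by
    have h2 := Plucker.ext_iff.1 h
    simp only [Plucker.map, pow_add, mul_assoc, mul_right_inj' (pow_ne_zero m hq0)] at h2
    exact Plucker.ext h2.1 h2.2.1 h2.2.2.1 h2.2.2.2.1 h2.2.2.2.2
  rcases Nat.eq_zero_or_pos j with rfl | hj
  · refine ⟨Subtype.ext ?_, rfl⟩
    rw [h1]
    simp [Plucker.map]
  · exfalso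
    have hd (x : ℤ) : (q : ℤ) ∣ (q : ℤ) ^ j * x := (dvd_pow_self _ hj.ne').mul_right x
    refine v.2.2 q hq ?_
    rw [h1]
    exact ⟨hd _, hd _, hd _, hd _, hd _⟩

/-- The first partial inversion exchanges the pair `(c, e)` with `(a, d)` up to signs, so it
conjugates the dilation into the contraction. It has order four on vectors, hence its cube is the
inverse. -/
theorem exists_contract (hq : q.Prime) (w : Cusp) :
    ∃ n : ℕ, ∃ v : Cusp, v.1.map ((q : ℤ) ^ n * ·) = w.1.contract (q : ℤ) := by
  obtain ⟨m, u, hu, -⟩ := exists_dilate hq (w.act partialInversionFst)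
  refine ⟨m, ((u.act partialInversionFst).act partialInversionFst).act partialInversionFst, ?_⟩
  change (((u.1.act _).act _).act _).map _ = _
  have h0 : (w.act partialInversionFst).1 = w.1.act partialInversionFst.1 := rfl
  rw [← act_map_mul, ← act_map_mul, ← act_map_mul, hu, h0]
  simp only [act_partialInversionFst]
  ext <;> simp [dilate, contract]

/-- Dilation and contraction compose to the scalar `q²`, which disappears on passing to primitive
vectors. -/
theorem dilateCusp_bijective (hq : q.Prime) : Function.Bijective (dilateCusp hq) := by
  have hq0 : (q : ℤ) ≠ 0 := by exact_mod_cast hq.ne_zero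
  have hcd (v : Plucker ℤ) : (v.dilate (q : ℤ)).contract (q : ℤ) = v.map ((q : ℤ) ^ 2 * ·) := by
    ext <;> simp [Plucker.map, dilate, contract] <;> ring
  have hdc (v : Plucker ℤ) : (v.contract (q : ℤ)).dilate (q : ℤ) = v.map ((q : ℤ) ^ 2 * ·) := by
    ext <;> simp [Plucker.map, dilate, contract] <;> ring
  have hdm (t : ℤ) (v : Plucker ℤ) : (v.map (t * ·)).dilate (q : ℤ) =
      (v.dilate (q : ℤ)).map (t * ·) := by
    ext <;> simp [Plucker.map, dilate] <;> ring
  have hcm (t : ℤ) (v : Plucker ℤ) : (v.map (t * ·)).contract (q : ℤ) =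
      (v.contract (q : ℤ)).map (t * ·) := by
    ext <;> simp [Plucker.map, contract] <;> ring
  have hmm (s t : ℤ) (v : Plucker ℤ) : (v.map (t * ·)).map (s * ·) = v.map (s * t * ·) := by
    ext <;> simp [Plucker.map, mul_assoc]
  constructor
  · intro v w h
    have h1 := congrArg (Plucker.contract (q : ℤ)) (dilateCusp_spec hq v)
    have h2 := congrArg (Plucker.contract (q : ℤ)) (dilateCusp_spec hq w)
    rw [hcd, hcm] at h1 h2
    rw [h] at h1
    have h3 := congrArg (Plucker.map ((q : ℤ) ^ dilateExp hq w * ·)) h1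
    have h4 := congrArg (Plucker.map ((q : ℤ) ^ dilateExp hq v * ·)) h2
    rw [hmm, hmm, ← pow_add, ← pow_add] at h3 h4
    rw [add_comm, h3] at h4
    exact (Cusp.eq_of_map_pow_eq hq h4).1
  · intro w
    obtain ⟨n, v, hv⟩ := exists_contract hq w
    refine ⟨v, ?_⟩
    have h1 := congrArg (Plucker.dilate (q : ℤ)) hv
    rw [hdc, hdm, ← dilateCusp_spec hq v, hmm, ← pow_add] at h1
    exact (Cusp.eq_of_map_pow_eq hq h1).1

/-- Multiplication by `δ_1` on cusps. -/
noncomputable def dilateEquiv (hq : q.Prime) : Cusp ≃ Cusp :=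
  Equiv.ofBijective _ (dilateCusp_bijective hq)

theorem dilateEquiv_apply (hq : q.Prime) (v : Cusp) : dilateEquiv hq v = dilateCusp hq v := rfl

theorem Cusp.actEquiv_apply (γ : Sp) (v : Cusp) : Cusp.actEquiv γ v = v.act γ := rfl

end Dilation

/-! ### Slashing a series over cusps by `δ_1⁻¹ γ` -/

section Slash

theorem denom_mul (g h : Matrix (Fin 2 ⊕ Fin 2) (Fin 2 ⊕ Fin 2) ℝ) (τ : Matrix (Fin 2) (Fin 2) ℂ)
    (hh : (denom h τ).det ≠ 0) : denom (g * h) τ = denom g (act h τ) * denom h τ := by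
  obtain ⟨A, B, C, D, rfl⟩ : ∃ A B C D, g = Matrix.fromBlocks A B C D :=
    ⟨_, _, _, _, (Matrix.fromBlocks_toBlocks g).symm⟩
  obtain ⟨A', B', C', D', rfl⟩ : ∃ A B C D, h = Matrix.fromBlocks A B C D :=
    ⟨_, _, _, _, (Matrix.fromBlocks_toBlocks h).symm⟩
  have hm (X Y : Matrix (Fin 2) (Fin 2) ℝ) : (X * Y).map Complex.ofReal =
      X.map Complex.ofReal * Y.map Complex.ofReal := map_mul Complex.ofRealHom.mapMatrix X Y
  have ha (X Y : Matrix (Fin 2) (Fin 2) ℝ) : (X + Y).map Complex.ofReal =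
      X.map Complex.ofReal + Y.map Complex.ofReal := map_add Complex.ofRealHom.mapMatrix X Y
  have h1 : act (Matrix.fromBlocks A' B' C' D') τ * denom (Matrix.fromBlocks A' B' C' D') τ =
      A'.map Complex.ofReal * τ + B'.map Complex.ofReal := by
    rw [act, Matrix.mul_assoc, Matrix.nonsing_inv_mul _ hh.isUnit, Matrix.mul_one]
    simp
  rw [denom.eq_1 (Matrix.fromBlocks A B C D), Matrix.add_mul, Matrix.mul_assoc, h1]
  simp only [denom, Matrix.fromBlocks_multiply, Matrix.toBlocks_fromBlocks₂₁,
    Matrix.toBlocks_fromBlocks₂₂, hm, ha, Matrix.mul_add, Matrix.add_mul, Matrix.mul_assoc]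
  abel

theorem inv_delta1 {q : ℕ} (hq : q ≠ 0) : (delta1 q)⁻¹ =
    Matrix.fromBlocks !![(q : ℝ)⁻¹, 0; 0, 1] 0 0 !![(q : ℝ), 0; 0, 1] := by
  have h : (q : ℝ) ≠ 0 := by exact_mod_cast hq
  refine Matrix.inv_eq_right_inv ?_
  rw [delta1, Matrix.fromBlocks_multiply, ← Matrix.fromBlocks_one]
  congr 1 <;> ext i j <;> fin_cases i <;> fin_cases j <;> simp [h]

theorem det_toReal (γ : Sp) : (toReal γ).det = 1 := by
  have h := (RingHom.map_det (Int.castRingHom ℝ) γ.1).symm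
  rw [SymplecticGroup.det_eq_one γ.2, map_one] at h
  exact h

theorem inv_delta1_mem {q : ℕ} (hq : q ≠ 0) :
    (delta1 q)⁻¹ ∈ Matrix.symplecticGroup (Fin 2) ℝ := by
  have h : (q : ℝ) ≠ 0 := by exact_mod_cast hq
  rw [inv_delta1 hq, SymplecticGroup.fromBlocks_mem_iff]
  refine ⟨by simp, by simp, ?_⟩
  ext i j
  fin_cases i <;> fin_cases j <;> simp [Matrix.mul_apply, h]

theorem delta1_mem {q : ℕ} (hq : q ≠ 0) : delta1 q ∈ Matrix.symplecticGroup (Fin 2) ℝ := by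
  have h : (q : ℝ) ≠ 0 := by exact_mod_cast hq
  rw [delta1, SymplecticGroup.fromBlocks_mem_iff]
  refine ⟨by simp, by simp, ?_⟩
  ext i j
  fin_cases i <;> fin_cases j <;> simp [Matrix.mul_apply, h]

theorem det_inv_delta1 {q : ℕ} (hq : q ≠ 0) : ((delta1 q)⁻¹).det = 1 := by
  have h : (q : ℝ) ≠ 0 := by exact_mod_cast hq
  rw [inv_delta1 hq, Matrix.det_fromBlocks_zero₂₁, Matrix.det_fin_two_of, Matrix.det_fin_two_of]
  simp [h]

theorem linForm_smul (τ : Matrix (Fin 2) (Fin 2) ℂ) (t : ℂ) (v : Plucker ℂ) :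
    linForm τ (v.map (t * ·)) = t * linForm τ v := by
  simp only [linForm, Plucker.map]
  ring

theorem linForm_ne_zero {τ : Matrix (Fin 2) (Fin 2) ℂ} (hτ : τ ∈ upperHalfSpace) (v : Cusp) :
    linForm τ v.toComplex ≠ 0 := by
  intro h
  have h2 : (v.1.map (Int.castRingHom ℝ)).map Complex.ofRealHom = v.toComplex := by
    ext <;> simp [Plucker.map, Cusp.toComplex]
  rw [← h2] at h
  have h3 := Plucker.ext_iff.1 (eq_zero_of_linForm_eq_zero hτ (v.2.1.map _) h)
  simp only [Plucker.map, eq_intCast, Int.cast_eq_zero] at h3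
  exact v.2.2 2 Nat.prime_two (by simp [h3])

theorem det_denom_inv_delta1_mul {q : ℕ} (hq : q ≠ 0) (γ : Sp) (τ : Matrix (Fin 2) (Fin 2) ℂ) :
    (denom ((delta1 q)⁻¹ * toReal γ) τ).det = q * (denom (toReal γ) τ).det := by
  have h : denom ((delta1 q)⁻¹ * toReal γ) τ =
      !![(q : ℂ), 0; 0, 1] * denom (toReal γ) τ := by
    obtain ⟨A, B, C, D, hA⟩ : ∃ A B C D, toReal γ = Matrix.fromBlocks A B C D :=
      ⟨_, _, _, _, (Matrix.fromBlocks_toBlocks _).symm⟩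
    rw [inv_delta1 hq, hA, Matrix.fromBlocks_multiply]
    ext i j
    fin_cases i <;> simp [denom, Matrix.mul_apply, Matrix.vecMul, dotProduct] <;> ring
  rw [h, Matrix.det_mul, Matrix.det_fin_two_of]
  simp

theorem of_toReal_mul_inv_delta1 {q : ℕ} (hq : q ≠ 0) (g : Sp) :
    of (toReal g * (delta1 q)⁻¹) =
      (((plucker g).map (Int.castRingHom ℝ)).contract (q : ℝ)).map ((q : ℝ)⁻¹ * ·) := by
  have h : (q : ℝ) ≠ 0 := by exact_mod_cast hq
  rw [of_mul _ _ (isSymm_of_mem_symplecticGroup (toReal_mem g)), of_toReal, inv_delta1 hq]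
  ext <;> simp [act_a, act_b, act_c, act_d, act_e, contract, Plucker.map] <;> field_simp

theorem of_toReal_mul_delta1 {q : ℕ} (hq : q ≠ 0) (g : Sp) :
    of (toReal g * delta1 q) =
      (((plucker g).map (Int.castRingHom ℝ)).dilate (q : ℝ)).map ((q : ℝ)⁻¹ * ·) := by
  have h : (q : ℝ) ≠ 0 := by exact_mod_cast hq
  rw [of_mul _ _ (isSymm_of_mem_symplecticGroup (toReal_mem g)), of_toReal, delta1]
  ext <;> simp [act_a, act_b, act_c, act_d, act_e, dilate, Plucker.map] <;> field_simp

theorem of_toReal_mul (x : Matrix (Fin 2 ⊕ Fin 2) (Fin 2 ⊕ Fin 2) ℝ)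
    (hx : x ∈ Matrix.symplecticGroup (Fin 2) ℝ) {v : Plucker ℤ} {t : ℝ}
    (h : of x = (v.map (Int.castRingHom ℝ)).map (t * ·)) (γ : Sp) :
    of (x * toReal γ) = ((v.act γ.1).map (Int.castRingHom ℝ)).map (t * ·) := by
  rw [of_mul _ _ (isSymm_of_mem_symplecticGroup hx), h, act_map_mul, act_map]
  rfl

/-- If `g` represents `q^(-m)` times the dilation of `v`, then `g δ_1⁻¹` has coordinates `q^(-1-m)`
times the contracted dilation, which is `q^(1-m) v`. -/
theorem det_denom_mul_inv_delta1_mul {q : ℕ} (hq : q.Prime) (g γ : Sp) (v : Cusp)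
    (hg : Cusp.mk g = dilateCusp hq v) (τ : Matrix (Fin 2) (Fin 2) ℂ) :
    (denom (toReal g * ((delta1 q)⁻¹ * toReal γ)) τ).det =
      (q : ℂ) ^ (1 - (dilateExp hq v : ℤ)) * linForm τ (v.act γ).toComplex := by
  have hq0 : (q : ℝ) ≠ 0 := by exact_mod_cast hq.ne_zero
  have hmem := mul_mem (toReal_mem g) (inv_delta1_mem hq.ne_zero)
  have hof : of (toReal g * (delta1 q)⁻¹) =
      (v.1.map (Int.castRingHom ℝ)).map ((q : ℝ) ^ (1 - (dilateExp hq v : ℤ)) * ·) := by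
    have h1 := Plucker.ext_iff.1 (dilateCusp_spec hq v)
    rw [← hg] at h1
    simp only [Plucker.map, dilate, Cusp.mk] at h1
    have hc := congrArg (Int.cast : ℤ → ℝ) h1.1
    have ha := congrArg (Int.cast : ℤ → ℝ) h1.2.1
    have hb := congrArg (Int.cast : ℤ → ℝ) h1.2.2.1
    have he := congrArg (Int.cast : ℤ → ℝ) h1.2.2.2.1
    have hd := congrArg (Int.cast : ℤ → ℝ) h1.2.2.2.2
    push_cast at hc ha hb he hd
    rw [of_toReal_mul_inv_delta1 hq.ne_zero, zpow_sub₀ hq0, zpow_one, zpow_natCast]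
    ext <;> simp only [Plucker.map, contract, eq_intCast] <;> field_simp
    · linear_combination hc
    · linear_combination ha
    · linear_combination hb
    · linear_combination he
    · linear_combination hd
  rw [← Matrix.mul_assoc, det_denom _ (mul_mem hmem (toReal_mem γ)), of_toReal_mul _ hmem hof,
    ← linForm_smul]
  congr 1
  ext <;> simp [Plucker.map, Cusp.toComplex, Cusp.act]

/-- The slash operator `f ↦ f | δ_1⁻¹ γ` on series over cusps. -/
theorem slash_tsum {q : ℕ} (hq : q.Prime) (k : ℕ) (f : Cusp → ℂ) (γ : Sp)
    {τ : Matrix (Fin 2) (Fin 2) ℂ} (hτ : τ ∈ upperHalfSpace) :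
    slash k (fun σ => 1 / 2 * ∑' v : Cusp, f v * linForm σ v.toComplex ^ (-(k : ℤ)))
        ((delta1 q)⁻¹ * toReal γ) τ =
      1 / 2 * ∑' v : Cusp, f (dilateCusp hq (v.act γ⁻¹)) *
        (q : ℂ) ^ (((dilateExp hq (v.act γ⁻¹) : ℤ) - 1) * k) *
        linForm τ v.toComplex ^ (-(k : ℤ)) := by
  have hj : (denom ((delta1 q)⁻¹ * toReal γ) τ).det ≠ 0 := by
    rw [det_denom_inv_delta1_mul hq.ne_zero, det_denom_toReal]
    exact mul_ne_zero (by exact_mod_cast hq.ne_zero) (linForm_ne_zero hτ _)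
  have hdet : ((delta1 q)⁻¹ * toReal γ).det = 1 := by
    rw [Matrix.det_mul, det_inv_delta1 hq.ne_zero, det_toReal, one_mul]
  rw [slash, hdet, Real.one_rpow, Complex.ofReal_one, one_mul, mul_left_comm, ← tsum_mul_left,
    ← (dilateEquiv hq).tsum_eq]
  congr 1
  -- The series has been reindexed by dilation; reindexing by `γ` as well turns the cocycle relation
  -- for `denom` into a termwise identity.
  refine (tsum_congr fun v => ?_).trans ((Cusp.actEquiv γ).tsum_eq _)
  have h0 : (v.act γ).act γ⁻¹ = v := by rw [← Cusp.act_mul, mul_inv_cancel, Cusp.act_one]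
  rw [Cusp.actEquiv_apply, dilateEquiv_apply, h0]
  obtain ⟨g, hg⟩ := (dilateCusp hq v).exists_rep
  have h1 := det_denom_mul_inv_delta1_mul hq g γ v hg.symm τ
  rw [denom_mul _ _ _ hj, Matrix.det_mul, det_denom_toReal, ← hg] at h1
  rw [mul_left_comm, ← mul_zpow, mul_comm (denom _ τ).det, h1, mul_zpow, ← zpow_mul, mul_assoc]
  congr 3
  ring

/-- Used to show that the Hecke summand does not depend on the coset representative. -/
theorem dilateCusp_act {q : ℕ} (hq : q.Prime) {h h' : Sp}
    (hh : toReal h * delta1 q = delta1 q * toReal h') (v : Cusp) :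
    dilateCusp hq (v.act h) = (dilateCusp hq v).act h' ∧
      dilateExp hq (v.act h) = dilateExp hq v := by
  obtain ⟨g, rfl⟩ := v.exists_rep
  have hmap (v : Plucker ℤ) : (v.map (Int.castRingHom ℝ)).dilate (q : ℝ) =
      (v.dilate (q : ℤ)).map (Int.castRingHom ℝ) := by
    ext <;> simp [Plucker.map, dilate]
  have hq0 : (q : ℝ) ≠ 0 := by exact_mod_cast hq.ne_zero
  have hmem := mul_mem (toReal_mem g) (delta1_mem hq.ne_zero)
  have h1 := of_toReal_mul_delta1 hq.ne_zero g
  rw [hmap] at h1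
  have h2 := of_toReal_mul _ hmem h1 h'
  rw [Matrix.mul_assoc, ← hh, ← Matrix.mul_assoc, ← toReal_mul, of_toReal_mul_delta1 hq.ne_zero,
    hmap] at h2
  have h3 : (plucker (g * h)).dilate (q : ℤ) = ((plucker g).dilate (q : ℤ)).act h'.1 := by
    have h4 := Plucker.ext_iff.1 h2
    simp only [Plucker.map, mul_right_inj' (inv_ne_zero hq0), eq_intCast, Int.cast_inj] at h4
    exact Plucker.ext h4.1 h4.2.1 h4.2.2.1 h4.2.2.2.1 h4.2.2.2.2
  have h5 := dilateCusp_spec hq (Cusp.mk (g * h))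
  have h6 := dilateCusp_spec hq (Cusp.mk g)
  change _ = (plucker (g * h)).dilate (q : ℤ) at h5
  change _ = (plucker g).dilate (q : ℤ) at h6
  rw [h3, ← h6, act_map_mul] at h5
  rw [Cusp.mk_act]
  exact Cusp.eq_of_map_pow_eq hq h5

end Slash

/-! ### Congruence description of the Hecke subgroup -/

section HeckeSubgroup

variable {N q : ℕ}

theorem toReal_eq_fromBlocks (γ : Sp) : toReal γ =
    Matrix.fromBlocks ((blockA γ).map Int.cast) ((blockB γ).map Int.cast)
      ((blockC γ).map Int.cast) ((blockD γ).map Int.cast) := by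
  rw [toReal, coe_eq_fromBlocks, Matrix.fromBlocks_map]

/-- The equation `γ δ_1 = δ_1 γ'` in coordinates. -/
theorem mul_delta1_eq_iff (hq : q ≠ 0) (γ γ' : Sp) :
    toReal γ * delta1 q = delta1 q * toReal γ' ↔
      blockA γ = !![blockA γ' 0 0, q * blockA γ' 0 1; blockA γ 1 0, blockA γ' 1 1] ∧
      blockA γ' 1 0 = q * blockA γ 1 0 ∧
      blockB γ = !![q ^ 2 * blockB γ' 0 0, q * blockB γ' 0 1; q * blockB γ' 1 0, blockB γ' 1 1] ∧
      blockC γ' = !![q ^ 2 * blockC γ 0 0, q * blockC γ 0 1; q * blockC γ 1 0, blockC γ 1 1] ∧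
      blockD γ' = !![blockD γ 0 0, q * blockD γ 0 1; blockD γ' 1 0, blockD γ 1 1] ∧
      blockD γ 1 0 = q * blockD γ' 1 0 := by
  have h : (q : ℝ) ≠ 0 := by exact_mod_cast hq
  rw [toReal_eq_fromBlocks, toReal_eq_fromBlocks, delta1, Matrix.fromBlocks_multiply,
    Matrix.fromBlocks_multiply, Matrix.fromBlocks_inj]
  simp only [← Matrix.ext_iff, Fin.forall_fin_two, Matrix.mul_apply,
    Fin.sum_univ_two, Matrix.map_apply, Matrix.of_apply, Matrix.cons_val',
    Matrix.cons_val_zero, Matrix.cons_val_one, Matrix.cons_val_fin_one, mul_zero, zero_mul,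
    add_zero, zero_add, mul_one, one_mul]
  field_simp
  norm_cast
  constructor
  · rintro ⟨⟨⟨h1, h2⟩, h3, h4⟩, ⟨⟨h5, h6⟩, h7, h8⟩, ⟨⟨h9, h10⟩, h11, h12⟩, ⟨h13, h14⟩, h15, h16⟩
    refine ⟨⟨⟨?_, ?_⟩, ?_, ?_⟩, ?_, ⟨⟨?_, ?_⟩, ?_, ?_⟩, ⟨⟨?_, ?_⟩, ?_, ?_⟩,
      ⟨⟨?_, ?_⟩, ?_, ?_⟩, ?_⟩ <;> first | trivial | linarith
  · rintro ⟨⟨⟨h1, h2⟩, h3, h4⟩, h0, ⟨⟨h5, h6⟩, h7, h8⟩, ⟨⟨h9, h10⟩, h11, h12⟩,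
      ⟨⟨h13, h14⟩, h15, h16⟩, h17⟩
    refine ⟨⟨⟨?_, ?_⟩, ?_, ?_⟩, ⟨⟨?_, ?_⟩, ?_, ?_⟩, ⟨⟨?_, ?_⟩, ?_, ?_⟩, ⟨?_, ?_⟩, ?_, ?_⟩ <;>
      linarith

theorem exists_row_eq_one (hqN : q ∣ N) {γ : Sp} (hγ : γ ∈ Gamma0 N) :
    (q : ℤ) ∣ blockA γ 0 0 * blockD γ 0 0 + blockA γ 0 1 * blockD γ 0 1 - 1 := by
  have h1 := congrFun₂ (row_relations γ).2.2 0 0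
  simp only [Matrix.sub_apply, Matrix.mul_apply, Fin.sum_univ_two, Matrix.transpose_apply,
    Matrix.one_apply_eq] at h1
  have h2 : blockA γ 0 0 * blockD γ 0 0 + blockA γ 0 1 * blockD γ 0 1 - 1 =
      blockB γ 0 0 * blockC γ 0 0 + blockB γ 0 1 * blockC γ 0 1 := by linarith
  rw [h2]
  exact dvd_add ((Gamma0_le hqN hγ 0 0).mul_left _) ((Gamma0_le hqN hγ 0 1).mul_left _)

theorem not_dvd_blockA (hq : q.Prime) (hqN : q ∣ N) {γ : Sp} (hγ : γ ∈ Gamma0 N)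
    (h : (q : ℤ) ∣ blockA γ 0 1) : ¬ (q : ℤ) ∣ blockA γ 0 0 := by
  intro h0
  have h1 := exists_row_eq_one hqN hγ
  have h2 := dvd_sub (dvd_add (h0.mul_right (blockD γ 0 0)) (h.mul_right (blockD γ 0 1))) h1
  rw [sub_sub_cancel] at h2
  exact (Nat.prime_iff_prime_int.1 hq).not_dvd_one h2

/-- Integrality of `δ_1⁻¹ γ δ_1` also requires `q` to divide `B 1 0` and `D 1 0`. Both follow from
the symplectic relations, because `q ∣ A 0 1` makes `A 0 0` prime to `q`. -/
theorem mem_heckeSubgroup_iff (hq : q.Prime) (hqN : q ∣ N) (γ : Gamma0 N) :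
    γ ∈ heckeSubgroup N q ↔ (q : ℤ) ∣ blockA γ.1 0 1 ∧ (q : ℤ) ∣ blockB γ.1 0 1 ∧
      (q : ℤ) ^ 2 ∣ blockB γ.1 0 0 := by
  constructor
  · rintro ⟨γ', h⟩
    obtain ⟨h1, -, h2, -⟩ := (mul_delta1_eq_iff hq.ne_zero _ _).1 h
    rw [h1, h2]
    simp
  · rintro ⟨⟨a, ha⟩, ⟨b, hb⟩, ⟨b₀, hb₀⟩⟩
    have hp := Nat.prime_iff_prime_int.1 hq
    have hA := not_dvd_blockA hq hqN γ.2 ⟨a, ha⟩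
    have hC := Gamma0_le hqN γ.2
    obtain ⟨h1, -, h3⟩ := row_relations γ.1
    have h1' := congrFun₂ h1 0 1
    have h3' := congrFun₂ h3 0 1
    simp only [Matrix.sub_apply, Matrix.mul_apply, Fin.sum_univ_two, Matrix.transpose_apply,
      Matrix.one_apply_ne (zero_ne_one' (Fin 2)), ha, hb, hb₀] at h1' h3'
    have hB : (q : ℤ) ∣ blockB γ.1 1 0 := by
      refine (hp.dvd_mul.1 ?_).resolve_left hA
      exact ⟨q * b₀ * blockA γ.1 1 0 + b * blockA γ.1 1 1 - a * blockB γ.1 1 1,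
        by linear_combination h1'⟩
    have hD : (q : ℤ) ∣ blockD γ.1 1 0 := by
      refine (hp.dvd_mul.1 ?_).resolve_left hA
      exact ⟨q * b₀ * blockC γ.1 1 0 + b * blockC γ.1 1 1 - a * blockD γ.1 1 1,
        by linear_combination h3'⟩
    obtain ⟨b', hb'⟩ := hB
    obtain ⟨d', hd'⟩ := hD
    -- The matrix `δ_1⁻¹ γ δ_1`, with the divisions by `q` carried out.
    have hmem : Matrix.fromBlocks
        !![blockA γ.1 0 0, a; q * blockA γ.1 1 0, blockA γ.1 1 1]
        !![b₀, b; b', blockB γ.1 1 1]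
        !![(q : ℤ) ^ 2 * blockC γ.1 0 0, q * blockC γ.1 0 1; q * blockC γ.1 1 0, blockC γ.1 1 1]
        !![blockD γ.1 0 0, q * blockD γ.1 0 1; d', blockD γ.1 1 1] ∈
          Matrix.symplecticGroup (Fin 2) ℤ := by
      have hq0 : (q : ℤ) ≠ 0 := by exact_mod_cast hq.ne_zero
      have h4 := col_relations γ.1
      simp only [← Matrix.ext_iff, Fin.forall_fin_two, Matrix.sub_apply, Matrix.mul_apply,
        Fin.sum_univ_two, Matrix.transpose_apply, Matrix.one_apply_eq,
        Matrix.one_apply_ne (zero_ne_one' (Fin 2)), Matrix.one_apply_ne (one_ne_zero' (Fin 2)),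
        ha, hb, hb₀, hb', hd'] at h4
      obtain ⟨⟨⟨-, h5⟩, -, -⟩, ⟨⟨-, h6⟩, -, -⟩, ⟨h7, h8⟩, h9, h10⟩ := h4
      rw [SymplecticGroup.fromBlocks_mem_iff]
      simp only [← Matrix.ext_iff, Fin.forall_fin_two, Matrix.sub_apply, Matrix.mul_apply,
        Fin.sum_univ_two, Matrix.transpose_apply, Matrix.one_apply_eq,
        Matrix.one_apply_ne (zero_ne_one' (Fin 2)), Matrix.one_apply_ne (one_ne_zero' (Fin 2)),
        Matrix.of_apply, Matrix.cons_val', Matrix.cons_val_zero, Matrix.cons_val_one,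
        Matrix.cons_val_fin_one]
      refine ⟨⟨⟨by ring, ?_⟩, ?_, by ring⟩, ⟨⟨by ring, ?_⟩, ?_, by ring⟩, ⟨?_, ?_⟩, ?_, ?_⟩
      · linear_combination (q : ℤ) * h5
      · linear_combination -(q : ℤ) * h5
      · apply mul_left_cancel₀ hq0
        linear_combination h6
      · apply mul_left_cancel₀ hq0
        linear_combination -h6
      · linear_combination h7
      · linear_combination (q : ℤ) * h8
      · apply mul_left_cancel₀ hq0
        linear_combination h9
      · linear_combination h10
    refine ⟨⟨⟨_, hmem⟩, ?_⟩, (mul_delta1_eq_iff hq.ne_zero _ _).2 ?_⟩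
    · intro i j
      change (N : ℤ) ∣ !![(q : ℤ) ^ 2 * blockC γ.1 0 0, q * blockC γ.1 0 1; q * blockC γ.1 1 0,
        blockC γ.1 1 1] i j
      fin_cases i <;> fin_cases j
      · exact (γ.2 0 0).mul_left _
      · exact (γ.2 0 1).mul_left _
      · exact (γ.2 1 0).mul_left _
      · exact γ.2 1 1
    · simp only [blockA, blockB, blockC, blockD, Matrix.toBlocks_fromBlocks₁₁,
        Matrix.toBlocks_fromBlocks₁₂, Matrix.toBlocks_fromBlocks₂₁, Matrix.toBlocks_fromBlocks₂₂]
      simp only [blockA, blockB, blockD] at ha hb hb₀ hb' hd'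
      simp [← Matrix.ext_iff, Fin.forall_fin_two, ha, hb, hb₀, hb', hd']

end HeckeSubgroup

/-! ### Coset representatives of the Hecke operator -/

section Representatives

/-- Representatives of the first rows modulo `q`, completed to elements of `SL_2(ℤ)`. -/
def heckeRow : Option ℤ → Matrix.SpecialLinearGroup (Fin 2) ℤ
  | none => ⟨!![0, -1; 1, 0], by simp [Matrix.det_fin_two_of]⟩
  | some j => ⟨!![1, j; 0, 1], by simp [Matrix.det_fin_two_of]⟩

/-- Inverses of representatives of the cosets in the Hecke operator. -/
def heckeRep (j : Option ℤ) (y x : ℤ) : Sp := levi (heckeRow j) * translation x y 0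

theorem blockC_heckeRep (j : Option ℤ) (y x : ℤ) : blockC (heckeRep j y x) = 0 := by
  rw [heckeRep, blockC_mul]
  simp [levi, translation, blockC]

theorem det_blockD_heckeRep (j : Option ℤ) (y x : ℤ) : (blockD (heckeRep j y x)).det = 1 := by
  rw [heckeRep, blockD_mul]
  cases j <;> simp [levi, translation, blockC, blockD, heckeRow, Matrix.det_fin_two_of,
    Matrix.adjugate_fin_two_of]

theorem heckeRep_mem (N : ℕ) (j : Option ℤ) (y x : ℤ) : heckeRep j y x ∈ Gamma0 N := by
  intro i l
  simp [blockC_heckeRep]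

theorem blockA_mul_levi (γ : Sp) (G : Matrix.SpecialLinearGroup (Fin 2) ℤ) :
    blockA (γ * levi G) = blockA γ * G.1 := by
  ext i j
  simp [blockA, levi, Matrix.toBlocks₁₁, Matrix.mul_apply]

theorem blockA_mul_translation (γ : Sp) (x y z : ℤ) :
    blockA (γ * translation x y z) = blockA γ := by
  ext i j
  simp [blockA, translation, Matrix.toBlocks₁₁, Matrix.mul_apply, Matrix.one_apply]

theorem blockB_mul_translation (γ : Sp) (x y z : ℤ) :
    blockB (γ * translation x y z) = blockA γ * !![x, y; y, z] + blockB γ := by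
  ext i j
  simp [blockA, blockB, translation, Matrix.toBlocks₁₁, Matrix.toBlocks₁₂, Matrix.mul_apply,
    Matrix.one_apply]

theorem exists_natCast_dvd_add {n : ℕ} (hn : n ≠ 0) {a : ℤ} (ha : IsCoprime a (n : ℤ)) (b : ℤ) :
    ∃ x : Fin n, (n : ℤ) ∣ a * (x : ℕ) + b := by
  obtain ⟨u, w, h⟩ := ha
  have hn' : (0 : ℤ) < n := by positivity
  have h0 := Int.emod_nonneg (-b * u) hn'.ne'
  have h1 := Int.emod_lt_of_pos (-b * u) hn'
  refine ⟨⟨((-b * u) % n).toNat, by omega⟩, ?_⟩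
  simp only [Int.toNat_of_nonneg h0]
  have h2 := Int.emod_add_mul_ediv (-b * u) n
  exact ⟨b * w - a * ((-b * u) / n), by linear_combination a * h2 - b * h⟩

theorem eq_of_natCast_dvd_sub {n : ℕ} {a : ℤ} (ha : IsCoprime a (n : ℤ)) {x y : Fin n}
    (h : (n : ℤ) ∣ a * ((x : ℕ) - (y : ℕ))) : x = y := by
  have h1 := ha.symm.dvd_of_dvd_mul_left h
  have h2 := Int.eq_zero_of_abs_lt_dvd h1 (by rw [abs_lt]; constructor <;> omega)
  exact Fin.ext (by omega)

variable {N q : ℕ}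

/-- Indices for the representatives. -/
abbrev HeckeIndex (q : ℕ) : Type := Option (Fin q) × Fin q × Fin (q ^ 2)

/-- The (inverse) representative with a given index. -/
def heckeRepOf (i : HeckeIndex q) : Sp :=
  heckeRep (i.1.map fun j : Fin q => ((j : ℕ) : ℤ)) ((i.2.1 : ℕ) : ℤ) ((i.2.2 : ℕ) : ℤ)

theorem isCoprime_of_not_dvd (hq : q.Prime) {a : ℤ} (h : ¬ (q : ℤ) ∣ a) : IsCoprime a (q : ℤ) :=
  ((Nat.prime_iff_prime_int.1 hq).coprime_iff_not_dvd.2 h).symm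

/-- The three congruences are solved in turn: `j` clears `A 0 1` modulo `q`, after which `A 0 0` is
a unit and `y`, then `x`, clear `B 0 1` modulo `q` and `B 0 0` modulo `q²`. -/
theorem exists_mul_heckeRepOf_mem (hq : q.Prime) (hqN : q ∣ N) (γ : Gamma0 N) :
    ∃ i : HeckeIndex q, γ * ⟨heckeRepOf i, heckeRep_mem N _ _ _⟩ ∈ heckeSubgroup N q := by
  have hlevi (j : Option ℤ) : levi (heckeRow j) ∈ Gamma0 N := by
    intro i l
    simp [blockC, levi]
  have key : ∃ j : Option (Fin q),
      (q : ℤ) ∣ blockA (γ.1 * levi (heckeRow (j.map fun j : Fin q => ((j : ℕ) : ℤ)))) 0 1 := by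
    by_cases h : (q : ℤ) ∣ blockA γ.1 0 0
    · exact ⟨none, by
        rw [blockA_mul_levi]
        simpa [heckeRow, Matrix.mul_apply] using h⟩
    · obtain ⟨j, hj⟩ := exists_natCast_dvd_add hq.ne_zero (isCoprime_of_not_dvd hq h)
        (blockA γ.1 0 1)
      exact ⟨some j, by
        rw [blockA_mul_levi]
        simpa [heckeRow, Matrix.mul_apply] using hj⟩
  obtain ⟨j, hj⟩ := key
  set γ' := γ.1 * levi (heckeRow (j.map fun j : Fin q => ((j : ℕ) : ℤ))) with hγ'
  have h0 := isCoprime_of_not_dvd hq (not_dvd_blockA hq hqN (mul_mem γ.2 (hlevi _)) hj)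
  obtain ⟨y, hy⟩ := exists_natCast_dvd_add hq.ne_zero h0 (blockB γ' 0 1)
  have h2 : IsCoprime (blockA γ' 0 0) ((q ^ 2 : ℕ) : ℤ) := by
    push_cast
    exact h0.pow_right
  obtain ⟨x, hx⟩ := exists_natCast_dvd_add (pow_ne_zero 2 hq.ne_zero) h2
    (blockA γ' 0 1 * (y : ℕ) + blockB γ' 0 0)
  refine ⟨(j, y, x), (mem_heckeSubgroup_iff hq hqN _).2 ?_⟩
  change (q : ℤ) ∣ blockA (γ.1 * (levi _ * translation _ _ _)) 0 1 ∧
    (q : ℤ) ∣ blockB (γ.1 * (levi _ * translation _ _ _)) 0 1 ∧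
    (q : ℤ) ^ 2 ∣ blockB (γ.1 * (levi _ * translation _ _ _)) 0 0
  simp only [← mul_assoc, ← hγ', blockA_mul_translation, blockB_mul_translation, Matrix.add_apply,
    Matrix.mul_apply, Fin.sum_univ_two, Matrix.of_apply, Matrix.cons_val', Matrix.cons_val_zero,
    Matrix.cons_val_one, Matrix.cons_val_fin_one, mul_zero, add_zero]
  refine ⟨hj, hy, ?_⟩
  rw [add_assoc]
  exact_mod_cast hx

theorem heckeRepOf_injective (hq : q.Prime) (hqN : q ∣ N) {i j : HeckeIndex q} {γ : Gamma0 N}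
    (hi : γ * ⟨heckeRepOf i, heckeRep_mem N _ _ _⟩ ∈ heckeSubgroup N q)
    (hj : γ * ⟨heckeRepOf j, heckeRep_mem N _ _ _⟩ ∈ heckeSubgroup N q) : i = j := by
  have hlevi (j : Option ℤ) : levi (heckeRow j) ∈ Gamma0 N := by
    intro i l
    simp [blockC, levi]
  obtain ⟨i₀, y, x⟩ := i
  obtain ⟨j₀, y', x'⟩ := j
  rw [mem_heckeSubgroup_iff hq hqN] at hi hj
  change (q : ℤ) ∣ blockA (γ.1 * (levi _ * translation _ _ _)) 0 1 ∧
    (q : ℤ) ∣ blockB (γ.1 * (levi _ * translation _ _ _)) 0 1 ∧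
    (q : ℤ) ^ 2 ∣ blockB (γ.1 * (levi _ * translation _ _ _)) 0 0 at hi hj
  simp only [← mul_assoc, blockA_mul_translation, blockB_mul_translation, Matrix.add_apply,
    Matrix.mul_apply, Fin.sum_univ_two, Matrix.of_apply, Matrix.cons_val', Matrix.cons_val_zero,
    Matrix.cons_val_one, Matrix.cons_val_fin_one, mul_zero, add_zero] at hi hj
  have hij : i₀ = j₀ := by
    have h1 := hi.1
    have h2 := hj.1
    have h3 := exists_row_eq_one hqN γ.2
    have hn (h4 : (q : ℤ) ∣ blockA γ.1 0 0) (h5 : (q : ℤ) ∣ blockA γ.1 0 1) : False :=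
      not_dvd_blockA hq hqN γ.2 h5 h4
    rw [blockA_mul_levi] at h1 h2
    rcases i₀ with _ | u <;> rcases j₀ with _ | w <;>
      simp [heckeRow, Matrix.mul_apply] at h1 h2
    · rfl
    · exact (hn h1 ((dvd_add_right (h1.mul_right _)).1 h2)).elim
    · exact (hn h2 ((dvd_add_right (h2.mul_right _)).1 h1)).elim
    · congr 1
      refine eq_of_natCast_dvd_sub (isCoprime_of_not_dvd hq fun h =>
        hn h ((dvd_add_right (h.mul_right _)).1 h1)) ?_
      have h3 := dvd_sub h1 h2
      rwa [add_sub_add_right_eq_sub, ← mul_sub] at h3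
  subst hij
  set γ' := γ.1 * levi (heckeRow (i₀.map fun j : Fin q => ((j : ℕ) : ℤ))) with hγ'
  have h0 := isCoprime_of_not_dvd hq (not_dvd_blockA hq hqN (mul_mem γ.2 (hlevi _)) hi.1)
  have hy : y = y' := by
    refine eq_of_natCast_dvd_sub h0 ?_
    have h3 := dvd_sub hi.2.1 hj.2.1
    rwa [add_sub_add_right_eq_sub, ← mul_sub] at h3
  subst hy
  have h2 : IsCoprime (blockA γ' 0 0) ((q ^ 2 : ℕ) : ℤ) := by
    push_cast
    exact h0.pow_right
  have hx : x = x' := by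
    refine eq_of_natCast_dvd_sub h2 ?_
    have h3 := dvd_sub hi.2.2 hj.2.2
    rw [add_sub_add_right_eq_sub, add_sub_add_right_eq_sub, ← mul_sub] at h3
    exact_mod_cast h3
  rw [hx]

/-- The cosets of the Hecke operator are indexed by `HeckeIndex`. -/
theorem bijective_mk_heckeRepOf (hq : q.Prime) (hqN : q ∣ N) :
    Function.Bijective fun i : HeckeIndex q =>
      (Quotient.mk (QuotientGroup.rightRel (heckeSubgroup N q))
        (⟨heckeRepOf i, heckeRep_mem N _ _ _⟩ : Gamma0 N)⁻¹) := by
  constructor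
  · intro i j h
    have h1 := QuotientGroup.rightRel_apply.1 (Quotient.exact h)
    rw [inv_inv] at h1
    refine heckeRepOf_injective hq hqN h1 ?_
    rw [inv_mul_cancel]
    exact one_mem _
  · intro c
    induction c using Quotient.inductionOn with
    | _ γ =>
    obtain ⟨i, hi⟩ := exists_mul_heckeRepOf_mem hq hqN γ
    refine ⟨i, Quotient.sound (QuotientGroup.rightRel_apply.2 ?_)⟩
    rwa [inv_inv]

/-- Sums over the cosets of the Hecke operator. -/
theorem finsum_hecke (hq : q.Prime) (hqN : q ∣ N) (F : Gamma0 N → ℂ)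
    (hF : ∀ h ∈ heckeSubgroup N q, ∀ γ, F (h * γ) = F γ) :
    ∑ᶠ c : Quotient (QuotientGroup.rightRel (heckeSubgroup N q)), F c.out =
      ∑ i : HeckeIndex q, F (⟨heckeRepOf i, heckeRep_mem N _ _ _⟩ : Gamma0 N)⁻¹ := by
  rw [← finsum_eq_of_bijective _ (bijective_mk_heckeRepOf hq hqN) (f := fun i : HeckeIndex q =>
    F (⟨heckeRepOf i, heckeRep_mem N _ _ _⟩ : Gamma0 N)⁻¹), finsum_eq_sum_of_fintype]
  intro i
  have h1 := QuotientGroup.rightRel_apply.1 (Quotient.exact (Quotient.out_eq (Quotient.mk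
    (QuotientGroup.rightRel (heckeSubgroup N q))
        (⟨heckeRepOf i, heckeRep_mem N _ _ _⟩ : Gamma0 N)⁻¹)))
  exact (congrArg F (inv_mul_cancel_right _ _)).symm.trans (hF _ h1 _)

end Representatives

/-! ### Sums over residues modulo `q` and `q²` -/

section ResidueSums

variable {q : ℕ}

theorem sum_fin_natCast [NeZero q] (F : ZMod q → ℂ) :
    ∑ x : Fin q, F ((x : ℕ) : ZMod q) = ∑ z, F z := by
  refine Fintype.sum_bijective _ ?_ _ _ fun _ => rfl
  rw [Fintype.bijective_iff_injective_and_card]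
  refine ⟨fun x y h => ?_, by simp⟩
  rw [ZMod.natCast_eq_natCast_iff', Nat.mod_eq_of_lt x.2, Nat.mod_eq_of_lt y.2] at h
  exact Fin.ext h

theorem sum_fin_sq (f : ℕ → ℂ) :
    ∑ x : Fin (q ^ 2), f x = ∑ t : Fin q, ∑ i : Fin q, f (i + q * t) := by
  rw [← Fintype.sum_prod_type', ← (finProdFinEquiv.trans (finCongr (sq q).symm)).sum_comp]
  rfl

theorem sum_fin_ite_dvd {n : ℕ} (hn : n ≠ 0) {a : ℤ} (ha : IsCoprime a (n : ℤ)) (b : ℤ) (t : ℂ) :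
    ∑ x : Fin n, (if (n : ℤ) ∣ a * (x : ℕ) + b then t else 0) = t := by
  obtain ⟨x, hx⟩ := exists_natCast_dvd_add hn ha b
  rw [Finset.sum_eq_single x, if_pos hx]
  · intro y _ hy
    refine if_neg fun h => hy (eq_of_natCast_dvd_sub ha ?_)
    have h3 := dvd_sub h hx
    rwa [add_sub_add_right_eq_sub, ← mul_sub] at h3
  · simp

open scoped Classical in
theorem sum_dirichletCharacter [Fact q.Prime] (ψ : DirichletCharacter ℂ q) :
    ∑ z : ZMod q, ψ z = if ψ = 1 then (q : ℂ) - 1 else 0 := by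
  split_ifs with h
  · have h1 := MulChar.sum_one_eq_card_units (R := ZMod q) (R' := ℂ)
    rw [h, h1, ZMod.card_units_eq_totient, Nat.totient_prime Fact.out,
      Nat.cast_sub (Fact.out : q.Prime).one_le, Nat.cast_one]
  · exact MulChar.sum_eq_zero_of_ne_one h

open scoped Classical in
theorem sum_dirichletCharacter_affine [Fact q.Prime] (ψ : DirichletCharacter ℂ q) {c : ZMod q}
    (hc : c ≠ 0) (u : ZMod q) :
    ∑ x : Fin q, ψ (u + c * ((x : ℕ) : ZMod q)) = if ψ = 1 then (q : ℂ) - 1 else 0 := by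
  rw [sum_fin_natCast fun z => ψ (u + c * z), ← sum_dirichletCharacter]
  exact ((Equiv.mulLeft₀ c hc).trans (Equiv.addLeft u)).sum_comp fun z => ψ z

end ResidueSums

/-! ### Sums over translations at the prime `q` -/

section LocalSums

variable {q : ℕ} [hq : Fact q.Prime] (ψ : DirichletCharacter ℂ q)

/-- The contribution of primitive vectors `u` for which `dilate q u` is primitive. -/
noncomputable def dilateTermTwo (v : Plucker ℤ) : ℂ := ψ (v.a : ZMod q)

/-- The contribution of primitive vectors `u` for which `dilate q u` has content `q`. -/
noncomputable def dilateTermOne (v : Plucker ℤ) : ℂ :=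
  if (q : ℤ) ∣ v.a ∧ (q : ℤ) ∣ v.d then ψ ((v.a / q : ℤ) : ZMod q) else 0

/-- The contribution of primitive vectors `u` for which `dilate q u` has content `q²`. -/
noncomputable def dilateTermZero (v : Plucker ℤ) : ℂ :=
  if (q : ℤ) ^ 2 ∣ v.a ∧ (q : ℤ) ^ 2 ∣ v.d ∧ (q : ℤ) ∣ v.c then ψ (v.e : ZMod q) else 0

theorem natCast_ne_zero_of_prime : (q : ℤ) ≠ 0 := by exact_mod_cast hq.out.ne_zero

open scoped Classical in
-- As `x` runs modulo `q²`, the coordinate `a + c x` meets each residue modulo `q` exactly `q`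
-- times; the sum over `y` adds another `q`.
theorem sum_dilateTermTwo_of_not_dvd (v : Plucker ℤ) (hc : ¬ (q : ℤ) ∣ v.c) :
    ∑ y : Fin q, ∑ x : Fin (q ^ 2), dilateTermTwo ψ (v.act (translation (x : ℕ) (y : ℕ) 0).1) =
      q ^ 2 * if ψ = 1 then (q : ℂ) - 1 else 0 := by
  have hc' : (v.c : ZMod q) ≠ 0 := by rwa [Ne, ZMod.intCast_zmod_eq_zero_iff_dvd]
  simp only [dilateTermTwo, act_translation]
  rw [Finset.sum_const, Finset.card_univ, Fintype.card_fin,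
    sum_fin_sq fun x => ψ ((v.a + v.c * (x : ℤ) : ℤ) : ZMod q)]
  push_cast
  simp only [CharP.cast_eq_zero, zero_mul, add_zero, sum_dirichletCharacter_affine ψ hc']
  rw [Finset.sum_const, Finset.card_univ, Fintype.card_fin]
  simp only [nsmul_eq_mul]
  ring

theorem sum_dilateTermTwo_of_dvd (v : Plucker ℤ) (hc : (q : ℤ) ∣ v.c) :
    ∑ y : Fin q, ∑ x : Fin (q ^ 2), dilateTermTwo ψ (v.act (translation (x : ℕ) (y : ℕ) 0).1) =
      q ^ 3 * ψ (v.a : ZMod q) := by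
  have hc' : (v.c : ZMod q) = 0 := by rwa [ZMod.intCast_zmod_eq_zero_iff_dvd]
  simp only [dilateTermTwo, act_translation]
  push_cast
  simp [hc']
  ring

open scoped Classical in
-- The divisibility conditions determine `y` and `x` modulo `q`. Writing `x = i + q t`, the quotient
-- of `a + c x` by `q` then runs over all residues as `t` varies.
theorem sum_dilateTermOne_of_not_dvd (v : Plucker ℤ) (hv : v.Isotropic) (hc : ¬ (q : ℤ) ∣ v.c) :
    ∑ y : Fin q, ∑ x : Fin (q ^ 2), dilateTermOne ψ (v.act (translation (x : ℕ) (y : ℕ) 0).1) =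
      if ψ = 1 then (q : ℂ) - 1 else 0 := by
  have hq0 := natCast_ne_zero_of_prime (q := q)
  have hp := Nat.prime_iff_prime_int.1 hq.out
  have hc' : (v.c : ZMod q) ≠ 0 := by rwa [Ne, ZMod.intCast_zmod_eq_zero_iff_dvd]
  have hcop := isCoprime_of_not_dvd hq.out hc
  -- Isotropy of the translated vector shows, once `q` divides its `a` and since `q ∤ c`, that `q`
  -- divides its `d` exactly when it divides its `b`.
  have hterm (y : Fin q) (x : Fin (q ^ 2)) :
      dilateTermOne ψ (v.act (translation (x : ℕ) (y : ℕ) 0).1) =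
        if (q : ℤ) ∣ v.c * (y : ℕ) + v.b then
          (if (q : ℤ) ∣ v.c * (x : ℕ) + v.a then ψ (((v.c * (x : ℕ) + v.a) / q : ℤ) : ZMod q)
            else 0) else 0 := by
    simp only [dilateTermOne, act_translation, mul_zero, add_zero, zero_sub]
    rw [← ite_and, add_comm (v.c * ((x : ℕ) : ℤ))]
    refine if_congr ?_ rfl rfl
    rw [and_comm]
    refine and_congr_left fun ha => ?_
    unfold Isotropic at hv
    constructor
    · intro h
      refine dvd_of_sq_dvd hq.out rfl ?_
      have : (v.c * (y : ℕ) + v.b) ^ 2 = (v.a + v.c * (x : ℕ)) * v.e -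
          v.c * (v.d + v.e * (x : ℕ) - 2 * v.b * (y : ℕ) + v.c * -((y : ℕ) : ℤ) ^ 2) := by
        linear_combination hv
      rw [this]
      exact dvd_sub (ha.mul_right _) (h.mul_left _)
    · intro h
      refine (hp.dvd_mul.1 ?_).resolve_left hc
      have : v.c * (v.d + v.e * (x : ℕ) - 2 * v.b * (y : ℕ) + v.c * -((y : ℕ) : ℤ) ^ 2) =
        (v.a + v.c * (x : ℕ)) * v.e - (v.c * (y : ℕ) + v.b) * (v.c * (y : ℕ) + v.b) := by
        linear_combination hv
      rw [this]
      exact dvd_sub (ha.mul_right _) (h.mul_left _)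
  have hx : ∑ x : Fin (q ^ 2), (if (q : ℤ) ∣ v.c * (x : ℕ) + v.a then
      ψ (((v.c * (x : ℕ) + v.a) / q : ℤ) : ZMod q) else 0) =
        if ψ = 1 then (q : ℂ) - 1 else 0 := by
    rw [sum_fin_sq fun x => if (q : ℤ) ∣ v.c * x + v.a then
      ψ (((v.c * x + v.a) / q : ℤ) : ZMod q) else 0, Finset.sum_comm]
    refine Eq.trans (Finset.sum_congr rfl fun i _ => ?_)
      (sum_fin_ite_dvd hq.out.ne_zero hcop v.a (if ψ = 1 then (q : ℂ) - 1 else 0))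
    have h3 (t : Fin q) : (q : ℤ) ∣ v.c * ((i + q * t : ℕ) : ℤ) + v.a ↔
        (q : ℤ) ∣ v.c * (i : ℕ) + v.a := by
      have : v.c * ((i + q * t : ℕ) : ℤ) + v.a = v.c * (i : ℕ) + v.a + q * (v.c * (t : ℕ)) := by
        push_cast
        ring
      rw [this]
      exact dvd_add_left (dvd_mul_right _ _)
    by_cases h1 : (q : ℤ) ∣ v.c * (i : ℕ) + v.a
    · obtain ⟨u, hu⟩ := id h1
      have h4 (t : Fin q) : (v.c * ((i + q * t : ℕ) : ℤ) + v.a) / q = u + v.c * (t : ℕ) := by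
        rw [Int.ediv_eq_iff_eq_mul_right hq0 ((h3 t).2 h1)]
        push_cast
        linear_combination hu
      simp only [(h3 _).2 h1, h1, if_true, h4]
      push_cast
      exact sum_dirichletCharacter_affine ψ hc' _
    · simp only [h3, h1, if_false, Finset.sum_const_zero]
  simp only [hterm]
  rw [← sum_fin_ite_dvd hq.out.ne_zero hcop v.b (if ψ = 1 then (q : ℂ) - 1 else 0)]
  refine Finset.sum_congr rfl fun y _ => ?_
  by_cases h : (q : ℤ) ∣ v.c * (y : ℕ) + v.b
  · simp only [if_pos h, hx]
  · simp only [if_neg h, Finset.sum_const_zero]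

/-- If `q` divides `c`, `a`, `d`, it divides `b` and not `e`, and `a e = c d + b²` forces `q² ∣ a`.
The quotient `a / q` is then zero modulo `q`. -/
theorem dilateTermOne_eq_zero {v : Plucker ℤ} (hv : v.Isotropic) (hp : v.Primitive)
    (hc : (q : ℤ) ∣ v.c) : dilateTermOne ψ v = 0 := by
  unfold Isotropic at hv
  refine ite_eq_right_iff.2 fun ⟨ha, hd⟩ => ?_
  have hb : (q : ℤ) ∣ v.b := by
    refine dvd_of_sq_dvd hq.out (y := v.a * v.e - v.c * v.d) (by linear_combination -hv) ?_
    exact dvd_sub (ha.mul_right _) (hc.mul_right _)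
  have he : ¬ (q : ℤ) ∣ v.e := fun he => hp q hq.out ⟨hc, ha, hb, he, hd⟩
  have h2 : (q : ℤ) ^ 2 ∣ v.a := by
    have h3 : IsCoprime ((q : ℤ) ^ 2) v.e := (isCoprime_of_not_dvd hq.out he).symm.pow_left
    refine h3.dvd_of_dvd_mul_right ?_
    rw [show v.a * v.e = v.c * v.d + v.b * v.b by linear_combination -hv, sq]
    exact dvd_add (mul_dvd_mul hc hd) (mul_dvd_mul hb hb)
  obtain ⟨t, ht⟩ := h2
  rw [ht, sq, mul_assoc, Int.mul_ediv_cancel_left _ natCast_ne_zero_of_prime]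
  push_cast
  rw [CharP.cast_eq_zero, zero_mul]
  exact MulChar.map_zero ψ

/-- Only `q ∤ e` and `q ∣ a` matter. For each `y` the condition on `d` then fixes `x` modulo `q²`,
and `q² ∣ a` follows from isotropy, so each of the `q` values of `y` contributes one term. -/
theorem sum_dilateTermZero_of_dvd {v : Plucker ℤ} (hv : v.Isotropic)
    (hc : (q : ℤ) ∣ v.c) :
    ∑ y : Fin q, ∑ x : Fin (q ^ 2), dilateTermZero ψ (v.act (translation (x : ℕ) (y : ℕ) 0).1) =
      q * if (q : ℤ) ∣ v.a then ψ (v.e : ZMod q) else 0 := by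
  unfold Isotropic at hv
  by_cases he : (q : ℤ) ∣ v.e
  · have : (v.e : ZMod q) = 0 := by rwa [ZMod.intCast_zmod_eq_zero_iff_dvd]
    have h0 : ψ 0 = 0 := MulChar.map_zero ψ
    simp [dilateTermZero, act_translation, this, h0]
  have hcop := isCoprime_of_not_dvd hq.out he
  have hcop2 : IsCoprime v.e ((q ^ 2 : ℕ) : ℤ) := by
    push_cast
    exact hcop.pow_right
  split_ifs with ha
  · have hb : (q : ℤ) ∣ v.b := by
      refine dvd_of_sq_dvd hq.out (y := v.a * v.e - v.c * v.d) (by linear_combination -hv) ?_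
      exact dvd_sub (ha.mul_right _) (hc.mul_right _)
    have hterm (y : Fin q) (x : Fin (q ^ 2)) :
        dilateTermZero ψ (v.act (translation (x : ℕ) (y : ℕ) 0).1) =
          if ((q ^ 2 : ℕ) : ℤ) ∣ v.e * (x : ℕ) + (v.d - 2 * v.b * (y : ℕ) - v.c * (y : ℕ) ^ 2) then
            ψ (v.e : ZMod q) else 0 := by
      simp only [dilateTermZero, act_translation, mul_zero, add_zero, zero_sub]
      refine if_congr ?_ rfl rfl
      have heq : v.d + v.e * (x : ℕ) - 2 * v.b * (y : ℕ) + v.c * -((y : ℕ) : ℤ) ^ 2 =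
          v.e * (x : ℕ) + (v.d - 2 * v.b * (y : ℕ) - v.c * (y : ℕ) ^ 2) := by ring
      rw [heq]
      push_cast
      refine ⟨fun h => h.2.1, fun h => ⟨?_, h, hc⟩⟩
      have h3 : IsCoprime ((q : ℤ) ^ 2) v.e := hcop.symm.pow_left
      refine h3.dvd_of_dvd_mul_right ?_
      have hb' : (q : ℤ) ∣ v.b + v.c * (y : ℕ) := dvd_add hb (hc.mul_right _)
      rw [show (v.a + v.c * (x : ℕ)) * v.e =
        v.c * (v.e * (x : ℕ) + (v.d - 2 * v.b * (y : ℕ) - v.c * (y : ℕ) ^ 2)) +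
          (v.b + v.c * (y : ℕ)) * (v.b + v.c * (y : ℕ)) by linear_combination -hv]
      exact dvd_add (h.mul_left _) (by rw [sq]; exact mul_dvd_mul hb' hb')
    simp only [hterm, sum_fin_ite_dvd (pow_ne_zero 2 hq.out.ne_zero) hcop2]
    simp
  · rw [mul_zero]
    refine Finset.sum_eq_zero fun y _ => Finset.sum_eq_zero fun x _ => ?_
    simp only [dilateTermZero, act_translation]
    refine if_neg fun h => ha ?_
    exact (dvd_add_left (hc.mul_right _)).1 ((dvd_pow_self _ two_ne_zero).trans h.1)

end LocalSums

/-! ### Sums over all Hecke representatives at the prime `q` -/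

section GlobalLocalSums

variable {q : ℕ}

/-- The first factor of the representative with a given first index. -/
def heckeLevi (j : Option (Fin q)) : Sp := levi (heckeRow (j.map fun j : Fin q => ((j : ℕ) : ℤ)))

theorem act_heckeLevi_none (v : Plucker ℤ) :
    v.act (heckeLevi (none : Option (Fin q))).1 = ⟨v.c, v.e, -v.b, v.a, v.d⟩ := by
  rw [heckeLevi, act_levi]
  simp [heckeRow]

theorem act_heckeLevi_some (v : Plucker ℤ) (j : Fin q) :
    v.act (heckeLevi (some j)).1 =
      ⟨v.c, v.a - 2 * (j : ℕ) * v.b + (j : ℕ) ^ 2 * v.e, v.b - (j : ℕ) * v.e, v.e, v.d⟩ := by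
  rw [heckeLevi, act_levi]
  simp [heckeRow]

theorem act_heckeLevi_c (v : Plucker ℤ) (j : Option (Fin q)) :
    (v.act (heckeLevi j).1).c = v.c := by
  cases j
  · rw [act_heckeLevi_none]
  · rw [act_heckeLevi_some]

theorem sum_heckeIndex (t : Plucker ℤ → ℂ) (v : Cusp) :
    ∑ i : HeckeIndex q, t (v.act (heckeRepOf i)).1 =
      ∑ j : Option (Fin q), ∑ y : Fin q, ∑ x : Fin (q ^ 2),
        t ((v.act (heckeLevi j)).1.act (translation (x : ℕ) (y : ℕ) 0).1) := by
  rw [Fintype.sum_prod_type]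
  refine Finset.sum_congr rfl fun j _ => ?_
  rw [Fintype.sum_prod_type]
  refine Finset.sum_congr rfl fun y _ => Finset.sum_congr rfl fun x _ => ?_
  have h : v.act (heckeRepOf (j, y, x)) =
      (v.act (heckeLevi j)).act (translation (x : ℕ) (y : ℕ) 0) := Cusp.act_mul _ _ _
  rw [h]
  rfl

variable [hq : Fact q.Prime] (ψ : DirichletCharacter ℂ q)

/-- The new `a` runs over the values of the form `(a b; b e)` at the `q + 1` points of `P¹(F_q)`. A
nonzero form of rank one vanishes at a single point and has constant `ψ` at the `q` others; at its
zero the new `e` is a nonzero value. -/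
theorem sum_heckeLevi {ψ : DirichletCharacter ℂ q} (hψ : ∀ x : ZMod q, x ≠ 0 → ψ x ^ 2 = 1)
    {v : Plucker ℤ} (hv : v.Isotropic) (hc : (q : ℤ) ∣ v.c) :
    (∑ j : Option (Fin q), ψ ((v.act (heckeLevi j).1).a : ZMod q) =
      q * localOne ψ (v.red q)) ∧
    (∑ j : Option (Fin q), if (q : ℤ) ∣ (v.act (heckeLevi j).1).a then
      ψ ((v.act (heckeLevi j).1).e : ZMod q) else 0) = localOne ψ (v.red q) := by
  have h0 : ψ 0 = 0 := MulChar.map_zero ψ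
  have hc' : (v.c : ZMod q) = 0 := by rwa [ZMod.intCast_zmod_eq_zero_iff_dvd]
  have hae : (v.a : ZMod q) * v.e = (v.b : ZMod q) ^ 2 := by
    have h := congrArg (Int.cast : ℤ → ZMod q) hv
    push_cast at h
    rw [hc', zero_mul] at h
    exact (sub_eq_zero.1 h.symm)
  have hloc : localOne ψ (v.red q) =
      ψ (if (v.a : ZMod q) = 0 then (v.e : ZMod q) else (v.a : ZMod q)) := by
    simp [localOne, Plucker.red, Plucker.map, hc']
  rw [hloc]
  simp only [Fintype.sum_option, act_heckeLevi_none, act_heckeLevi_some]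
  simp only [← ZMod.intCast_zmod_eq_zero_iff_dvd]
  push_cast
  rw [sum_fin_natCast fun z : ZMod q => ψ ((v.a : ZMod q) - 2 * z * (v.b : ZMod q) + z ^ 2 * (v.e : ZMod q)),
    sum_fin_natCast fun z : ZMod q => if (v.a : ZMod q) - 2 * z * (v.b : ZMod q) + z ^ 2 * (v.e : ZMod q) = 0 then
      ψ (v.e : ZMod q) else 0]
  generalize (v.a : ZMod q) = a at *
  generalize (v.b : ZMod q) = b at *
  generalize (v.e : ZMod q) = e at *
  by_cases he : e = 0
  · subst he
    have hb : b = 0 := by simpa using hae.symm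
    subst hb
    constructor
    · by_cases ha : a = 0 <;> simp [ha, h0, ZMod.card]
    · by_cases ha : a = 0 <;> simp [ha, h0]
  -- Because `a e = b²`, multiplying the polynomial by `e` gives the square of `z e - b`, so it has
  -- one root.
  · have hval (z : ZMod q) : a - 2 * z * b + z ^ 2 * e = 0 ↔ z = b / e := by
      rw [eq_div_iff he, ← sub_eq_zero (a := z * e), ← sq_eq_zero_iff (a := z * e - b)]
      rw [← mul_eq_zero_iff_right he]
      rw [show (a - 2 * z * b + z ^ 2 * e) * e = (z * e - b) ^ 2 by linear_combination hae]
    have hone (z : ZMod q) : ψ (a - 2 * z * b + z ^ 2 * e) =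
        if z = b / e then 0 else ψ (if a = 0 then e else a) := by
      split_ifs with hz ha
      · rw [(hval z).2 hz, h0]
      all_goals
        have h1 := quadratic_value ψ hψ hae 1 (-z)
          (fun h => hz ((hval z).1 (by linear_combination h)))
        rw [show (1 : ZMod q) ^ 2 * a + 2 * 1 * (-z) * b + (-z) ^ 2 * e =
          a - 2 * z * b + z ^ 2 * e by ring] at h1
        simpa [ha] using h1
    have hE : ψ e = ψ (if a = 0 then e else a) := by
      have h1 := quadratic_value ψ hψ hae 0 1 (by simpa using he)
      simpa using h1
    simp only [hone, hval]
    rw [if_neg he, zero_add, hE]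
    refine ⟨?_, by simp⟩
    rw [Finset.sum_ite]
    simp only [Finset.sum_const_zero, Finset.sum_const, zero_add, nsmul_eq_mul]
    rw [Finset.filter_not, Finset.card_sdiff_of_subset (Finset.filter_subset _ _), Finset.filter_eq' _ (b / e),
      if_pos (Finset.mem_univ _), Finset.card_singleton, Finset.card_univ, ZMod.card,
      Nat.cast_sub hq.out.one_le]
    push_cast
    ring

open scoped Classical in
-- The Levi factors preserve `c`, so each of the `q + 1` points contributes the same amount and `(q
-- + 1)(q - 1) = q² - 1` appears.
theorem sum_dilateTerm_of_not_dvd (v : Cusp) (hc : ¬ (q : ℤ) ∣ v.1.c) :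
    (∑ i : HeckeIndex q, dilateTermTwo ψ (v.act (heckeRepOf i)).1 =
      q ^ 2 * ((q : ℂ) ^ 2 - 1) * if ψ = 1 then 1 else 0) ∧
    (∑ i : HeckeIndex q, dilateTermOne ψ (v.act (heckeRepOf i)).1 =
      ((q : ℂ) ^ 2 - 1) * if ψ = 1 then 1 else 0) ∧
    ∑ i : HeckeIndex q, dilateTermZero ψ (v.act (heckeRepOf i)).1 = 0 := by
  have hc' (j : Option (Fin q)) : ¬ (q : ℤ) ∣ (v.act (heckeLevi j)).1.c := by
    change ¬ (q : ℤ) ∣ (v.1.act (heckeLevi j).1).c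
    rwa [act_heckeLevi_c]
  rw [sum_heckeIndex, sum_heckeIndex, sum_heckeIndex]
  refine ⟨?_, ?_, ?_⟩
  · simp only [sum_dilateTermTwo_of_not_dvd ψ _ (hc' _)]
    simp only [Finset.sum_const, Finset.card_univ, Fintype.card_option, Fintype.card_fin,
      nsmul_eq_mul]
    split_ifs <;> push_cast <;> ring
  · simp only [sum_dilateTermOne_of_not_dvd ψ _ (v.act (heckeLevi _)).2.1 (hc' _)]
    simp only [Finset.sum_const, Finset.card_univ, Fintype.card_option, Fintype.card_fin,
      nsmul_eq_mul]
    split_ifs <;> push_cast <;> ring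
  · refine Finset.sum_eq_zero fun j _ => Finset.sum_eq_zero fun y _ => Finset.sum_eq_zero fun x _ =>
      if_neg fun h => hc' j ?_
    simpa only [act_translation] using h.2.2

theorem sum_dilateTerm_of_dvd {ψ : DirichletCharacter ℂ q}
    (hψ : ∀ x : ZMod q, x ≠ 0 → ψ x ^ 2 = 1) (v : Cusp) (hc : (q : ℤ) ∣ v.1.c) :
    (∑ i : HeckeIndex q, dilateTermTwo ψ (v.act (heckeRepOf i)).1 =
      q ^ 4 * localOne ψ (v.1.red q)) ∧
    (∑ i : HeckeIndex q, dilateTermOne ψ (v.act (heckeRepOf i)).1 = 0) ∧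
    ∑ i : HeckeIndex q, dilateTermZero ψ (v.act (heckeRepOf i)).1 =
      q * localOne ψ (v.1.red q) := by
  have hc' (j : Option (Fin q)) : (q : ℤ) ∣ (v.act (heckeLevi j)).1.c := by
    change (q : ℤ) ∣ (v.1.act (heckeLevi j).1).c
    rwa [act_heckeLevi_c]
  obtain ⟨h1, h2⟩ := sum_heckeLevi hψ v.2.1 hc
  rw [sum_heckeIndex, sum_heckeIndex, sum_heckeIndex]
  refine ⟨?_, ?_, ?_⟩
  · simp only [sum_dilateTermTwo_of_dvd ψ _ (hc' _)]
    rw [← Finset.mul_sum]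
    refine (congrArg _ h1).trans ?_
    ring
  · refine Finset.sum_eq_zero fun j _ => Finset.sum_eq_zero fun y _ => Finset.sum_eq_zero fun x _ =>
      dilateTermOne_eq_zero ψ ((v.act (heckeLevi j)).act _).2.1
        ((v.act (heckeLevi j)).act _).2.2 ?_
    simpa only [act_translation] using hc' j
  · simp only [sum_dilateTermZero_of_dvd ψ (v.act (heckeLevi _)).2.1 (hc' _)]
    rw [← Finset.mul_sum]
    exact congrArg _ h2

end GlobalLocalSums

/-! ### Effect of the dilation at the primes `p ≠ q` -/

section OtherPrimes

/-- The factor by which `dilateCusp` changes the local factor at a prime `p ≠ q`. -/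
noncomputable def dilateFactor (N₀ N₁ : ℕ) {p : ℕ} (ψ : DirichletCharacter ℂ p) (q m : ℕ) : ℂ :=
  if p ∣ N₀ then ψ q ^ m else if p ∣ N₁ then ψ q ^ m else ψ q ^ (2 - m)

theorem dilateExp_le {q : ℕ} (hq : q.Prime) (u : Cusp) : dilateExp hq u ≤ 2 := by
  rcases dilateExp_spec hq u with h | h | h <;> omega

/-- Modulo `p` the dilation only rescales coordinates by units: relative to `u`, the coordinate `d`
gains `q^(-m)`, `a` gains `q^(-m)`, and `c` gains `q^(2-m)`. For `p ∣ N₁` the sign of the exponent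
is immaterial because `ψ` is quadratic. -/
theorem localFactor_dilateCusp {N₀ N₁ p q : ℕ} (hp : p.Prime) (hq : q.Prime) (hpq : p ≠ q)
    (ψ : DirichletCharacter ℂ p) (hψ : p ∣ N₁ → ∀ x : ZMod p, x ≠ 0 → ψ x ^ 2 = 1) (u : Cusp) :
    localFactor N₀ N₁ ψ ((dilateCusp hq u).1.red p) =
      dilateFactor N₀ N₁ ψ q (dilateExp hq u) * localFactor N₀ N₁ ψ (u.1.red p) := by
  have := Fact.mk hp
  have hQ : (q : ZMod p) ≠ 0 := by
    rw [Ne, ZMod.natCast_eq_zero_iff]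
    exact fun h => hpq ((Nat.prime_dvd_prime_iff_eq hp hq).1 h)
  have hψQ : ψ q ≠ 0 := (hQ.isUnit.map ψ).ne_zero
  have hm := dilateExp_le hq u
  have hspec := Plucker.ext_iff.1 (dilateCusp_spec hq u)
  generalize dilateExp hq u = m at *
  generalize dilateCusp hq u = w at *
  simp only [Plucker.map, dilate] at hspec
  obtain ⟨hc, ha, hb, he, hd⟩ := hspec
  replace hc := congrArg (Int.cast : ℤ → ZMod p) hc
  replace ha := congrArg (Int.cast : ℤ → ZMod p) ha
  replace hb := congrArg (Int.cast : ℤ → ZMod p) hb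
  replace he := congrArg (Int.cast : ℤ → ZMod p) he
  replace hd := congrArg (Int.cast : ℤ → ZMod p) hd
  push_cast at hc ha hb he hd
  have hQm := pow_ne_zero m hQ
  have hQ2 := pow_ne_zero 2 hQ
  have zc : (w.1.c : ZMod p) = 0 ↔ (u.1.c : ZMod p) = 0 := by
    rw [← mul_eq_zero_iff_left hQm, hc, mul_eq_zero_iff_left hQ2]
  have za : (w.1.a : ZMod p) = 0 ↔ (u.1.a : ZMod p) = 0 := by
    rw [← mul_eq_zero_iff_left hQm, ha]
  have zb : (w.1.b : ZMod p) = 0 ↔ (u.1.b : ZMod p) = 0 := by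
    rw [← mul_eq_zero_iff_left hQm, hb, mul_eq_zero_iff_left hQ]
  have ze : (w.1.e : ZMod p) = 0 ↔ (u.1.e : ZMod p) = 0 := by
    rw [← mul_eq_zero_iff_left hQm, he, mul_eq_zero_iff_left hQ2]
  have hpow : ψ (q : ZMod p) ^ m * ψ (q : ZMod p) ^ (2 - m) = ψ (q : ZMod p) ^ 2 := by
    rw [← pow_add, Nat.add_sub_cancel' hm]
  have hψm := pow_ne_zero m hψQ
  unfold localFactor dilateFactor localZero localOne localTwo
  simp only [Plucker.red, Plucker.map, eq_intCast, zc, za, zb, ze]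
  split_ifs with h0 h00 h1 hc0 ha0
  · have h2 := congrArg (ψ⁻¹ : DirichletCharacter ℂ p) hd
    rw [map_mul, map_pow] at h2
    rw [← h2, ← mul_assoc, ← mul_pow]
    have h3 : ψ (q : ZMod p) * ψ⁻¹ (q : ZMod p) = 1 := by
      rw [← MulChar.mul_apply, mul_inv_cancel, MulChar.one_apply hQ.isUnit]
    rw [h3, one_pow, one_mul]
  · rw [mul_zero]
  · have h2 := congrArg ψ he
    rw [map_mul, map_mul, map_pow, map_pow, hψ h1 _ hQ, one_mul] at h2
    rw [← h2, ← mul_assoc, ← pow_add, ← two_mul, pow_mul, hψ h1 _ hQ, one_pow, one_mul]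
  · have h2 := congrArg ψ ha
    rw [map_mul, map_pow] at h2
    rw [← h2, ← mul_assoc, ← pow_add, ← two_mul, pow_mul, hψ h1 _ hQ, one_pow, one_mul]
  · rw [mul_zero]
  · have h2 := congrArg ψ hc
    rw [map_mul, map_mul, map_pow, map_pow, ← hpow, mul_assoc] at h2
    exact mul_left_cancel₀ hψm h2

end OtherPrimes

/-! ### The automorphy character -/

section Nebentypus

variable {N : ℕ} (χ : DirichletCharacter ℂ N)

/-- The automorphy character `γ ↦ conj (χ (det D_γ))`. -/
noncomputable def nebentypus (γ : Sp) : ℂ :=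
  (starRingEnd ℂ) (χ (((blockD γ).det : ℤ) : ZMod N))

theorem nebentypus_mul {γ : Sp} (hγ : γ ∈ Gamma0 N) (δ : Sp) :
    nebentypus χ (γ * δ) = nebentypus χ γ * nebentypus χ δ := by
  unfold nebentypus
  rw [← map_mul, ← map_mul]
  congr 2
  have hC : (blockC γ).map (Int.castRingHom (ZMod N)) = 0 := by
    ext i j
    simpa [ZMod.intCast_zmod_eq_zero_iff_dvd] using hγ i j
  have h (X : Matrix (Fin 2) (Fin 2) ℤ) :
      ((X.det : ℤ) : ZMod N) = (X.map (Int.castRingHom (ZMod N))).det :=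
    RingHom.map_det (Int.castRingHom (ZMod N)) X
  rw [h, h, h, blockD_mul, Matrix.map_add _ (map_add _), Matrix.map_mul, Matrix.map_mul, hC,
    Matrix.zero_mul, zero_add, Matrix.det_mul]

theorem nebentypus_one : nebentypus χ 1 = 1 := by
  simp [nebentypus, blockD_one]

theorem nebentypus_mul_inv {γ : Sp} (hγ : γ ∈ Gamma0 N) :
    nebentypus χ γ * nebentypus χ γ⁻¹ = 1 := by
  rw [← nebentypus_mul χ hγ, mul_inv_cancel, nebentypus_one]

theorem nebentypus_inv_heckeRepOf {q : ℕ} (i : HeckeIndex q) :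
    nebentypus χ (heckeRepOf i)⁻¹ = 1 := by
  have h := nebentypus_mul_inv χ (heckeRep_mem N (i.1.map fun j : Fin q => ((j : ℕ) : ℤ))
    ((i.2.1 : ℕ) : ℤ) ((i.2.2 : ℕ) : ℤ))
  have h1 : nebentypus χ (heckeRepOf i) = 1 := by
    simp [nebentypus, heckeRepOf, det_blockD_heckeRep]
  change nebentypus χ (heckeRepOf i) * _ = 1 at h
  rwa [h1, one_mul] at h

theorem nebentypus_eq_of_mul_delta1_eq {q : ℕ} (hq : q ≠ 0) {γ γ' : Sp}
    (h : toReal γ * delta1 q = delta1 q * toReal γ') : nebentypus χ γ' = nebentypus χ γ := by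
  obtain ⟨-, -, -, -, h1, h2⟩ := (mul_delta1_eq_iff hq _ _).1 h
  unfold nebentypus
  rw [Matrix.det_fin_two (blockD γ), h1, Matrix.det_fin_two_of, h2]
  congr 4
  ring

end Nebentypus

/-! ### The Hecke operator as an explicit finite sum -/

section Hecke

variable {N N₀ N₁ N₂ : ℕ} {χ : DirichletCharacter ℂ N} {q : ℕ}

/-- The Hecke operator on Eisenstein series, as a sum over explicit representatives of series over
cusps. -/
theorem heckeT1_eisenstein (k : ℕ) (hN : Squarefree N) (hρ : N₀ * N₁ * N₂ = N)
    (hχ : component χ N₁ ^ 2 = 1) (hq : q.Prime) (hqN : q ∣ N) {d : Fin 2 → ℤ}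
    (hd : IsCuspDiagonal N₀ N₁ N₂ d) {τ : Matrix (Fin 2) (Fin 2) ℂ} (hτ : τ ∈ upperHalfSpace) :
    heckeT1 k N χ q (eisenstein k N χ (cuspRep d)) τ =
      (q : ℂ) ^ ((k : ℤ) - 3) * ∑ i : HeckeIndex q, 1 / 2 * ∑' v : Cusp,
        (weight N₀ N₁ χ (dilateCusp hq (v.act (heckeRepOf i))).1 *
          (q : ℂ) ^ (((dilateExp hq (v.act (heckeRepOf i)) : ℤ) - 1) * k)) *
          linForm τ v.toComplex ^ (-(k : ℤ)) := by
  have hN₁ : N₁ ∣ N := ⟨N₀ * N₂, by rw [← hρ]; ring⟩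
  have hf : eisenstein k N χ (cuspRep d) = fun σ =>
      1 / 2 * ∑' v : Cusp, weight N₀ N₁ χ v.1 * linForm σ v.toComplex ^ (-(k : ℤ)) :=
    funext fun σ => eisenstein_eq_tsum k hN hρ hχ hd σ
  have hslash (γ : Sp) := slash_tsum hq k (fun v => weight N₀ N₁ χ v.1) γ hτ
  rw [heckeT1, hf]
  congr 1
  refine (finsum_hecke hq hqN (fun γ : Gamma0 N => nebentypus χ γ *
    slash k (fun σ => 1 / 2 * ∑' v : Cusp, weight N₀ N₁ χ v.1 *
      linForm σ v.toComplex ^ (-(k : ℤ))) ((delta1 q)⁻¹ * toReal γ) τ) ?_).trans ?_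
  · intro h hh γ
    -- Independence of the representative: `h⁻¹` passes through the dilation as `h'`, where
    -- `weight_act` produces the character of `h⁻¹`, cancelling that of `h`.
    obtain ⟨h', hh'⟩ := inv_mem hh
    rw [hslash, hslash, mul_left_comm, mul_left_comm _ (1 / 2 : ℂ), ← tsum_mul_left (a := nebentypus χ _),
      ← tsum_mul_left (a := nebentypus χ _)]
    congr 1
    refine tsum_congr fun v => ?_
    have hact : v.act ((h * γ : Gamma0 N) : Sp)⁻¹ = (v.act (γ : Sp)⁻¹).act (h⁻¹ : Gamma0 N) := by
      rw [← Cusp.act_mul]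
      simp
    obtain ⟨h1, h2⟩ := dilateCusp_act hq hh' (v.act (γ : Sp)⁻¹)
    have h3 : weight N₀ N₁ χ ((dilateCusp hq (v.act (γ : Sp)⁻¹)).act h').1 =
        nebentypus χ h' * weight N₀ N₁ χ (dilateCusp hq (v.act (γ : Sp)⁻¹)).1 :=
      weight_act hN hN₁ hχ h'.2 (dilateCusp hq (v.act (γ : Sp)⁻¹)).2.1
    have h4 := nebentypus_mul_inv χ h.2
    have h5 : nebentypus χ h' = nebentypus χ (h : Sp)⁻¹ :=
      nebentypus_eq_of_mul_delta1_eq χ hq.ne_zero hh'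
    rw [hact, h1, h2, h3, h5, Subgroup.coe_mul, nebentypus_mul χ h.2]
    linear_combination (nebentypus χ γ * weight N₀ N₁ χ (dilateCusp hq (v.act (γ : Sp)⁻¹)).1 *
      (q : ℂ) ^ (((dilateExp hq (v.act (γ : Sp)⁻¹) : ℤ) - 1) * k) *
        linForm τ v.toComplex ^ (-(k : ℤ))) * h4
  · refine Finset.sum_congr rfl fun i _ => ?_
    have h1 : (((⟨heckeRepOf i, heckeRep_mem N _ _ _⟩ : Gamma0 N)⁻¹ : Gamma0 N) : Sp) =
      (heckeRepOf i)⁻¹ := rfl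
    simp only [h1]
    rw [nebentypus_inv_heckeRepOf, one_mul, hslash, inv_inv]

/-- The part of the weight away from `q`. -/
noncomputable def weightAway (N₀ N₁ : ℕ) (χ : DirichletCharacter ℂ N) (q : ℕ) (v : Plucker ℤ) : ℂ :=
  ∏ p ∈ N.primeFactors.erase q, localFactor N₀ N₁ (component χ p) (v.red p)

theorem weight_eq_mul_weightAway (hN : N ≠ 0) (hq : q.Prime) (hqN : q ∣ N) (v : Plucker ℤ) :
    weight N₀ N₁ χ v = localFactor N₀ N₁ (component χ q) (v.red q) * weightAway N₀ N₁ χ q v :=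
  (Finset.mul_prod_erase _ _ (Nat.mem_primeFactors.2 ⟨hq, hqN, hN⟩)).symm

/-- The factor by which `dilateCusp` changes the weight away from `q`. -/
noncomputable def dilateFactorAway (N₀ N₁ : ℕ) (χ : DirichletCharacter ℂ N) (q m : ℕ) : ℂ :=
  ∏ p ∈ N.primeFactors.erase q, dilateFactor N₀ N₁ (component χ p) q m

theorem weightAway_dilateCusp (hN : Squarefree N) (hN₁ : N₁ ∣ N) (hχ : component χ N₁ ^ 2 = 1)
    (hq : q.Prime) (v : Cusp) (i : HeckeIndex q) :
    weightAway N₀ N₁ χ q (dilateCusp hq (v.act (heckeRepOf i))).1 =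
      dilateFactorAway N₀ N₁ χ q (dilateExp hq (v.act (heckeRepOf i))) *
        weightAway N₀ N₁ χ q v.1 := by
  unfold weightAway dilateFactorAway
  rw [← Finset.prod_mul_distrib]
  refine Finset.prod_congr rfl fun p hp => ?_
  obtain ⟨hpq, hp⟩ := Finset.mem_erase.1 hp
  have hpp := Nat.prime_of_mem_primeFactors hp
  have hψ := fun (h : p ∣ N₁) (x : ZMod p) hx => component_prime_sq χ hN hN₁ hχ hpp h (x := x) hx
  rw [localFactor_dilateCusp hpp hq hpq _ hψ]
  congr 1
  refine (localFactor_act hpp _ hψ (heckeRep_mem p _ _ _) v.2.1).trans ?_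
  rw [det_blockD_heckeRep]
  simp

/-- Moving `q` from `N₁` to `N₂` changes only the factor at `q`. -/
theorem weightAway_div (hN₁ : q ∣ N₁) (hq : q.Prime) (v : Plucker ℤ) :
    weightAway N₀ (N₁ / q) χ q v = weightAway N₀ N₁ χ q v := by
  unfold weightAway
  refine Finset.prod_congr rfl fun p hp => ?_
  obtain ⟨hpq, hp⟩ := Finset.mem_erase.1 hp
  have hpp := Nat.prime_of_mem_primeFactors hp
  have h : p ∣ N₁ / q ↔ p ∣ N₁ := by
    obtain ⟨M, rfl⟩ := hN₁
    rw [Nat.mul_div_cancel_left _ hq.pos]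
    refine ⟨fun h => h.mul_left _, fun h => (hpp.dvd_mul.1 h).resolve_left fun h => ?_⟩
    exact hpq ((Nat.prime_dvd_prime_iff_eq hpp hq).1 h)
  simp only [localFactor, h]

end Hecke

/-! ### Evaluation of the constants away from `q` -/

section Factors

variable {N N₀ N₁ N₂ : ℕ} {χ : DirichletCharacter ℂ N} {q : ℕ}

theorem component_natCast_eq_prod (hN : Squarefree N) {M : ℕ} (h : M ∣ N) (a : ℕ) :
    component χ M (a : ZMod M) = ∏ p ∈ M.primeFactors, component χ p (a : ZMod p) := by
  have h1 := component_eq_prod χ hN h (a : ℤ)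
  simpa using h1

theorem component_natCast_ne_zero_sq (hN : Squarefree N) (hN₁ : N₁ ∣ N)
    (hχ : component χ N₁ ^ 2 = 1) {p : ℕ} (hp : p.Prime) (hpN : p ∣ N₁) (hq : q.Prime)
    (hpq : p ≠ q) : component χ p (q : ZMod p) ^ 2 = 1 := by
  have := Fact.mk hp
  refine component_prime_sq χ hN hN₁ hχ hp hpN ?_
  rw [Ne, ZMod.natCast_eq_zero_iff]
  exact fun h => hpq ((Nat.prime_dvd_prime_iff_eq hp hq).1 h)

theorem primeFactors_div_eq_erase (hN : Squarefree N) (hq : q.Prime) (hqN : q ∣ N) :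
    (N / q).primeFactors = N.primeFactors.erase q := by
  obtain ⟨M, rfl⟩ := hqN
  have hc := (Nat.squarefree_mul_iff.1 hN).1
  rw [Nat.mul_div_cancel_left _ hq.pos, hc.primeFactors_mul, hq.primeFactors, Finset.erase_union_distrib,
    Finset.erase_singleton, Finset.empty_union, Finset.erase_eq_of_notMem]
  exact fun h => (Nat.Prime.coprime_iff_not_dvd hq).1 hc (Nat.dvd_of_mem_primeFactors h)

theorem prod_component_sq (hN : Squarefree N) {M : ℕ} (hM : M ∣ N) (hqM : ¬ q ∣ M) :
    ∏ p ∈ N.primeFactors.erase q, (if p ∣ M then component χ p (q : ZMod p) ^ 2 else 1) =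
      component χ M ((q : ZMod M) ^ 2) := by
  have h1 := component_natCast_eq_prod (χ := χ) hN hM (q ^ 2)
  push_cast at h1
  have hM0 : M ≠ 0 := ne_zero_of_dvd_ne_zero hN.ne_zero hM
  rw [h1, ← Finset.prod_filter]
  refine Finset.prod_congr ?_ fun p _ => (map_pow _ _ _).symm
  ext p
  simp only [Finset.mem_filter, Finset.mem_erase, Nat.mem_primeFactors]
  constructor
  · rintro ⟨⟨-, hp, -, -⟩, h⟩
    exact ⟨hp, h, hM0⟩
  · rintro ⟨hp, h, -⟩
    exact ⟨⟨fun h' => hqM (h' ▸ h), hp, h.trans hM, hN.ne_zero⟩, h⟩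

theorem not_dvd_of_dvd_mul_squarefree {A B : ℕ} (hN : Squarefree N) (h : A * B ∣ N) {p : ℕ}
    (hp : p.Prime) (hA : p ∣ A) : ¬ p ∣ B := fun hB =>
  hp.not_isUnit (hN p ((mul_dvd_mul hA hB).trans h))

theorem dilateFactorAway_zero (hN : Squarefree N) (hρ : N₀ * N₁ * N₂ = N)
    (hq : q.Prime) (hqN : q ∣ N₁) :
    dilateFactorAway N₀ N₁ χ q 0 = component χ N₂ ((q : ZMod N₂) ^ 2) := by
  have h12 : N₁ * N₂ ∣ N := ⟨N₀, by rw [← hρ]; ring⟩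
  have h02 : N₀ * N₂ ∣ N := ⟨N₁, by rw [← hρ]; ring⟩
  rw [← prod_component_sq hN ((dvd_mul_left _ _).trans h12)
    (not_dvd_of_dvd_mul_squarefree hN h12 hq hqN)]
  refine Finset.prod_congr rfl fun p hp => ?_
  obtain ⟨hpp, hpN, -⟩ := Nat.mem_primeFactors.1 (Finset.mem_of_mem_erase hp)
  unfold dilateFactor
  split_ifs with h1 h2 h3 h4 h5
  · exact absurd h2 (not_dvd_of_dvd_mul_squarefree hN h02 hpp h1)
  · simp
  · exact absurd h4 (not_dvd_of_dvd_mul_squarefree hN h12 hpp h3)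
  · simp
  · rfl
  · rw [← hρ, hpp.dvd_mul, hpp.dvd_mul] at hpN
    tauto

/-- For `m = 1` all three kinds of primes contribute the same factor `χ_p(q)`. -/
theorem dilateFactorAway_one (hN : Squarefree N) (hq : q.Prime) (hqN : q ∣ N) :
    dilateFactorAway N₀ N₁ χ q 1 = component χ (N / q) (q : ZMod (N / q)) := by
  rw [component_natCast_eq_prod hN (Nat.div_dvd_of_dvd hqN), primeFactors_div_eq_erase hN hq hqN]
  refine Finset.prod_congr rfl fun p hp => ?_
  simp [dilateFactor]

theorem dilateFactorAway_two (hN : Squarefree N) (hρ : N₀ * N₁ * N₂ = N)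
    (hχ : component χ N₁ ^ 2 = 1) (hq : q.Prime) (hqN : q ∣ N₁) :
    dilateFactorAway N₀ N₁ χ q 2 = component χ N₀ ((q : ZMod N₀) ^ 2) := by
  have h01 : N₀ * N₁ ∣ N := ⟨N₂, by rw [← hρ]⟩
  rw [← prod_component_sq hN ((dvd_mul_right _ _).trans h01)
    fun h => not_dvd_of_dvd_mul_squarefree hN h01 hq h hqN]
  refine Finset.prod_congr rfl fun p hp => ?_
  obtain ⟨hpq, hp⟩ := Finset.mem_erase.1 hp
  obtain ⟨hpp, hpN, -⟩ := Nat.mem_primeFactors.1 hp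
  unfold dilateFactor
  split_ifs with h1 h2
  · rfl
  · exact component_natCast_ne_zero_sq hN ((dvd_mul_left _ _).trans h01) hχ hpp h2 hq hpq
  · simp

end Factors

/-! ### Comparison of coefficients and conclusion -/

section Assembly

/-- The local factor at `q` of a dilated vector, by the content of the dilation. -/
theorem localOne_dilateCusp {q : ℕ} [hq : Fact q.Prime] {ψ : DirichletCharacter ℂ q}
    (hψ : ∀ x : ZMod q, x ≠ 0 → ψ x ^ 2 = 1) (k : ℕ) (K : ℕ → ℂ) (u : Cusp) :
    (q : ℂ) ^ ((k : ℤ) - 3) * (K (dilateExp hq.out u) *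
      (q : ℂ) ^ (((dilateExp hq.out u : ℤ) - 1) * k) * localOne ψ ((dilateCusp hq.out u).1.red q)) =
      (q : ℂ) ^ (-3 : ℤ) * K 0 * dilateTermTwo ψ u.1 +
        (q : ℂ) ^ ((k : ℤ) - 3) * K 1 * dilateTermOne ψ u.1 +
        (q : ℂ) ^ (2 * (k : ℤ) - 3) * K 2 * dilateTermZero ψ u.1 := by
  have h0 : ψ 0 = 0 := MulChar.map_zero ψ
  have hqZ := natCast_ne_zero_of_prime (q := q)
  have hqC : (q : ℂ) ≠ 0 := by exact_mod_cast hq.out.ne_zero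
  have hzero {x : ℤ} (hx : (q : ℤ) ∣ x) : ψ (x : ZMod q) = 0 := by
    rw [(ZMod.intCast_zmod_eq_zero_iff_dvd x q).2 hx, h0]
  have hq1 : (q : ℤ) ∣ (q : ℤ) ^ 2 := dvd_pow_self _ two_ne_zero
  have hspec := Plucker.ext_iff.1 (dilateCusp_spec hq.out u)
  have hexp := dilateExp_spec hq.out u
  have hu := u.2
  have hw := (dilateCusp hq.out u).2.1
  generalize dilateExp hq.out u = m at *
  generalize dilateCusp hq.out u = w at *
  simp only [Plucker.map, dilate] at hspec
  obtain ⟨hc, ha, hb, he, hd⟩ := hspec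
  have hloc : localOne ψ (w.1.red q) = if (q : ℤ) ∣ w.1.c then
      ψ (if (w.1.a : ZMod q) = 0 then (w.1.e : ZMod q) else (w.1.a : ZMod q)) else 0 := by
    simp [localOne, Plucker.red, Plucker.map, ZMod.intCast_zmod_eq_zero_iff_dvd]
  rw [hloc]
  -- The contents `1`, `q`, `q²` single out `dilateTermTwo`, `dilateTermOne`, `dilateTermZero`
  -- respectively; the other two terms vanish in each case.
  rcases hexp with ⟨rfl, h⟩ | ⟨rfl, h, h'⟩ | ⟨rfl, h⟩
  · have t1 : dilateTermOne ψ u.1 = 0 := if_neg h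
    have t0 : dilateTermZero ψ u.1 = 0 :=
      if_neg fun h' => h ⟨hq1.trans h'.1, hq1.trans h'.2.1⟩
    rw [pow_zero, one_mul] at hc ha he
    rw [t0, t1, dilateTermTwo, if_pos (hc ▸ hq1.mul_right _), ha]
    have hee : (w.1.e : ZMod q) = 0 := by
      rw [he]
      push_cast
      simp
    have : ψ (if (u.1.a : ZMod q) = 0 then (w.1.e : ZMod q) else (u.1.a : ZMod q)) =
        ψ (u.1.a : ZMod q) := by
      split_ifs with h1
      · rw [hee, h1]
      · rfl
    rw [this, Nat.cast_zero, zero_sub, neg_one_mul, show (-3 : ℤ) = ((k : ℤ) - 3) + -k by ring,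
      zpow_add₀ hqC]
    ring
  · have t2 : dilateTermTwo ψ u.1 = 0 := hzero h.1
    have t0 : dilateTermZero ψ u.1 = 0 := if_neg fun h0 => h' ⟨h0.1, h0.2.1⟩
    rw [pow_one] at hc ha he
    have hc2 : w.1.c = q * u.1.c := mul_left_cancel₀ hqZ (by rw [hc]; ring)
    have he2 : w.1.e = q * u.1.e := mul_left_cancel₀ hqZ (by rw [he]; ring)
    have ha2 : u.1.a / q = w.1.a := by
      rw [← ha, Int.mul_ediv_cancel_left _ hqZ]
    rw [t0, t2, dilateTermOne, if_pos h, if_pos (hc2 ▸ dvd_mul_right _ _), ha2]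
    have hee : (w.1.e : ZMod q) = 0 := by
      rw [he2]
      push_cast
      simp
    have : ψ (if (w.1.a : ZMod q) = 0 then (w.1.e : ZMod q) else (w.1.a : ZMod q)) =
        ψ (w.1.a : ZMod q) := by
      split_ifs with h1
      · rw [hee, h1]
      · rfl
    rw [this, Nat.cast_one, sub_self, zero_mul, zpow_zero]
    ring
  · have t2 : dilateTermTwo ψ u.1 = 0 := hzero (hq1.trans h.1)
    have t1 : dilateTermOne ψ u.1 = 0 := by
      refine ite_eq_right_iff.2 fun _ => hzero ?_
      rw [← ha, sq, mul_assoc, Int.mul_ediv_cancel_left _ hqZ]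
      exact dvd_mul_right _ _
    have hqq := pow_ne_zero 2 hqZ
    have hc2 : w.1.c = u.1.c := mul_left_cancel₀ hqq hc
    have he2 : w.1.e = u.1.e := mul_left_cancel₀ hqq he
    have hb2 : u.1.b = q * w.1.b := mul_left_cancel₀ hqZ (by rw [← hb]; ring)
    -- When `q ∣ c`, primitivity of `u` makes `e` a unit modulo `q`, so `e` may serve as the nonzero
    -- value of the rank one form.
    have hval : (if (q : ℤ) ∣ w.1.c then
        ψ (if (w.1.a : ZMod q) = 0 then (w.1.e : ZMod q) else (w.1.a : ZMod q)) else 0) =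
          dilateTermZero ψ u.1 := by
      unfold dilateTermZero
      rw [hc2, he2]
      by_cases hcu : (q : ℤ) ∣ u.1.c
      · have hall : (q : ℤ) ^ 2 ∣ u.1.a ∧ (q : ℤ) ^ 2 ∣ u.1.d ∧ (q : ℤ) ∣ u.1.c := ⟨h.1, h.2, hcu⟩
        rw [if_pos hcu, if_pos hall]
        have hne : (u.1.e : ZMod q) ≠ 0 := by
          rw [Ne, ZMod.intCast_zmod_eq_zero_iff_dvd]
          exact fun heu => hu.2 q hq.out ⟨hcu, hq1.trans h.1, ⟨_, hb2⟩, heu, hq1.trans h.2⟩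
        have hae : (w.1.a : ZMod q) * u.1.e = (w.1.b : ZMod q) ^ 2 := by
          have h1 := congrArg (Int.cast : ℤ → ZMod q) hw
          push_cast at h1
          rw [hc2, he2, (ZMod.intCast_zmod_eq_zero_iff_dvd _ q).2 hcu, zero_mul] at h1
          exact (sub_eq_zero.1 h1.symm)
        have h1 := quadratic_value ψ hψ hae 0 1 (by simpa using hne)
        rw [← h1]
        simp
      · rw [if_neg hcu, if_neg fun h' => hcu h'.2.2]
    rw [hval, t1, t2, show 2 * (k : ℤ) - 3 = ((k : ℤ) - 3) + k by ring, zpow_add₀ hqC]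
    norm_num
    ring

variable {N N₀ N₁ N₂ : ℕ} {χ : DirichletCharacter ℂ N} {q : ℕ}

open scoped Classical in
/-- The coefficients of the image of an Eisenstein series under the Hecke operator. -/
theorem sum_weight_dilateCusp (k : ℕ) (hN : Squarefree N) (hρ : N₀ * N₁ * N₂ = N)
    (hχ : component χ N₁ ^ 2 = 1) (hq : q.Prime) (hqN : q ∣ N₁) (v : Cusp) :
    (q : ℂ) ^ ((k : ℤ) - 3) * ∑ i : HeckeIndex q,
        weight N₀ N₁ χ (dilateCusp hq (v.act (heckeRepOf i))).1 *
          (q : ℂ) ^ (((dilateExp hq (v.act (heckeRepOf i)) : ℤ) - 1) * k) =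
      (component χ N₀ ((q : ZMod N₀) ^ 2) * (q : ℂ) ^ (2 * (k : ℤ) - 2) +
          component χ N₂ ((q : ZMod N₂) ^ 2) * (q : ℂ)) * weight N₀ N₁ χ v.1 +
      (if component χ q = 1 then (q : ℂ)⁻¹ *
          (component χ (N / q) (q : ZMod (N / q)) * (q : ℂ) ^ ((k : ℤ) - 2) +
            component χ N₂ ((q : ZMod N₂) ^ 2)) * ((q : ℂ) ^ 2 - 1) else 0) *
        weight N₀ (N₁ / q) χ v.1 := by
  have := Fact.mk hq
  have h01 : N₀ * N₁ ∣ N := ⟨N₂, by rw [← hρ]⟩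
  have hN₁ : N₁ ∣ N := (dvd_mul_left _ _).trans h01
  have hqC : (q : ℂ) ≠ 0 := by exact_mod_cast hq.ne_zero
  have hq0 : ¬ q ∣ N₀ := fun h => not_dvd_of_dvd_mul_squarefree hN h01 hq h hqN
  have hq1 : ¬ q ∣ N₁ / q := by
    refine not_dvd_of_dvd_mul_squarefree hN (A := q) ?_ hq dvd_rfl
    rwa [Nat.mul_div_cancel' hqN]
  have hψ := fun (x : ZMod q) hx => component_prime_sq χ hN hN₁ hχ hq hqN (x := x) hx
  have hf (v : Plucker ℤ) : localFactor N₀ N₁ (component χ q) (v.red q) =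
      localOne (component χ q) (v.red q) := by
    rw [localFactor, if_neg hq0, if_pos hqN]
  have hf' : localFactor N₀ (N₁ / q) (component χ q) (v.1.red q) =
      component χ q (v.1.c : ZMod q) := by
    rw [localFactor, if_neg hq0, if_neg hq1]
    rfl
  rw [weight_eq_mul_weightAway hN.ne_zero hq (hqN.trans hN₁) v.1,
    weight_eq_mul_weightAway hN.ne_zero hq (hqN.trans hN₁) v.1, hf, hf', weightAway_div hqN hq]
  have hterm (i : HeckeIndex q) :
      (q : ℂ) ^ ((k : ℤ) - 3) * (weight N₀ N₁ χ (dilateCusp hq (v.act (heckeRepOf i))).1 *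
          (q : ℂ) ^ (((dilateExp hq (v.act (heckeRepOf i)) : ℤ) - 1) * k)) =
      ((q : ℂ) ^ (-3 : ℤ) * dilateFactorAway N₀ N₁ χ q 0 *
          dilateTermTwo (component χ q) (v.act (heckeRepOf i)).1 +
        (q : ℂ) ^ ((k : ℤ) - 3) * dilateFactorAway N₀ N₁ χ q 1 *
          dilateTermOne (component χ q) (v.act (heckeRepOf i)).1 +
        (q : ℂ) ^ (2 * (k : ℤ) - 3) * dilateFactorAway N₀ N₁ χ q 2 *
          dilateTermZero (component χ q) (v.act (heckeRepOf i)).1) * weightAway N₀ N₁ χ q v.1 := by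
    rw [← localOne_dilateCusp hψ k (dilateFactorAway N₀ N₁ χ q),
      weight_eq_mul_weightAway hN.ne_zero hq (hqN.trans hN₁), hf,
      weightAway_dilateCusp hN hN₁ hχ hq]
    ring
  rw [Finset.mul_sum, Finset.sum_congr rfl fun i _ => hterm i, ← Finset.sum_mul,
    Finset.sum_add_distrib, Finset.sum_add_distrib, ← Finset.mul_sum, ← Finset.mul_sum,
    ← Finset.mul_sum, dilateFactorAway_zero hN hρ hq hqN,
    dilateFactorAway_one hN hq (hqN.trans hN₁), dilateFactorAway_two hN hρ hχ hq hqN]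
  have e1 : (q : ℂ) ^ (2 * (k : ℤ) - 2) = (q : ℂ) ^ (2 * (k : ℤ) - 3) * q := by
    rw [← zpow_add_one₀ hqC]
    congr 1
    ring
  have e2 : (q : ℂ) ^ ((k : ℤ) - 2) = (q : ℂ) ^ ((k : ℤ) - 3) * q := by
    rw [← zpow_add_one₀ hqC]
    congr 1
    ring
  have e3 : (q : ℂ) ^ (-3 : ℤ) = ((q : ℂ) ^ 3)⁻¹ := by
    rw [zpow_neg]
    rfl
  rw [e1, e2, e3]
  -- The local factors at `q` for `ρ` and `ρ'` are supported on `q ∣ c` and `q ∤ c` respectively, so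
  -- each case sees one of the two series.
  by_cases hc : (q : ℤ) ∣ v.1.c
  · obtain ⟨s2, s1, s0⟩ := sum_dilateTerm_of_dvd hψ v hc
    have hz : component χ q (v.1.c : ZMod q) = 0 := by
      rw [(ZMod.intCast_zmod_eq_zero_iff_dvd _ q).2 hc]
      exact MulChar.map_zero _
    rw [s2, s1, s0, hz]
    field_simp
    ring
  · obtain ⟨s2, s1, s0⟩ := sum_dilateTerm_of_not_dvd (component χ q) v hc
    have hc' : (v.1.c : ZMod q) ≠ 0 := by rwa [Ne, ZMod.intCast_zmod_eq_zero_iff_dvd]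
    have hl : localOne (component χ q) (v.1.red q) = 0 := if_neg hc'
    rw [s2, s1, s0, hl]
    split_ifs with h1
    · rw [h1, MulChar.one_apply hc'.isUnit]
      field_simp
      ring
    · ring

theorem norm_localFactor_le {N₀ N₁ p : ℕ} (ψ : DirichletCharacter ℂ p) (v : Plucker (ZMod p)) :
    ‖localFactor N₀ N₁ ψ v‖ ≤ 1 := by
  unfold localFactor localZero localOne localTwo
  split_ifs <;> first | exact DirichletCharacter.norm_le_one _ _ | simp

theorem norm_weight_le (v : Plucker ℤ) : ‖weight N₀ N₁ χ v‖ ≤ 1 := by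
  rw [weight, norm_prod]
  exact Finset.prod_le_one (fun _ _ => norm_nonneg _) fun p _ => norm_localFactor_le _ _

theorem component_div_sq (hN : Squarefree N) (hN₁ : N₁ ∣ N) (hχ : component χ N₁ ^ 2 = 1)
    (hqN : q ∣ N₁) : component χ (N₁ / q) ^ 2 = 1 := by
  have hd := (Nat.div_dvd_of_dvd hqN).trans hN₁
  refine MulChar.ext fun u => ?_
  obtain ⟨a, ha⟩ := ZMod.intCast_surjective (u : ZMod (N₁ / q))
  rw [MulChar.one_apply_coe, MulChar.pow_apply_coe, ← ha, component_eq_prod χ hN hd,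
    ← Finset.prod_pow]
  refine Finset.prod_eq_one fun p hp => ?_
  have hpp := Nat.prime_of_mem_primeFactors hp
  have := Fact.mk hpp
  have hpd := Nat.dvd_of_mem_primeFactors hp
  refine component_prime_sq χ hN hN₁ hχ hpp (hpd.trans (Nat.div_dvd_of_dvd hqN)) ?_
  have h1 := u.isUnit
  rw [← ha] at h1
  have h2 := h1.map (ZMod.castHom hpd (ZMod p))
  rw [map_intCast] at h2
  exact h2.ne_zero

open scoped Classical in
-- Absolute convergence allows the finite sum over representatives to enter the series, where the
-- coefficients are compared cusp by cusp.
theorem heckeT1_eisenstein_eq {k : ℕ} (hk : 4 ≤ k) (hN : Squarefree N) (hρ : N₀ * N₁ * N₂ = N)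
    (hχ : component χ N₁ ^ 2 = 1) (hq : q.Prime) (hqN : q ∣ N₁) {d d' : Fin 2 → ℤ}
    (hd : IsCuspDiagonal N₀ N₁ N₂ d) (hd' : IsCuspDiagonal N₀ (N₁ / q) (q * N₂) d')
    {τ : Matrix (Fin 2) (Fin 2) ℂ} (hτ : τ ∈ upperHalfSpace) :
    heckeT1 k N χ q (eisenstein k N χ (cuspRep d)) τ =
      (component χ N₀ ((q : ZMod N₀) ^ 2) * (q : ℂ) ^ (2 * (k : ℤ) - 2) +
          component χ N₂ ((q : ZMod N₂) ^ 2) * (q : ℂ)) * eisenstein k N χ (cuspRep d) τ +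
      (if component χ q = 1 then (q : ℂ)⁻¹ *
          (component χ (N / q) (q : ZMod (N / q)) * (q : ℂ) ^ ((k : ℤ) - 2) +
            component χ N₂ ((q : ZMod N₂) ^ 2)) * ((q : ℂ) ^ 2 - 1) else 0) *
        eisenstein k N χ (cuspRep d') τ := by
  have hN₁ : N₁ ∣ N := ⟨N₀ * N₂, by rw [← hρ]; ring⟩
  have hρ' : N₀ * (N₁ / q) * (q * N₂) = N := by
    obtain ⟨M, rfl⟩ := hqN
    rw [Nat.mul_div_cancel_left _ hq.pos, ← hρ]
    ring
  have hs (M : ℕ) : Summable fun v : Cusp => weight N₀ M χ v.1 * linForm τ v.toComplex ^ (-(k : ℤ)) :=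
    summable_linForm hk hτ fun v => norm_weight_le v.1
  have hq1 : (1 : ℝ) ≤ q := by exact_mod_cast hq.one_le
  have hsi (i : HeckeIndex q) : Summable fun v : Cusp =>
      (weight N₀ N₁ χ (dilateCusp hq (v.act (heckeRepOf i))).1 *
        (q : ℂ) ^ (((dilateExp hq (v.act (heckeRepOf i)) : ℤ) - 1) * k)) *
          linForm τ v.toComplex ^ (-(k : ℤ)) := by
    refine summable_linForm hk hτ (K := (q : ℝ) ^ (k : ℤ)) fun v => ?_
    rw [norm_mul, norm_zpow, Complex.norm_natCast, ← one_mul ((q : ℝ) ^ (k : ℤ))]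
    refine mul_le_mul (norm_weight_le _) ?_ (by positivity) zero_le_one
    -- As `m ≤ 2`, the exponent `(m - 1) k` is at most `k`.
    refine zpow_le_zpow_right₀ hq1 ?_
    have := dilateExp_le hq (v.act (heckeRepOf i))
    nlinarith
  rw [heckeT1_eisenstein k hN hρ hχ hq (hqN.trans hN₁) hd hτ, eisenstein_eq_tsum k hN hρ hχ hd,
    eisenstein_eq_tsum k hN hρ' (component_div_sq hN hN₁ hχ hqN) hd', ← Finset.mul_sum,
    ← Summable.tsum_finsetSum fun i _ => hsi i, mul_left_comm,
    mul_left_comm _ (1 / 2 : ℂ), mul_left_comm _ (1 / 2 : ℂ), ← mul_add]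
  congr 1
  rw [← tsum_mul_left, ← tsum_mul_left, ← tsum_mul_left,
    ← ((hs N₁).mul_left _).tsum_add ((hs (N₁ / q)).mul_left _)]
  refine tsum_congr fun v => ?_
  rw [← Finset.sum_mul, ← mul_assoc, sum_weight_dilateCusp k hN hρ hχ hq hqN]
  ring

end Assembly

end SiegelDegTwo

theorem proposition3p9 (k : ℕ) (hk : 4 ≤ k) (N N₀ N₁ N₂ : ℕ) (hN : Squarefree N)
    (hρ : N₀ * N₁ * N₂ = N) (χ : DirichletCharacter ℂ N)
    (hχ : SiegelDegTwo.component χ N₁ ^ 2 = 1)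
    (q : ℕ) (hq : q.Prime) (hqN : q ∣ N₁)
    (d d' : Fin 2 → ℤ) (hd : SiegelDegTwo.IsCuspDiagonal N₀ N₁ N₂ d)
    (hd' : SiegelDegTwo.IsCuspDiagonal N₀ (N₁ / q) (q * N₂) d')
    (τ : Matrix (Fin 2) (Fin 2) ℂ) (hτ : τ ∈ SiegelDegTwo.upperHalfSpace) :
    (SiegelDegTwo.component χ q = 1 →
      SiegelDegTwo.heckeT1 k N χ q
          (SiegelDegTwo.eisenstein k N χ (SiegelDegTwo.cuspRep d)) τ =
        (SiegelDegTwo.component χ N₀ ((q : ZMod N₀) ^ 2) * (q : ℂ) ^ (2 * (k : ℤ) - 2) +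
            SiegelDegTwo.component χ N₂ ((q : ZMod N₂) ^ 2) * (q : ℂ)) *
          SiegelDegTwo.eisenstein k N χ (SiegelDegTwo.cuspRep d) τ +
        (q : ℂ)⁻¹ *
            (SiegelDegTwo.component χ (N / q) (q : ZMod (N / q)) * (q : ℂ) ^ ((k : ℤ) - 2) +
              SiegelDegTwo.component χ N₂ ((q : ZMod N₂) ^ 2)) *
            ((q : ℂ) ^ 2 - 1) *
          SiegelDegTwo.eisenstein k N χ (SiegelDegTwo.cuspRep d') τ) ∧
    (SiegelDegTwo.component χ q ≠ 1 →
      SiegelDegTwo.heckeT1 k N χ q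
          (SiegelDegTwo.eisenstein k N χ (SiegelDegTwo.cuspRep d)) τ =
        (SiegelDegTwo.component χ N₀ ((q : ZMod N₀) ^ 2) * (q : ℂ) ^ (2 * (k : ℤ) - 2) +
            SiegelDegTwo.component χ N₂ ((q : ZMod N₂) ^ 2) * (q : ℂ)) *
          SiegelDegTwo.eisenstein k N χ (SiegelDegTwo.cuspRep d) τ) := by
  have h := SiegelDegTwo.heckeT1_eisenstein_eq hk hN hρ hχ hq hqN hd hd' hτ
  refine ⟨fun h1 => ?_, fun h1 => ?_⟩
  · rw [h, if_pos h1]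
  · rw [h, if_neg h1, zero_mul, add_zero]
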